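/- Let $n,p\ge 1$ be integers. Let $\mathfrak{osp}(1|2n)$ be the Lie superalgebra generated by odd elements $B_1^\pm,\dots,B_n^\pm$ with relations $$[\{B_i^\xi,B_j^\eta\},B_l^\epsilon]=(\epsilon-\xi)\delta_{il}B_j^\eta+(\epsilon-\eta)\delta_{jl}B_i^\xi\qquad(\xi,\eta,\epsilon\in\{\pm1\}).$$ Let $\overline V_n(p)$ be the $\mathfrak{osp}(1|2n)$-module induced from the one-dimensional module $\mathbb C|0\rangle$ of the subalgebra spanned by all $\{B_i^+,B_j^-\}$, $B_i^-$, $\{B_i^-,B_j^-\}$, on which $B_i^-|0\rangle=0$ and $\{B_i^+,B_j^-\}|0\rangle=p\,\delta_{ij}|0\rangle$. For an integer $q\ge1$ let $\mathcal{C}\ell_q$ be the complex Clifford algebra with generators $e_1,\dots,e_q$, $\{e_\alpha,e_\beta\}=2\delta_{\alpha\beta}$. On $\mathbb C[x_{i,\alpha}:1\le i\le n,1\le\alpha\le q]\otimes\mathcal{C}\ell_q$ put $X_i=\sum_\alpha x_{i,\alpha}e_\alpha$ and $D_i=\sum_\alpha\partial_{x_{i,\alpha}}e_\alpha$ (with $e_\alpha$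 acting by left multiplication), and let $L_n(q)$ be the subspace generated from $1$ by the operators $X_i,D_i$; here $B_i^+$ acts as $X_i$ and $B_i^-$ as $D_i$. Let $\mathbb Y_n$ be the set of semistandard Young tableaux with entries in $\{1,\dots,n\}$, and $\mathbb Y_n(q)$ the subset of those with at most $q$ rows. For $A\in\mathbb Y_n$ with columns $a_1,\dots,a_m$ from left to right, and operators $b_1,\dots,b_n$, put $b_A=b_{a_m}\cdots b_{a_1}$, where $b_I=\sum_{\sigma\in S_k}\operatorname{sgn}(\sigma)\,b_{i_{\sigma(1)}}\cdots b_{i_{\sigma(k)}}$ for a column $I=(i_1<\dots<i_k)$; let $\lambda_A!$ be the product of the factorials of the column lengths of $A$. Put $$\tilde v_A(p)=\tfrac1{\lambda_A!}B_A^+|0\rangle\in\overline V_n(p),\qquad \tilde\omega_A(q)=\tfrac1{\lambda_A!}X_A(1)\in L_n(q).$$ Then $\{\tilde\omega_A(q):A\in\mathbb Y_n(q)\}$ is a basis of $L_n(q)$ for every $q\ge1$, and $\{\tilde v_A(p):A\in\mathbb Y_n\}$ is a basis of $\overline V_n(p)$. Let $\bar c_B(i,q,A)$ and $\hat c_B(i,q,A)$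 be the coefficients determined, for $A\in\mathbb Y_n(q)$, by $$X_i\tilde\omega_A(q)=\sum_{B\in\mathbb Y_n(q)}\bar c_B(i,q,A)\,\tilde\omega_B(q),\qquad D_i\tilde\omega_A(q)=\sum_{B\in\mathbb Y_n(q)}\hat c_B(i,q,A)\,\tilde\omega_B(q).$$ (For $q\ge n$ one has $\mathbb Y_n(q)=\mathbb Y_n$.) For all $i\in\{1,\dots,n\}$ and $A\in\mathbb Y_n$, $$B_i^+\tilde v_A(p)=\sum_{B\in\mathbb Y_n}\bar c_B(i,n,A)\,\tilde v_B(p),$$ $$B_i^-\tilde v_A(p)=\sum_{B\in\mathbb Y_n}\big((n+1-p)\,\hat c_B(i,n,A)-(n-p)\,\hat c_B(i,n+1,A)\big)\,\tilde v_B(p).$$ Moreover, for all $i\in\{1,\dots,n\}$ and $A\in\mathbb Y_n(p)$, $$X_i\tilde\omega_A(p)=\sum_{B\in\mathbb Y_n(p)}\bar c_B(i,n,A)\,\tilde\omega_B(p),$$ $$D_i\tilde\omega_A(p)=\sum_{B\in\mathbb Y_n(p)}\big((n+1-p)\,\hat c_B(i,n,A)-(n-p)\,\hat c_B(i,n+1,A)\big)\,\tilde\omega_B(p).$$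 -/

import Mathlib

open scoped TensorProduct

namespace Paraboson

noncomputable section

/-! ### The Lie superalgebra `osp(1|2n)` and its enveloping algebra -/

/-- The defining relations `[{B_i^ξ, B_j^η}, B_l^ε] = (ε - ξ) δ_{il} B_j^η + (ε - η) δ_{jl} B_i^ξ`
of `osp(1|2n)`, on free generators indexed by `i : Fin n` and a sign `±1 : ℤˣ`. -/
inductive Rel (n : ℕ) :
    FreeAlgebra ℂ (Fin n × ℤˣ) → FreeAlgebra ℂ (Fin n × ℤˣ) → Prop
  | triple (i j l : Fin n) (ξ η ε : ℤˣ) :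
      Rel n
        ((FreeAlgebra.ι ℂ (i, ξ) * FreeAlgebra.ι ℂ (j, η)
            + FreeAlgebra.ι ℂ (j, η) * FreeAlgebra.ι ℂ (i, ξ)) * FreeAlgebra.ι ℂ (l, ε)
          - FreeAlgebra.ι ℂ (l, ε) * (FreeAlgebra.ι ℂ (i, ξ) * FreeAlgebra.ι ℂ (j, η)
            + FreeAlgebra.ι ℂ (j, η) * FreeAlgebra.ι ℂ (i, ξ)))
        ((if i = l then (((ε : ℤ) - (ξ : ℤ) : ℤ) : ℂ) else 0) • FreeAlgebra.ι ℂ (j, η)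
          + (if j = l then (((ε : ℤ) - (η : ℤ) : ℤ) : ℂ) else 0) • FreeAlgebra.ι ℂ (i, ξ))

/-- The universal enveloping algebra of the Lie superalgebra `osp(1|2n)`, which is presented by
the odd generators `B_i^±` and the triple relations. -/
def UOsp (n : ℕ) : Type := RingQuot (Rel n)

instance (n : ℕ) : Ring (UOsp n) := inferInstanceAs (Ring (RingQuot (Rel n)))

instance (n : ℕ) : Algebra ℂ (UOsp n) := inferInstanceAs (Algebra ℂ (RingQuot (Rel n)))

/-- The generator `B_i^ξ`, for a sign `ξ = ±1`. -/
def gen (n : ℕ) (ξ : ℤˣ) (i : Fin n) : UOsp n :=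
  (RingQuot.mkAlgHom ℂ (Rel n) (FreeAlgebra.ι ℂ (i, ξ)) : RingQuot (Rel n))

/-! ### The induced module -/

/-- The left ideal generated by the elements `x - χ(x)`, where `x` runs through the spanning set
`B_i^-`, `{B_i^-, B_j^-}`, `{B_i^+, B_j^-}` of the parabolic subalgebra and `χ(x)` is the scalar
by which `x` acts on the vacuum: `0`, `0` and `p δ_{ij}` respectively. -/
def vacuumIdeal (n p : ℕ) : Ideal (UOsp n) :=
  Ideal.span
    (Set.range (fun i : Fin n => gen n (-1) i)
      ∪ Set.range (fun ij : Fin n × Fin n =>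
          gen n (-1) ij.1 * gen n (-1) ij.2 + gen n (-1) ij.2 * gen n (-1) ij.1)
      ∪ Set.range (fun ij : Fin n × Fin n =>
          gen n 1 ij.1 * gen n (-1) ij.2 + gen n (-1) ij.2 * gen n 1 ij.1
            - algebraMap ℂ (UOsp n) (if ij.1 = ij.2 then (p : ℂ) else 0)))

/-- The module induced from the one-dimensional module `ℂ|0⟩` of the parabolic subalgebra:
inducing a one-dimensional module with character `χ` gives the quotient of the enveloping algebra
by the left ideal generated by all `x - χ(x)`. -/
def VBar (n p : ℕ) : Type := UOsp n ⧸ vacuumIdeal n p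

instance (n p : ℕ) : AddCommGroup (VBar n p) :=
  inferInstanceAs (AddCommGroup (UOsp n ⧸ vacuumIdeal n p))

instance (n p : ℕ) : Module (UOsp n) (VBar n p) :=
  inferInstanceAs (Module (UOsp n) (UOsp n ⧸ vacuumIdeal n p))

instance (n p : ℕ) : Module ℂ (VBar n p) :=
  inferInstanceAs (Module ℂ (UOsp n ⧸ vacuumIdeal n p))

instance (n p : ℕ) : IsScalarTower ℂ (UOsp n) (VBar n p) :=
  inferInstanceAs (IsScalarTower ℂ (UOsp n) (UOsp n ⧸ vacuumIdeal n p))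

/-- The lowest weight vector `|0⟩`. -/
def vacuum (n p : ℕ) : VBar n p := (Submodule.Quotient.mk 1 : UOsp n ⧸ vacuumIdeal n p)

/-! ### Clifford algebra valued polynomials -/

/-- The complex Clifford algebra on `e_α`, `α : Fin p`, with `{e_α, e_β} = 2 δ_{αβ}`. -/
abbrev Cl (p : ℕ) : Type :=
  CliffordAlgebra (QuadraticMap.weightedSumSquares ℂ (fun _ : Fin p => (1 : ℂ)))

/-- The Clifford generator `e_α`. -/
def e {p : ℕ} (α : Fin p) : Cl p :=
  CliffordAlgebra.ι (QuadraticMap.weightedSumSquares ℂ (fun _ : Fin p => (1 : ℂ)))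
    (Pi.single α 1)

/-- Clifford algebra valued polynomials in the variables `x_{i,α}`. -/
abbrev ClPoly (n p : ℕ) : Type := MvPolynomial (Fin n × Fin p) ℂ ⊗[ℂ] Cl p

/-- `X_i = ∑_α x_{i,α} e_α`, as an operator. -/
def X (n p : ℕ) (i : Fin n) : Module.End ℂ (ClPoly n p) :=
  ∑ α : Fin p, TensorProduct.map
    (LinearMap.mulLeft ℂ (MvPolynomial.X (i, α) : MvPolynomial (Fin n × Fin p) ℂ))
    (LinearMap.mulLeft ℂ (e α))

/-- `D_i = ∑_α ∂_{i,α} e_α`, as an operator. -/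
def D (n p : ℕ) (i : Fin n) : Module.End ℂ (ClPoly n p) :=
  ∑ α : Fin p, TensorProduct.map
    (MvPolynomial.pderiv (R := ℂ) ((i, α) : Fin n × Fin p)).toLinearMap
    (LinearMap.mulLeft ℂ (e α))

/-- `L_n(p)`: the set of all `a(1)`, for `a` in the algebra of operators generated by the
`X_i` and `D_i`, that is, the `osp(1|2n)`-submodule generated by `1`. -/
def L (n p : ℕ) : Submodule ℂ (ClPoly n p) :=
  (Subalgebra.toSubmodule (Algebra.adjoin ℂ (Set.range (X n p) ∪ Set.range (D n p)))).map
    (LinearMap.applyₗ (1 : ClPoly n p))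

/-! ### Tableaux and tableau vectors -/

/-- Semistandard Young tableaux with entries in `{0, …, n-1}` (standing for `{1, …, n}`),
of arbitrary shape. -/
structure Tableau (n : ℕ) where
  shape : YoungDiagram
  filling : SemistandardYoungTableau shape
  entry_lt : ∀ {k l : ℕ}, (k, l) ∈ shape → filling k l < n

namespace Tableau

variable {n : ℕ}

/-- The number of rows. -/
def rows (A : Tableau n) : ℕ := A.shape.colLen 0

/-- The number of columns. -/
def cols (A : Tableau n) : ℕ := A.shape.rowLen 0

/-- The `l`-th column, from left to right, read downwards. -/
def col (A : Tableau n) (l : ℕ) (k : Fin (A.shape.colLen l)) : Fin n :=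
  ⟨A.filling k l, A.entry_lt (YoungDiagram.mem_iff_lt_colLen.mpr k.isLt)⟩

/-- `λ!`, the product of the factorials of the column lengths of the shape `λ`. -/
def shapeFactorial (A : Tableau n) : ℕ :=
  ∏ l ∈ Finset.range A.cols, (A.shape.colLen l).factorial

end Tableau

/-- The antisymmetrised product `∑_σ sgn(σ) b_{i_σ(1)} ⋯ b_{i_σ(k)}` for `I = (i_1, …, i_k)`. -/
def columnOp {R : Type*} [Ring R] {n k : ℕ} (b : Fin n → R) (I : Fin k → Fin n) : R :=
  ∑ σ : Equiv.Perm (Fin k),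
    ((Equiv.Perm.sign σ : ℤˣ) : ℤ) • (List.ofFn fun r => b (I (σ r))).prod

/-- `b_{a_m} ⋯ b_{a_1}`, where `a_1, …, a_m` are the columns of `A` from left to right. -/
def tableauOp {R : Type*} [Ring R] {n : ℕ} (b : Fin n → R) (A : Tableau n) : R :=
  (((List.range A.cols).map fun l => columnOp b (A.col l)).reverse).prod

/-- `v_A(p)`. -/
def v (n p : ℕ) (A : Tableau n) : VBar n p := tableauOp (gen n 1) A • vacuum n p

/-- `ω_A(p)`. -/
def ω (n p : ℕ) (A : Tableau n) : ClPoly n p := tableauOp (X n p) A 1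

/-- The normalised vector `v_A(p) / λ_A!`. -/
def vTilde (n p : ℕ) (A : Tableau n) : VBar n p := (A.shapeFactorial : ℂ)⁻¹ • v n p A

/-- The normalised vector `ω_A(p) / λ_A!`. -/
def ωTilde (n p : ℕ) (A : Tableau n) : ClPoly n p := (A.shapeFactorial : ℂ)⁻¹ • ω n p A

/-! ### Matrix elements -/

/-- The coordinates of `w` with respect to the normalised tableau vectors of `L_n(p)`, which are
indexed by the tableaux with at most `p` rows: the finitely supported `c` that vanishes on the
tableaux with more than `p` rows and satisfies `w = ∑_B c_B ω̃_B(p)`. -/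
def coords (n p : ℕ) (w : ClPoly n p) : Tableau n →₀ ℂ :=
  Classical.epsilon fun c : Tableau n →₀ ℂ =>
    (∀ B, p < B.rows → c B = 0) ∧ w = Finsupp.linearCombination ℂ (ωTilde n p) c

/-- The coefficients `c̄_B(i, p, A)` of `X_i ω̃_A(p)`, as a function of `B`. -/
def cBar (n p : ℕ) (i : Fin n) (A : Tableau n) : Tableau n →₀ ℂ :=
  coords n p (X n p i (ωTilde n p A))

/-- The coefficients `ĉ_B(i, p, A)` of `D_i ω̃_A(p)`, as a function of `B`. -/
def cHat (n p : ℕ) (i : Fin n) (A : Tableau n) : Tableau n →₀ ℂ :=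
  coords n p (D n p i (ωTilde n p A))

end

end Paraboson

/-! The matrix elements are controlled by one computation in the enveloping algebra. Words in the
`B_i^+` straighten to tableau products with coefficients that do not involve `p`. Pushing `B_i^-` to
the right through such a word creates anticommutators `{B_j^+, B_i^-}`; commuting one of these past
a further `B_l^+` gives either itself or a single `B_j^+`. The number `p` appears only when an
anticommutator reaches `|0⟩`, hence at most once in each term. So `B_i^-` acts on tableau vectors
with coefficients `c₀ + p c₁`, where `c₀` and `c₁` do not depend on `p` (`exists_lowering`,
`exists_lowering_tab`).

The polynomial `1` satisfies the vacuum relations with `p = q` (`realization_one_of_mem`), so the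
same coefficients describe `X_i` and `D_i` on the vectors `ω̃_A(q)`. For `q ≥ n` all these vectors
are independent and the coefficients can be read off. An affine function is determined by its values
at `n` and `n + 1`; this is `interpolation`. In `L_n(p)` the tableaux with more than `p` rows
contribute nothing, because `ω̃_B(p) = 0` for them (`ωTilde_eq_zero`).

Three facts support this argument.

Spanning is straightening by Garnir relations. A column is the top Grassmann coefficient of a power
of `η = ∑ b_{x_j} ⊗ θ_j`. As `{b_i, b_j}` commutes with all `b_l`, the anticommutator of `η` with a
generator anticommutes with `η`, and letters can be moved through powers of `η` explicitly. This
gives `garnir`, and an induction on column length and entry sum gives `genSpan_pow_le_tableauSpan`.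

Independence of the `ω̃_A(q)` with at most `q` rows comes from leading monomials: that of `A`
records how often each `i` occurs in each row, which determines a semistandard tableau, and its
Clifford coefficient is a unit.

Independence of the `ṽ_A(p)` for every `p` comes from letting `osp(1|2n)` act on the formal span of
all tableaux by these affine coefficients. The defining relations are polynomial in `p` and hold at
all integers `q ≥ n`, by comparison with Clifford polynomials, so they hold identically
(`tabOp_triple`). The resulting map out of the induced module sends `ṽ_A(p)` to the basis vector
`A`. -/

namespace Paraboson

/-! ### Antisymmetrised products -/

section ColumnOp

variable {R : Type*} [Ring R] {n : ℕ}

/-- The product `b_{f(0)} b_{f(1)} ⋯`. -/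
def wordOp (b : Fin n → R) {k : ℕ} (f : Fin k → Fin n) : R := (List.ofFn fun r => b (f r)).prod

/-- The linear span of the generators. -/
def genSpan [Algebra ℂ R] (b : Fin n → R) : Submodule ℂ R := Submodule.span ℂ (Set.range b)

/-- The linear span of the antisymmetrised products of `k` generators. -/
def colSpan [Algebra ℂ R] (b : Fin n → R) (k : ℕ) : Submodule ℂ R :=
  Submodule.span ℂ (Set.range fun I : Fin k → Fin n => columnOp b I)

lemma mem_genSpan [Algebra ℂ R] (b : Fin n → R) (i : Fin n) : b i ∈ genSpan b :=
  Submodule.subset_span ⟨i, rfl⟩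

lemma columnOp_mem_colSpan [Algebra ℂ R] (b : Fin n → R) {k : ℕ} (I : Fin k → Fin n) :
    columnOp b I ∈ colSpan b k := Submodule.subset_span ⟨I, rfl⟩

lemma columnOp_eq (b : Fin n → R) {k : ℕ} (I : Fin k → Fin n) :
    columnOp b I = ∑ σ : Equiv.Perm (Fin k),
      ((Equiv.Perm.sign σ : ℤˣ) : ℤ) • wordOp b (I ∘ σ) := rfl

lemma wordOp_zero (b : Fin n → R) (f : Fin 0 → Fin n) : wordOp b f = 1 := by
  simp [wordOp]

lemma wordOp_succ (b : Fin n → R) {k : ℕ} (f : Fin (k + 1) → Fin n) :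
    wordOp b f = b (f 0) * wordOp b (fun r => f r.succ) := by
  simp [wordOp, List.ofFn_succ]

lemma wordOp_mem [Algebra ℂ R] (b : Fin n → R) {k : ℕ} (f : Fin k → Fin n) : wordOp b f ∈ genSpan b ^ k := by
  induction k with
  | zero => rw [wordOp_zero, pow_zero]; exact Submodule.one_le.1 le_rfl
  | succ k ih =>
    rw [wordOp_succ, pow_succ']
    exact Submodule.mul_mem_mul (mem_genSpan b _) (ih _)

lemma colSpan_le [Algebra ℂ R] (b : Fin n → R) (k : ℕ) : colSpan b k ≤ genSpan b ^ k := by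
  rw [colSpan, Submodule.span_le]
  rintro _ ⟨I, rfl⟩
  simp only [columnOp_eq]
  exact Submodule.sum_mem _ fun σ _ => zsmul_mem (wordOp_mem b _) _

lemma columnOp_comp_perm (b : Fin n → R) {k : ℕ} (I : Fin k → Fin n) (τ : Equiv.Perm (Fin k)) :
    columnOp b (I ∘ τ) = ((Equiv.Perm.sign τ : ℤˣ) : ℤ) • columnOp b I := by
  simp only [columnOp_eq, Finset.smul_sum, smul_smul]
  refine Fintype.sum_equiv (Equiv.mulLeft τ) _ _ fun σ => ?_
  simp only [Equiv.coe_mulLeft, Equiv.Perm.sign_mul, Function.comp_assoc, Equiv.Perm.coe_mul,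
    Units.val_mul, ← mul_assoc]
  simp [← Units.val_mul]

lemma columnOp_comp_equiv (b : Fin n → R) {k l : ℕ} (e : Fin k ≃ Fin l) :
    ∃ s : ℤ, (s = 1 ∨ s = -1) ∧ ∀ I : Fin l → Fin n, columnOp b (I ∘ e) = s • columnOp b I := by
  obtain rfl : k = l := Fin.equiv_iff_eq.1 ⟨e⟩
  refine ⟨_, ?_, fun I => columnOp_comp_perm b I e⟩
  rcases Int.units_eq_one_or (Equiv.Perm.sign e) with h | h <;> simp [h]

lemma columnOp_of_not_injective [Algebra ℂ R] (b : Fin n → R) {k : ℕ} (I : Fin k → Fin n)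
    (h : ¬ Function.Injective I) : columnOp b I = 0 := by
  simp only [Function.Injective, not_forall] at h
  obtain ⟨r, s, hrs, hne⟩ := h
  have h1 : I ∘ Equiv.swap r s = I := by
    funext t
    simp only [Function.comp_apply, Equiv.swap_apply_def]
    split_ifs <;> simp_all
  have h2 := columnOp_comp_perm b I (Equiv.swap r s)
  rw [h1, Equiv.Perm.sign_swap hne] at h2
  simp only [Units.val_neg, Units.val_one, neg_smul, one_smul] at h2
  have h3 : (2 : ℂ) • columnOp b I = 0 := by
    rw [two_smul]; nth_rewrite 1 [h2]; simp
  simpa using h3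

lemma columnOp_zero (b : Fin n → R) (I : Fin 0 → Fin n) : columnOp b I = 1 := by
  simp [columnOp_eq, wordOp_zero]

lemma columnOp_one (b : Fin n → R) (i : Fin n) : columnOp b (fun _ : Fin 1 => i) = b i := by
  simp [columnOp_eq, wordOp_succ, wordOp_zero]

lemma map_wordOp {S F : Type*} [Ring S] [FunLike F R S] [RingHomClass F R S] (φ : F)
    (b : Fin n → R) {k : ℕ} (f : Fin k → Fin n) :
    φ (wordOp b f) = wordOp (fun i => φ (b i)) f := by
  simp only [wordOp, map_list_prod, List.map_ofFn]; rfl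

lemma map_columnOp {S F : Type*} [Ring S] [FunLike F R S] [RingHomClass F R S] (φ : F)
    (b : Fin n → R) {k : ℕ} (I : Fin k → Fin n) :
    φ (columnOp b I) = columnOp (fun i => φ (b i)) I := by
  simp only [columnOp_eq, map_sum, map_zsmul, map_wordOp]

end ColumnOp

/-! ### Extension of scalars by a Grassmann algebra -/

section Grassmann

variable {R : Type*} [Ring R] [Algebra ℂ R] {n M : ℕ}

/-- The Grassmann algebra on `M` generators. -/
abbrev Gr (M : ℕ) : Type := ExteriorAlgebra ℂ (Fin M → ℂ)

/-- The generators of the Grassmann algebra. -/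
noncomputable def θ {M : ℕ} (j : Fin M) : Gr M := ExteriorAlgebra.ι ℂ (Pi.single j 1)

lemma θ_mul_self (j : Fin M) : θ j * θ j = 0 := ExteriorAlgebra.ι_sq_zero _

lemma θ_mul_θ (i j : Fin M) : θ i * θ j = - (θ j * θ i) := by
  have := ExteriorAlgebra.ι_add_mul_swap (R := ℂ) (Pi.single i 1 : Fin M → ℂ) (Pi.single j 1)
  exact eq_neg_of_add_eq_zero_left this

/-- The product of the Grassmann generators along a word. -/
noncomputable def wedge {k : ℕ} (f : Fin k → Fin M) : Gr M := (List.ofFn fun r => θ (f r)).prod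

lemma wedge_eq {k : ℕ} (f : Fin k → Fin M) :
    wedge f = ExteriorAlgebra.ιMulti ℂ k fun r => (Pi.single (f r) 1 : Fin M → ℂ) := by
  rw [ExteriorAlgebra.ιMulti_apply]; rfl

lemma wedge_comp_perm {k : ℕ} (f : Fin k → Fin M) (σ : Equiv.Perm (Fin k)) :
    wedge (f ∘ σ) = ((Equiv.Perm.sign σ : ℤˣ) : ℤ) • wedge f := by
  rw [wedge_eq, wedge_eq]
  exact (ExteriorAlgebra.ιMulti ℂ k).map_perm (fun r => (Pi.single (f r) 1 : Fin M → ℂ)) σ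

lemma wedge_of_not_injective {k : ℕ} (f : Fin k → Fin M) (h : ¬ Function.Injective f) :
    wedge f = 0 := by
  rw [wedge_eq]
  refine (ExteriorAlgebra.ιMulti ℂ k).map_eq_zero_of_not_injective _ fun h' => h fun r s hrs => ?_
  exact h' (by simp [hrs])

lemma wedge_append {k l : ℕ} (f : Fin (k + l) → Fin M) :
    wedge f = wedge (f ∘ Fin.castAdd l) * wedge (f ∘ Fin.natAdd k) := by
  simp only [wedge, List.ofFn_add, List.prod_append]; rfl

lemma wedge_succ {k : ℕ} (f : Fin (k + 1) → Fin M) :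
    wedge f = θ (f 0) * wedge (fun r => f r.succ) := by
  simp [wedge, List.ofFn_succ]

/-- The coefficient of the product of all Grassmann generators. -/
noncomputable def topCoeff (M : ℕ) : Gr M →ₗ[ℂ] ℂ :=
  ExteriorAlgebra.liftAlternating fun k =>
    if h : k = M then (Matrix.detRowAlternating (n := Fin M) (R := ℂ)).domDomCongr
      (finCongr h.symm) else 0

/-- The determinant of the identity matrix. This makes the top Grassmann coefficient a left inverse
of `w ↦ w ⊗ wedge id`, so identities proved in the envelope descend to `R`. -/
lemma topCoeff_wedge_id : topCoeff M (wedge (id : Fin M → Fin M)) = 1 := by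
  rw [wedge_eq, topCoeff, ExteriorAlgebra.liftAlternating_apply_ιMulti]
  simp only [dite_true, id, finCongr_refl]
  change Matrix.det (fun r : Fin M => (Pi.single r (1 : ℂ) : Fin M → ℂ)) = 1
  rw [← Matrix.det_one (n := Fin M) (R := ℂ)]
  congr 1
  ext i j
  simp [Matrix.one_apply, Pi.single_apply, eq_comm]

/-- Application of a linear functional to the Grassmann factor. -/
noncomputable def contract (φ : Gr M →ₗ[ℂ] ℂ) : R ⊗[ℂ] Gr M →ₗ[ℂ] R :=
  (TensorProduct.rid ℂ R).toLinearMap ∘ₗ LinearMap.lTensor R φ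

lemma contract_tmul (φ : Gr M →ₗ[ℂ] ℂ) (w : R) (g : Gr M) :
    contract φ (w ⊗ₜ[ℂ] g) = φ g • w := by
  simp [contract]

/-- The extension of a subspace of `R` to the Grassmann envelope. -/
noncomputable def env (M : ℕ) (W : Submodule ℂ R) : Submodule ℂ (R ⊗[ℂ] Gr M) :=
  Submodule.map₂ (TensorProduct.mk ℂ R (Gr M)) W ⊤

lemma tmul_mem_env {W : Submodule ℂ R} {w : R} (hw : w ∈ W) (g : Gr M) :
    w ⊗ₜ[ℂ] g ∈ env M W :=
  Submodule.apply_mem_map₂ _ hw Submodule.mem_top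

lemma env_mono {W W' : Submodule ℂ R} (h : W ≤ W') : env M W ≤ env M W' :=
  Submodule.map₂_le_map₂_left h

lemma env_mul_le (W W' : Submodule ℂ R) : env M W * env M W' ≤ env M (W * W') := by
  rw [env, env, Submodule.map₂_eq_span_image2, Submodule.map₂_eq_span_image2,
    Submodule.span_mul_span, Submodule.span_le]
  rintro _ ⟨_, ⟨w, hw, g, -, rfl⟩, _, ⟨w', hw', g', -, rfl⟩, rfl⟩
  simp only [TensorProduct.mk_apply, Algebra.TensorProduct.tmul_mul_tmul]
  exact tmul_mem_env (Submodule.mul_mem_mul hw hw') _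

lemma mul_mem_env {W W' : Submodule ℂ R} {x y : R ⊗[ℂ] Gr M} (hx : x ∈ env M W)
    (hy : y ∈ env M W') : x * y ∈ env M (W * W') :=
  env_mul_le W W' (Submodule.mul_mem_mul hx hy)

lemma contract_mem {W : Submodule ℂ R} (φ : Gr M →ₗ[ℂ] ℂ) {x : R ⊗[ℂ] Gr M}
    (hx : x ∈ env M W) : contract φ x ∈ W := by
  have : env M W ≤ W.comap (contract φ) := by
    rw [env, Submodule.map₂_le]
    intro w hw g _
    simp only [Submodule.mem_comap, TensorProduct.mk_apply, contract_tmul]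
    exact W.smul_mem _ hw
  exact this hx

/-- The element `∑_j b_{x(j)} θ_{g(j)}`. -/
noncomputable def eta (b : Fin n → R) {L : ℕ} (x : Fin L → Fin n) (g : Fin L → Fin M) :
    R ⊗[ℂ] Gr M := ∑ j, b (x j) ⊗ₜ[ℂ] θ (g j)

lemma list_prod_tmul {S : Type*} [Ring S] [Algebra ℂ S] {k : ℕ} (u : Fin k → R) (g : Fin k → S) :
    (List.ofFn fun r => u r ⊗ₜ[ℂ] g r).prod = (List.ofFn u).prod ⊗ₜ[ℂ] (List.ofFn g).prod := by
  induction k with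
  | zero => simp [Algebra.TensorProduct.one_def]
  | succ k ih => simp [List.ofFn_succ, ih]

lemma eta_pow (b : Fin n → R) {L : ℕ} (x : Fin L → Fin n) (g : Fin L → Fin M) (k : ℕ) :
    eta b x g ^ k = ∑ f : Fin k → Fin L, wordOp b (x ∘ f) ⊗ₜ[ℂ] wedge (g ∘ f) := by
  have h := (MultilinearMap.mkPiAlgebraFin ℂ k (R ⊗[ℂ] Gr M)).map_sum
    (fun (_ : Fin k) (j : Fin L) => b (x j) ⊗ₜ[ℂ] θ (g j))
  simp only [MultilinearMap.mkPiAlgebraFin_apply, List.ofFn_const, List.prod_replicate] at h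
  rw [eta, h]
  refine Finset.sum_congr rfl fun f _ => ?_
  rw [list_prod_tmul (fun r => b (x (f r))) (fun r => θ (g (f r)))]
  rfl

/-- Relabelling the summation by a permutation of the `k` factors moves its sign from the Grassmann
word to the word in `b`. Summing over all `k!` permutations replaces words by antisymmetrised
products, and `k!` is invertible. -/
lemma eta_pow_mem (b : Fin n → R) {L : ℕ} (x : Fin L → Fin n) (g : Fin L → Fin M) (k : ℕ) :
    eta b x g ^ k ∈ env M (colSpan b k) := by
  have h : (Fintype.card (Equiv.Perm (Fin k)) : ℂ) • eta b x g ^ k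
      = ∑ f : Fin k → Fin L, columnOp b (x ∘ f) ⊗ₜ[ℂ] wedge (g ∘ f) := by
    have h1 : ∀ σ : Equiv.Perm (Fin k), eta b x g ^ k = ∑ f : Fin k → Fin L,
        (((Equiv.Perm.sign σ : ℤˣ) : ℤ) • wordOp b ((x ∘ f) ∘ σ)) ⊗ₜ[ℂ] wedge (g ∘ f) := by
      intro σ
      rw [eta_pow]
      refine Fintype.sum_equiv (Equiv.arrowCongr σ (Equiv.refl _)) _ _ fun f => ?_
      have h2 : g ∘ f = (g ∘ f ∘ σ.symm) ∘ σ := by funext r; simp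
      have h3 : (Equiv.arrowCongr σ (Equiv.refl (Fin L))) f = f ∘ σ.symm := rfl
      rw [h3]
      conv_lhs => rw [h2, wedge_comp_perm]
      rw [TensorProduct.tmul_smul, TensorProduct.smul_tmul']
      have h4 : x ∘ f = (x ∘ f ∘ σ.symm) ∘ σ := by funext r; simp
      rw [h4]
    simp only [columnOp_eq, TensorProduct.sum_tmul]
    rw [Finset.sum_comm, ← Finset.sum_congr rfl fun σ _ => h1 σ, Finset.sum_const,
      Finset.card_univ, ← Nat.cast_smul_eq_nsmul ℂ]
  have h0 : (Fintype.card (Equiv.Perm (Fin k)) : ℂ) ≠ 0 := by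
    exact_mod_cast Fintype.card_ne_zero
  rw [← Submodule.smul_mem_iff _ h0, h]
  exact Submodule.sum_mem _ fun f _ => tmul_mem_env (columnOp_mem_colSpan b _) _

/-- Non-injective self-maps are killed by the wedge, and the injective ones are exactly the
permutations, each contributing its sign. -/
lemma sum_tmul_wedge {k : ℕ} (F : (Fin k → Fin k) → R) (g : Fin k → Fin M) :
    ∑ f : Fin k → Fin k, F f ⊗ₜ[ℂ] wedge (g ∘ f)
      = (∑ σ : Equiv.Perm (Fin k), ((Equiv.Perm.sign σ : ℤˣ) : ℤ) • F σ) ⊗ₜ[ℂ] wedge g := by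
  rw [TensorProduct.sum_tmul]
  have h : ∀ σ : Equiv.Perm (Fin k),
      (((Equiv.Perm.sign σ : ℤˣ) : ℤ) • F σ) ⊗ₜ[ℂ] wedge g = F σ ⊗ₜ[ℂ] wedge (g ∘ σ) := by
    intro σ
    rw [← TensorProduct.smul_tmul', ← TensorProduct.tmul_smul, ← wedge_comp_perm]
  rw [Finset.sum_congr rfl fun σ _ => h σ]
  symm
  refine Finset.sum_bij_ne_zero (fun σ _ _ => (σ : Fin k → Fin k)) (fun _ _ _ => Finset.mem_univ _)
    (fun σ _ _ τ _ _ h => Equiv.coe_fn_injective h) (fun f _ hf => ?_) (fun _ _ _ => rfl)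
  have hinj : Function.Injective f := by
    by_contra hc
    exact hf (by rw [wedge_of_not_injective _ fun h => hc h.of_comp, TensorProduct.tmul_zero])
  exact ⟨Equiv.ofBijective f (Finite.injective_iff_bijective.1 hinj), Finset.mem_univ _, hf, rfl⟩

lemma eta_pow_card (b : Fin n → R) {L : ℕ} (x : Fin L → Fin n) (g : Fin L → Fin M) :
    eta b x g ^ L = columnOp b x ⊗ₜ[ℂ] wedge g := by
  rw [eta_pow, columnOp_eq]
  exact sum_tmul_wedge (fun f => wordOp b (x ∘ f)) g

/-- Pigeonhole: with only `L` Grassmann letters, every word of length `L + 1` repeats one. -/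
lemma eta_pow_card_succ (b : Fin n → R) {L : ℕ} (x : Fin L → Fin n) (g : Fin L → Fin M) :
    eta b x g ^ (L + 1) = 0 := by
  rw [eta_pow]
  refine Finset.sum_eq_zero fun f _ => ?_
  rw [wedge_of_not_injective, TensorProduct.tmul_zero]
  intro h
  have := Fintype.card_le_of_injective f h.of_comp
  simp at this

lemma eta_mem (b : Fin n → R) {L : ℕ} (x : Fin L → Fin n) (g : Fin L → Fin M) :
    eta b x g ∈ env M (genSpan b) :=
  Submodule.sum_mem _ fun _ _ => tmul_mem_env (mem_genSpan b _) _

lemma mem_of_columnOp_tmul_mem {W : Submodule ℂ R} {w : R}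
    (h : w ⊗ₜ[ℂ] wedge (id : Fin M → Fin M) ∈ env M W) : w ∈ W := by
  have := contract_mem (topCoeff M) h
  rwa [contract_tmul, topCoeff_wedge_id, one_smul] at this

/-- Expansion of a column along its first factor, read off from `η ^ (k + 1) = η * η ^ k`. -/
lemma colSpan_succ_le_mul (b : Fin n → R) (k : ℕ) :
    colSpan b (k + 1) ≤ genSpan b * colSpan b k := by
  rw [colSpan, Submodule.span_le]
  rintro _ ⟨I, rfl⟩
  refine mem_of_columnOp_tmul_mem (M := k + 1) ?_
  rw [← eta_pow_card, pow_succ']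
  exact mul_mem_env (eta_mem b I id) (eta_pow_mem b I id k)

end Grassmann

/-! ### Commutation with antisymmetrised products -/

section Abstract

variable {T : Type*} [Ring T] [Algebra ℂ T]

/-- Each passage of `β` across one `η` leaves the anticommutator `S` behind. Since `S` anticommutes
with `η`, all these terms acquire the same sign when collected at the left, whence the factor `k +
1`. -/
lemma pow_succ_mul_comm {β η : T}
    (hS : (η * β + β * η) * η = -(η * (η * β + β * η))) (k : ℕ) :
    η ^ (k + 1) * β = (-1 : ℂ) ^ (k + 1) •
      (β * η ^ (k + 1) - ((k : ℂ) + 1) • ((η * β + β * η) * η ^ k)) := by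
  set S := η * β + β * η with hSdef
  have h0 : η * β = S - β * η := by rw [hSdef]; abel
  have hSk : ∀ k : ℕ, η * (S * η ^ k) = -(S * η ^ (k + 1)) := by
    intro k; rw [← mul_assoc, ← neg_eq_iff_eq_neg.2 hS, pow_succ', ← mul_assoc]; simp
  induction k with
  | zero => simp only [zero_add, pow_one, pow_zero, mul_one, h0, Nat.cast_zero]; module
  | succ k ih =>
    have h1 : η * (β * η ^ (k + 1)) = S * η ^ (k + 1) - β * η ^ (k + 2) := by
      rw [← mul_assoc, h0, sub_mul, mul_assoc, ← pow_succ']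
    rw [pow_succ' η (k + 1), mul_assoc, ih, mul_smul_comm, mul_sub, mul_smul_comm, hSk, h1,
      ← pow_succ']
    push_cast
    rw [pow_succ (-1 : ℂ) (k + 1)]
    module

/-- As `t ^ 2 = 0`, the expansion is linear in `t`: it is an alternating sum of the `η ^ j * β * η ^
(k - j)`. Eliminating the anticommutator leaves only the two extreme positions of `β`, equally
weighted. -/
lemma add_mul_pow_succ {β η t : T}
    (hS : (η * β + β * η) * η = -(η * (η * β + β * η)))
    (ht : t * t = 0) (hη : η * t = -(t * η)) (hβ : β * t = t * β) (k : ℕ) :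
    (η + t * β) ^ (k + 1) = η ^ (k + 1) + (((k : ℂ) + 1) / 2) •
      (t * (β * η ^ k + (-1 : ℂ) ^ k • (η ^ k * β))) := by
  induction k with
  | zero => simp only [zero_add, pow_one, pow_zero, mul_one, one_mul, one_smul, Nat.cast_zero, mul_add]; module
  | succ k ih =>
    have hp := pow_succ_mul_comm hS k
    rw [pow_succ', ih]
    have e1 : ∀ z : T, (η + t * β) * (t * z) = -(t * (η * z)) := by
      intro z
      have : t * β * (t * z) = 0 := by
        rw [mul_assoc, ← mul_assoc β, hβ, mul_assoc, ← mul_assoc, ht, zero_mul]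
      rw [add_mul, this, add_zero, ← mul_assoc, hη, neg_mul, mul_assoc]
    rw [mul_add, mul_smul_comm, e1]
    have e2 : η * (β * η ^ k + (-1 : ℂ) ^ k • (η ^ k * β))
        = η * β * η ^ k + (-1 : ℂ) ^ k • (η ^ (k + 1) * β) := by
      rw [mul_add, mul_smul_comm, pow_succ', mul_assoc, mul_assoc]
    rw [e2]
    -- Here `η * β = S - β * η`, and `(k + 1) • (S * η ^ k)` is eliminated through `hp`. Multiplying
    -- by `k + 1` first makes this possible without a division.
    have e3 : ((k : ℂ) + 1) • (η * β * η ^ k)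
        = β * η ^ (k + 1) + (-1 : ℂ) ^ k • (η ^ (k + 1) * β)
          - ((k : ℂ) + 1) • (β * η ^ (k + 1)) := by
      rw [hp, smul_smul, pow_succ (-1 : ℂ), ← mul_assoc, ← pow_add, ← two_mul, pow_mul,
        add_mul, mul_assoc β, ← pow_succ']
      simp only [neg_one_sq, one_pow]
      module
    rw [add_mul, ← pow_succ' η (k + 1), mul_assoc t]
    have e4 : (((k : ℂ) + 1) / 2) • -(t * (η * β * η ^ k + (-1 : ℂ) ^ k • (η ^ (k + 1) * β)))
        = -(t * ((1 / 2 : ℂ) • (((k : ℂ) + 1) • (η * β * η ^ k))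
          + (((k : ℂ) + 1) / 2) • ((-1 : ℂ) ^ k • (η ^ (k + 1) * β)))) := by
      rw [smul_neg, ← mul_smul_comm]
      congr 2
      module
    rw [e4, e3, add_assoc]
    congr 1
    rw [← mul_neg, ← mul_add, ← mul_smul_comm _ t]
    congr 1
    push_cast
    rw [pow_succ (-1 : ℂ) k]
    module

end Abstract

section Triple

variable {R : Type*} [Ring R] [Algebra ℂ R] {n M : ℕ}

/-- The anticommutators of the generators commute with the generators. -/
def TripleComm (b : Fin n → R) : Prop :=
  ∀ i j l, (b i * b j + b j * b i) * b l = b l * (b i * b j + b j * b i)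

lemma eta_anticomm (b : Fin n → R) {L : ℕ} (x : Fin L → Fin n) (g : Fin L → Fin M) (a : Fin n) :
    eta b x g * (b a ⊗ₜ[ℂ] 1) + (b a ⊗ₜ[ℂ] 1) * eta b x g
      = ∑ j, (b (x j) * b a + b a * b (x j)) ⊗ₜ[ℂ] θ (g j) := by
  simp only [eta, Finset.sum_mul, Finset.mul_sum, Algebra.TensorProduct.tmul_mul_tmul, mul_one,
    one_mul, TensorProduct.add_tmul, Finset.sum_add_distrib]

/-- The coefficients `{b_x, b_a}` commute with the generators, but each carries one Grassmann
letter, as does each term of `η`; interchanging the two letters produces the sign. -/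
lemma eta_anticomm_mul_eta {b : Fin n → R} (hb : TripleComm b) {L : ℕ} (x : Fin L → Fin n)
    (g : Fin L → Fin M) (a : Fin n) :
    (eta b x g * (b a ⊗ₜ[ℂ] 1) + (b a ⊗ₜ[ℂ] 1) * eta b x g) * eta b x g
      = -(eta b x g * (eta b x g * (b a ⊗ₜ[ℂ] 1) + (b a ⊗ₜ[ℂ] 1) * eta b x g)) := by
  rw [eta_anticomm]
  simp only [eta, Finset.sum_mul, Finset.mul_sum, Algebra.TensorProduct.tmul_mul_tmul]
  rw [Finset.sum_comm, ← Finset.sum_neg_distrib]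
  refine Finset.sum_congr rfl fun i _ => ?_
  rw [← Finset.sum_neg_distrib]
  refine Finset.sum_congr rfl fun j _ => ?_
  rw [hb, θ_mul_θ, TensorProduct.tmul_neg]

lemma eta_anticomm_mul_gen {b : Fin n → R} (hb : TripleComm b) {L : ℕ} (x : Fin L → Fin n)
    (g : Fin L → Fin M) (a c : Fin n) :
    (eta b x g * (b a ⊗ₜ[ℂ] 1) + (b a ⊗ₜ[ℂ] 1) * eta b x g) * (b c ⊗ₜ[ℂ] 1)
      = (b c ⊗ₜ[ℂ] 1) * (eta b x g * (b a ⊗ₜ[ℂ] 1) + (b a ⊗ₜ[ℂ] 1) * eta b x g) := by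
  rw [eta_anticomm]
  simp only [Finset.sum_mul, Finset.mul_sum, Algebra.TensorProduct.tmul_mul_tmul, mul_one,
    one_mul]
  exact Finset.sum_congr rfl fun j _ => by rw [hb]

lemma tmul_wedge_injective {w w' : R}
    (h : w ⊗ₜ[ℂ] wedge (id : Fin M → Fin M) = w' ⊗ₜ[ℂ] wedge (id : Fin M → Fin M)) : w = w' := by
  have := congrArg (contract (topCoeff M)) h
  simpa [contract_tmul, topCoeff_wedge_id] using this

/-- A new entry of a column needs to be placed only at the two ends, with equal weight up to sign.
This is the top coefficient of `add_mul_pow_succ`. -/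
lemma columnOp_cons {b : Fin n → R} (hb : TripleComm b) {k : ℕ} (a : Fin n) (x : Fin k → Fin n) :
    columnOp b (Fin.cons a x : Fin (k + 1) → Fin n) = (((k : ℂ) + 1) / 2) •
      (b a * columnOp b x + (-1 : ℂ) ^ k • (columnOp b x * b a)) := by
  apply tmul_wedge_injective (M := k + 1)
  have hη : eta b (Fin.cons a x : Fin (k + 1) → Fin n) (id : Fin (k + 1) → Fin (k + 1))
      = eta b x Fin.succ + (1 ⊗ₜ[ℂ] θ 0) * (b a ⊗ₜ[ℂ] 1) := by
    simp [eta, Fin.sum_univ_succ, add_comm]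
  -- The letter `θ 0` marks the new entry `a`, the remaining letters mark `x`. The pure power `η ^
  -- (k + 1)` then vanishes, since `x` has only `k` entries.
  have h := @add_mul_pow_succ (R ⊗[ℂ] Gr (k + 1)) _ _ (b a ⊗ₜ[ℂ] 1) (eta b x Fin.succ)
    (1 ⊗ₜ[ℂ] θ 0) (eta_anticomm_mul_eta hb x Fin.succ a) ?_ ?_ ?_ k
  rw [eta_pow_card_succ, eta_pow_card, zero_add] at h
  rw [← eta_pow_card, hη, h]
  · have hw : (θ 0 : Gr (k + 1)) * wedge (Fin.succ : Fin k → Fin (k + 1))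
        = wedge (id : Fin (k + 1) → Fin (k + 1)) := by
      rw [wedge_succ (id : Fin (k + 1) → Fin (k + 1))]; rfl
    simp only [mul_add, mul_smul_comm, Algebra.TensorProduct.tmul_mul_tmul, one_mul, mul_one, hw,
      TensorProduct.smul_tmul']
    rw [← TensorProduct.add_tmul, TensorProduct.smul_tmul']
  · simp [θ_mul_self]
  · simp only [eta, Finset.sum_mul, Finset.mul_sum, Algebra.TensorProduct.tmul_mul_tmul, mul_one,
      one_mul, ← Finset.sum_neg_distrib]
    refine Finset.sum_congr rfl fun j _ => ?_
    rw [θ_mul_θ, TensorProduct.tmul_neg]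
  · simp

/-- `columnOp_cons` can be solved for the product with `b a` on the right; the longer column that
appears is expanded along its first factor. -/
lemma colSpan_mul_genSpan_le {b : Fin n → R} (hb : TripleComm b) (k : ℕ) :
    colSpan b k * genSpan b ≤ genSpan b * colSpan b k := by
  rw [colSpan, genSpan, Submodule.span_mul_span, Submodule.span_le]
  rintro _ ⟨_, ⟨x, rfl⟩, _, ⟨a, rfl⟩, rfl⟩
  have h := columnOp_cons hb a x
  have hk : ((k : ℂ) + 1) / 2 ≠ 0 := div_ne_zero (by exact_mod_cast Nat.succ_ne_zero k) two_ne_zero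
  have h2 : columnOp b x * b a = (-1 : ℂ) ^ k • ((((k : ℂ) + 1) / 2)⁻¹ •
      columnOp b (Fin.cons a x : Fin (k + 1) → Fin n) - b a * columnOp b x) := by
    rw [h, smul_smul, inv_mul_cancel₀ hk, one_smul, add_sub_cancel_left, smul_smul, ← pow_add,
      ← two_mul, pow_mul]
    simp
  simp only [SetLike.mem_coe]
  rw [h2]
  refine Submodule.smul_mem _ _ (Submodule.sub_mem _ (Submodule.smul_mem _ _ ?_) ?_)
  · exact colSpan_succ_le_mul b k (columnOp_mem_colSpan b _)
  · exact Submodule.mul_mem_mul (mem_genSpan b a) (columnOp_mem_colSpan b x)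

lemma colSpan_mul_genSpan_pow_le {b : Fin n → R} (hb : TripleComm b) (k d : ℕ) :
    colSpan b k * genSpan b ^ d ≤ genSpan b ^ d * colSpan b k := by
  induction d with
  | zero => simp
  | succ d ih =>
    rw [pow_succ, ← mul_assoc]
    refine (mul_le_mul_left ih _).trans ?_
    rw [mul_assoc, mul_assoc]
    exact mul_le_mul_right (colSpan_mul_genSpan_le hb k) _

end Triple

/-! ### Garnir relations -/

section Garnir

variable {R : Type*} [Ring R] [Algebra ℂ R] {n M : ℕ}

/-- The product of the anticommutators `{η, b_a}` along a list. -/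
noncomputable def anticommProd (b : Fin n → R) {L : ℕ} (x : Fin L → Fin n) (g : Fin L → Fin M)
    (t : List (Fin n)) : R ⊗[ℂ] Gr M :=
  (t.map fun a => eta b x g * (b a ⊗ₜ[ℂ] 1) + (b a ⊗ₜ[ℂ] 1) * eta b x g).prod

lemma anticommProd_append (b : Fin n → R) {L : ℕ} (x : Fin L → Fin n) (g : Fin L → Fin M)
    (t : List (Fin n)) (a : Fin n) : anticommProd b x g (t ++ [a])
      = anticommProd b x g t *
        (eta b x g * (b a ⊗ₜ[ℂ] 1) + (b a ⊗ₜ[ℂ] 1) * eta b x g) := by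
  simp [anticommProd]

lemma anticommProd_mul_gen {b : Fin n → R} (hb : TripleComm b) {L : ℕ} (x : Fin L → Fin n)
    (g : Fin L → Fin M) (t : List (Fin n)) (c : Fin n) :
    anticommProd b x g t * (b c ⊗ₜ[ℂ] 1) = (b c ⊗ₜ[ℂ] 1) * anticommProd b x g t := by
  have : Commute (anticommProd b x g t) (b c ⊗ₜ[ℂ] 1) := by
    refine Commute.list_prod_left _ _ fun y hy => ?_
    obtain ⟨a, -, rfl⟩ := List.mem_map.1 hy
    exact eta_anticomm_mul_gen hb x g a c
  exact this

/-- The basic move of the Garnir argument: a letter moved to the left either escapes past everything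
or uses up one `η` and becomes a further anticommutator. -/
lemma anticommProd_mul_pow_mul_gen {b : Fin n → R} (hb : TripleComm b) {L : ℕ} (x : Fin L → Fin n)
    (g : Fin L → Fin M) (t : List (Fin n)) (k : ℕ) (c : Fin n) :
    anticommProd b x g t * eta b x g ^ (k + 1) * (b c ⊗ₜ[ℂ] 1)
      = (-1 : ℂ) ^ (k + 1) • ((b c ⊗ₜ[ℂ] 1) * (anticommProd b x g t * eta b x g ^ (k + 1))
        - ((k : ℂ) + 1) • (anticommProd b x g (t ++ [c]) * eta b x g ^ k)) := by
  have h := pow_succ_mul_comm (eta_anticomm_mul_eta hb x g c) k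
  rw [mul_assoc, h, mul_smul_comm, mul_sub, mul_smul_comm, ← mul_assoc, ← mul_assoc,
    anticommProd_mul_gen hb, ← anticommProd_append, mul_assoc]

lemma gen_mul_mem_env {W : Submodule ℂ R} (b : Fin n → R) (a : Fin n) {z : R ⊗[ℂ] Gr M}
    (hz : z ∈ env M W) : (b a ⊗ₜ[ℂ] 1) * z ∈ env M (genSpan b * W) :=
  mul_mem_env (tmul_mem_env (mem_genSpan b a) 1) hz

/-- The basic move, solved for its last term, trades an anticommutator for one more `η` and a
generator beside the product; a generator on the right is carried across the column by
`colSpan_mul_genSpan_le`. -/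
lemma anticommProd_mul_pow_mem {b : Fin n → R} (hb : TripleComm b) {L : ℕ} (x : Fin L → Fin n)
    (g : Fin L → Fin M) (t : List (Fin n)) (k : ℕ) :
    anticommProd b x g t * eta b x g ^ k
      ∈ env M (genSpan b ^ t.length * colSpan b (t.length + k)) := by
  induction t using List.reverseRecOn generalizing k with
  | nil => simpa [anticommProd] using eta_pow_mem b x g k
  | append_singleton t c ih =>
    have h := anticommProd_mul_pow_mul_gen hb x g t k c
    have hk : ((k : ℂ) + 1) ≠ 0 := by exact_mod_cast Nat.succ_ne_zero k
    have h2 : anticommProd b x g (t ++ [c]) * eta b x g ^ k = ((k : ℂ) + 1)⁻¹ •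
        ((b c ⊗ₜ[ℂ] 1) * (anticommProd b x g t * eta b x g ^ (k + 1)) - (-1 : ℂ) ^ (k + 1) •
          (anticommProd b x g t * eta b x g ^ (k + 1) * (b c ⊗ₜ[ℂ] 1))) := by
      rw [h, smul_smul, ← pow_add, ← two_mul, pow_mul]
      simp [smul_smul, hk]
    rw [h2, List.length_append, List.length_singleton,
      show t.length + 1 + k = t.length + (k + 1) by ring]
    refine Submodule.smul_mem _ _ (Submodule.sub_mem _ ?_ (Submodule.smul_mem _ _ ?_))
    · have := gen_mul_mem_env b c (ih (k + 1))
      rwa [← mul_assoc, ← pow_succ'] at this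
    · have := mul_mem_env (ih (k + 1)) (tmul_mem_env (mem_genSpan b c) (1 : Gr M))
      refine env_mono ?_ this
      rw [mul_assoc, pow_succ, mul_assoc]
      exact mul_le_mul_right (colSpan_mul_genSpan_le hb _) _

/-- The letters of `w` are moved out to the left one at a time until the two powers of `η` meet and
merge. The list `t`, which collects the absorbed letters, is present to make the induction close. -/
lemma anticommProd_mul_mem {b : Fin n → R} (hb : TripleComm b) {L : ℕ} (x : Fin L → Fin n)
    (g : Fin L → Fin M) (d : ℕ) (t : List (Fin n)) (k l : ℕ) {w : R} (hw : w ∈ genSpan b ^ d) :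
    anticommProd b x g t * eta b x g ^ k * (w ⊗ₜ[ℂ] 1) * eta b x g ^ l
      ∈ env M (genSpan b ^ (d + t.length) * colSpan b (t.length + k + l)) := by
  induction d generalizing t k w with
  | zero =>
    rw [pow_zero, Submodule.mem_one] at hw
    obtain ⟨c, rfl⟩ := hw
    have h1 : (algebraMap ℂ R c) ⊗ₜ[ℂ] (1 : Gr M) = algebraMap ℂ (R ⊗[ℂ] Gr M) c := rfl
    rw [h1, Algebra.algebraMap_eq_smul_one, mul_smul_comm, smul_mul_assoc, mul_one, mul_assoc,
      ← pow_add, zero_add, add_assoc]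
    exact Submodule.smul_mem _ _ (anticommProd_mul_pow_mem hb x g t (k + l))
  | succ d ih =>
    rw [pow_succ'] at hw
    induction hw using Submodule.mul_induction_on' with
    | add y _ z _ hy hz =>
      rw [TensorProduct.add_tmul, mul_add, add_mul]
      exact Submodule.add_mem _ hy hz
    | mem_mul_mem m hm w hw =>
      induction hm using Submodule.span_induction with
      | zero => simp
      | add y z _ _ hy hz =>
        rw [add_mul, TensorProduct.add_tmul, mul_add, add_mul]
        exact Submodule.add_mem _ hy hz
      | smul c y _ hy =>
        rw [smul_mul_assoc, ← TensorProduct.smul_tmul', mul_smul_comm, smul_mul_assoc]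
        exact Submodule.smul_mem _ _ hy
      | mem y hy =>
        obtain ⟨c, rfl⟩ := hy
        have e : (b c * w) ⊗ₜ[ℂ] (1 : Gr M) = (b c ⊗ₜ[ℂ] 1) * (w ⊗ₜ[ℂ] 1) := by
          simp
        have hp : genSpan b ^ (d + 1 + t.length) = genSpan b * genSpan b ^ (d + t.length) := by
          rw [← pow_succ']; congr 1; ring
        rw [e, ← mul_assoc]
        -- Without a factor `η` to absorb it, the letter simply commutes past the anticommutators.
        cases k with
        | zero =>
          have := gen_mul_mem_env b c (ih t 0 hw)
          rw [pow_zero, mul_one] at this ⊢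
          rw [anticommProd_mul_gen hb, hp]
          simpa only [mul_assoc] using this
        | succ k =>
          rw [anticommProd_mul_pow_mul_gen hb, smul_mul_assoc, smul_mul_assoc, sub_mul, sub_mul,
            smul_mul_assoc, smul_mul_assoc]
          refine Submodule.smul_mem _ _ (Submodule.sub_mem _ ?_ (Submodule.smul_mem _ _ ?_))
          · have := gen_mul_mem_env b c (ih t (k + 1) hw)
            rw [hp]
            simpa only [mul_assoc] using this
          · have := ih (t ++ [c]) k hw
            rw [List.length_append, List.length_singleton] at this
            convert this using 4 <;> ring

lemma eta_pow_mul_mul_eta_pow_mem {b : Fin n → R} (hb : TripleComm b) {L : ℕ} (x : Fin L → Fin n)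
    (g : Fin L → Fin M) (d k l : ℕ) {w : R} (hw : w ∈ genSpan b ^ d) :
    eta b x g ^ k * (w ⊗ₜ[ℂ] 1) * eta b x g ^ l
      ∈ env M (genSpan b ^ d * colSpan b (k + l)) := by
  simpa [anticommProd] using anticommProd_mul_mem hb x g d [] k l hw

/-- The left side is the top coefficient of `η ^ k * w * η ^ l`, so the Grassmann letters do the
antisymmetrisation over both blocks. -/
lemma sum_sign_wordOp_mem {b : Fin n → R} (hb : TripleComm b) {d k l : ℕ}
    (x : Fin (k + l) → Fin n) {w : R} (hw : w ∈ genSpan b ^ d) :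
    ∑ σ : Equiv.Perm (Fin (k + l)), ((Equiv.Perm.sign σ : ℤˣ) : ℤ) •
      (wordOp b (x ∘ σ ∘ Fin.castAdd l) * w * wordOp b (x ∘ σ ∘ Fin.natAdd k))
      ∈ genSpan b ^ d * colSpan b (k + l) := by
  apply mem_of_columnOp_tmul_mem (M := k + l)
  have h := eta_pow_mul_mul_eta_pow_mem hb x (id : Fin (k + l) → Fin (k + l)) d k l hw
  rw [← sum_tmul_wedge (fun f => wordOp b (x ∘ f ∘ Fin.castAdd l) * w
    * wordOp b (x ∘ f ∘ Fin.natAdd k)) (id : Fin (k + l) → Fin (k + l))]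
  rw [eta_pow, eta_pow, Finset.sum_mul, Finset.sum_mul_sum, ← Fintype.sum_prod_type'] at h
  convert h using 1
  symm
  refine Fintype.sum_equiv (Fin.appendEquiv k l) _ _ fun fg => ?_
  obtain ⟨f, f'⟩ := fg
  have h1 : (Fin.append f f') ∘ Fin.castAdd l = f := by funext i; simp
  have h2 : (Fin.append f f') ∘ Fin.natAdd k = f' := by funext i; simp
  have h3 : Fin.appendEquiv k l (f, f') = Fin.append f f' := rfl
  simp only [h3, h1, h2, Function.id_comp, wedge_append,
    Algebra.TensorProduct.tmul_mul_tmul, mul_one]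

/-- The permutation of `Fin (k + l)` acting by `π` on the first `k` and by `ρ` on the last `l`
elements. -/
def blockPerm {k l : ℕ} (π : Equiv.Perm (Fin k)) (ρ : Equiv.Perm (Fin l)) :
    Equiv.Perm (Fin (k + l)) := finSumFinEquiv.permCongr (Equiv.Perm.sumCongr π ρ)

lemma sign_blockPerm {k l : ℕ} (π : Equiv.Perm (Fin k)) (ρ : Equiv.Perm (Fin l)) :
    Equiv.Perm.sign (blockPerm π ρ) = Equiv.Perm.sign π * Equiv.Perm.sign ρ := by
  rw [blockPerm, Equiv.Perm.sign_permCongr, Equiv.Perm.sign_sumCongr]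

lemma blockPerm_comp_castAdd {k l : ℕ} (π : Equiv.Perm (Fin k)) (ρ : Equiv.Perm (Fin l)) :
    blockPerm π ρ ∘ Fin.castAdd l = Fin.castAdd l ∘ π := by
  funext i; simp [blockPerm, Equiv.permCongr_apply]

lemma blockPerm_comp_natAdd {k l : ℕ} (π : Equiv.Perm (Fin k)) (ρ : Equiv.Perm (Fin l)) :
    blockPerm π ρ ∘ Fin.natAdd k = Fin.natAdd k ∘ ρ := by
  funext i; simp [blockPerm, Equiv.permCongr_apply]

/-- The permutations inside the two columns form a block permutation, which is absorbed by
translating `σ`; what remains is the statement for words. -/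
lemma sum_sign_columnOp_mem {b : Fin n → R} (hb : TripleComm b) {d k l : ℕ}
    (x : Fin (k + l) → Fin n) {w : R} (hw : w ∈ genSpan b ^ d) :
    ∑ σ : Equiv.Perm (Fin (k + l)), ((Equiv.Perm.sign σ : ℤˣ) : ℤ) •
      (columnOp b (x ∘ σ ∘ Fin.castAdd l) * w * columnOp b (x ∘ σ ∘ Fin.natAdd k))
      ∈ genSpan b ^ d * colSpan b (k + l) := by
  simp only [columnOp_eq, Finset.sum_mul, Finset.mul_sum, Finset.smul_sum]
  rw [Finset.sum_comm]
  refine Submodule.sum_mem _ fun π _ => ?_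
  rw [Finset.sum_comm]
  refine Submodule.sum_mem _ fun ρ _ => ?_
  convert sum_sign_wordOp_mem hb x hw using 1
  refine Fintype.sum_equiv (Equiv.mulRight (blockPerm ρ π)) _ _ fun σ => ?_
  have h1 : x ∘ (σ * blockPerm ρ π) ∘ Fin.castAdd l = (x ∘ σ ∘ Fin.castAdd l) ∘ ρ := by
    rw [Equiv.Perm.coe_mul, Function.comp_assoc, blockPerm_comp_castAdd]; rfl
  have h2 : x ∘ (σ * blockPerm ρ π) ∘ Fin.natAdd k = (x ∘ σ ∘ Fin.natAdd k) ∘ π := by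
    rw [Equiv.Perm.coe_mul, Function.comp_assoc, blockPerm_comp_natAdd]; rfl
  simp only [Equiv.coe_mulRight, h1, h2, Equiv.Perm.sign_mul, sign_blockPerm, Units.val_mul,
    smul_mul_assoc, mul_smul_comm, smul_smul]
  congr 1
  ring

/-- Functions of `x` that are spanned by products `u b_x u'`, with `u u'` of degree `s`. -/
def colFunSpan (b : Fin n → R) (r s : ℕ) : Submodule ℂ ((Fin r → Fin n) → R) :=
  Submodule.span ℂ {h | ∃ a a' : ℕ, a + a' = s ∧ ∃ u ∈ genSpan b ^ a, ∃ u' ∈ genSpan b ^ a',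
    h = fun x => u * columnOp b x * u'}

/-- The fixed entries `c` are stripped off one at a time with `columnOp_cons`, after a rotation that
costs a sign not depending on `x`. The resulting outer factors do not depend on `x` either, so they
can be pulled out of an antisymmetrisation over `x`. -/
lemma columnOp_append_mem {b : Fin n → R} (hb : TripleComm b) {r s : ℕ} (c : Fin s → Fin n) :
    (fun x : Fin r → Fin n => columnOp b (Fin.append x c)) ∈ colFunSpan b r s := by
  induction s with
  | zero =>
    refine Submodule.subset_span ⟨0, 0, rfl, 1, ?_, 1, ?_, ?_⟩
    · rw [pow_zero]; exact Submodule.one_le.1 le_rfl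
    · rw [pow_zero]; exact Submodule.one_le.1 le_rfl
    · funext x
      have : Fin.append x c = x := by funext i; exact Fin.append_left x c i
      rw [this]; simp
  | succ s ih =>
    obtain ⟨a, c, rfl⟩ : ∃ (a : Fin n) (c' : Fin s → Fin n), c = Fin.snoc c' a :=
      ⟨c (Fin.last s), Fin.init c, (Fin.snoc_init_self c).symm⟩
    obtain ⟨ε, -, hε⟩ := columnOp_comp_equiv b (finRotate (r + s + 1))
    have key : (fun x : Fin r → Fin n => columnOp b (Fin.append x (Fin.snoc c a : Fin (s + 1) → _)))
        = (ε : ℂ) • (((((r + s : ℕ) : ℂ) + 1) / 2) •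
          ((fun x => b a * columnOp b (Fin.append x c)) + (-1 : ℂ) ^ (r + s) •
            fun x => columnOp b (Fin.append x c) * b a)) := by
      funext x
      rw [Fin.append_snoc, Fin.snoc_eq_cons_rotate]
      refine (hε (Fin.cons a (Fin.append x c))).trans ?_
      rw [columnOp_cons hb, ← Int.cast_smul_eq_zsmul ℂ]
      rfl
    rw [key]
    refine Submodule.smul_mem _ _ (Submodule.smul_mem _ _ (Submodule.add_mem _ ?_
      (Submodule.smul_mem _ _ ?_)))
    · have hle : colFunSpan b r s ≤ (colFunSpan b r (s + 1)).comap
          ((LinearMap.mulLeft ℂ (b a)).compLeft (Fin r → Fin n)) := by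
        rw [colFunSpan, Submodule.span_le]
        rintro _ ⟨d, d', hd, u, hu, u', hu', rfl⟩
        refine Submodule.subset_span ⟨d + 1, d', by omega, b a * u, ?_, u', hu', ?_⟩
        · rw [pow_succ']; exact Submodule.mul_mem_mul (mem_genSpan b a) hu
        · funext x; simp [mul_assoc]
      exact hle (ih c)
    · have hle : colFunSpan b r s ≤ (colFunSpan b r (s + 1)).comap
          ((LinearMap.mulRight ℂ (b a)).compLeft (Fin r → Fin n)) := by
        rw [colFunSpan, Submodule.span_le]
        rintro _ ⟨d, d', hd, u, hu, u', hu', rfl⟩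
        refine Submodule.subset_span ⟨d, d' + 1, by omega, u, hu, u' * b a, ?_, ?_⟩
        · rw [pow_succ]; exact Submodule.mul_mem_mul hu' (mem_genSpan b a)
        · funext x; simp [mul_assoc]
      exact hle (ih c)

/-- With `u * columnOp b x * u'` on the left and `v * columnOp b x * v'` on the right, `u' * v` is
the middle word of `sum_sign_columnOp_mem`; the trailing `v'` is then moved across the long column.
-/
lemma sum_sign_colFun_mem {b : Fin n → R} (hb : TripleComm b) {k l s s' : ℕ}
    (x : Fin (k + l) → Fin n) {h : (Fin k → Fin n) → R} {h' : (Fin l → Fin n) → R}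
    (hh : h ∈ colFunSpan b k s) (hh' : h' ∈ colFunSpan b l s') :
    ∑ σ : Equiv.Perm (Fin (k + l)), ((Equiv.Perm.sign σ : ℤˣ) : ℤ) •
      (h (x ∘ σ ∘ Fin.castAdd l) * h' (x ∘ σ ∘ Fin.natAdd k))
      ∈ genSpan b ^ (s + s') * colSpan b (k + l) := by
  induction hh using Submodule.span_induction with
  | zero => simp
  | add y z _ _ hy hz =>
    simp only [Pi.add_apply, add_mul, smul_add, Finset.sum_add_distrib]
    exact Submodule.add_mem _ hy hz
  | smul c y _ hy =>
    simp only [Pi.smul_apply, smul_mul_assoc, smul_comm _ c, ← Finset.smul_sum]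
    exact Submodule.smul_mem _ _ hy
  | mem y hy =>
    obtain ⟨a, a', rfl, u, hu, u', hu', rfl⟩ := hy
    induction hh' using Submodule.span_induction with
    | zero => simp
    | add y z _ _ hy hz =>
      simp only [Pi.add_apply, mul_add, smul_add, Finset.sum_add_distrib]
      exact Submodule.add_mem _ hy hz
    | smul c y _ hy =>
      simp only [Pi.smul_apply, mul_smul_comm, smul_comm _ c, ← Finset.smul_sum]
      exact Submodule.smul_mem _ _ hy
    | mem y hy =>
      obtain ⟨e, e', rfl, v, hv, v', hv', rfl⟩ := hy
      have hw : u' * v ∈ genSpan b ^ (a' + e) := by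
        rw [pow_add]; exact Submodule.mul_mem_mul hu' hv
      have h1 := Submodule.mul_mem_mul (Submodule.mul_mem_mul hu
        (sum_sign_columnOp_mem hb x hw)) hv'
      have hle : genSpan b ^ a * (genSpan b ^ (a' + e) * colSpan b (k + l)) * genSpan b ^ e'
          ≤ genSpan b ^ (a + a' + (e + e')) * colSpan b (k + l) := by
        rw [← mul_assoc, ← pow_add, mul_assoc]
        refine (mul_le_mul_right (colSpan_mul_genSpan_pow_le hb _ _) _).trans ?_
        rw [← mul_assoc, ← pow_add]
        apply le_of_eq; congr 2; ring
      convert hle h1 using 1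
      rw [Finset.mul_sum, Finset.sum_mul]
      refine Finset.sum_congr rfl fun σ _ => ?_
      simp only [smul_mul_assoc, mul_smul_comm, mul_assoc]

/-- The Garnir relation: antisymmetrising two adjacent columns over `k + l` of their entries gives
a combination of products ending in a column of length `k + l`. -/
theorem garnir {b : Fin n → R} (hb : TripleComm b) {k l s s' : ℕ}
    (x : Fin (k + l) → Fin n) (c : Fin s → Fin n) (c' : Fin s' → Fin n) :
    ∑ σ : Equiv.Perm (Fin (k + l)), ((Equiv.Perm.sign σ : ℤˣ) : ℤ) •
      (columnOp b (Fin.append (x ∘ σ ∘ Fin.castAdd l) c)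
        * columnOp b (Fin.append (x ∘ σ ∘ Fin.natAdd k) c'))
      ∈ genSpan b ^ (s + s') * colSpan b (k + l) :=
  sum_sign_colFun_mem hb x (columnOp_append_mem hb c) (columnOp_append_mem hb c')

end Garnir

/-! ### Straightening -/

section Straightening

lemma sum_lt_sum_of_exchange {α : Type*} [DecidableEq α] {S T : Finset α} {f : α → ℕ} {m : ℕ}
    (hcard : S.card = T.card) (hne : ¬ T ⊆ S) (hS : ∀ a ∈ S \ T, f a ≤ m)
    (hT : ∀ a ∈ T \ S, m < f a) : ∑ a ∈ S, f a < ∑ a ∈ T, f a := by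
  rw [← Finset.sum_inter_add_sum_sdiff S T, ← Finset.sum_inter_add_sum_sdiff T S,
    Finset.inter_comm T S]
  have h1 : ∑ a ∈ S \ T, f a ≤ (S \ T).card * m := by
    simpa using Finset.sum_le_card_nsmul _ _ _ hS
  have h2 : (T \ S).card * (m + 1) ≤ ∑ a ∈ T \ S, f a := by
    simpa using Finset.card_nsmul_le_sum (T \ S) f (m + 1) hT
  have h3 : (S \ T).card = (T \ S).card := Finset.card_sdiff_comm hcard
  have h4 : 0 < (T \ S).card := Finset.card_pos.2 (Finset.sdiff_nonempty.2 hne)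
  rw [h3] at h1
  nlinarith

variable {R : Type*} [Ring R] {n : ℕ}

lemma exists_blockPerm {k l : ℕ} (σ : Equiv.Perm (Fin (k + l)))
    (h : ∀ i : Fin k, ∃ j : Fin k, σ (Fin.castAdd l i) = Fin.castAdd l j) :
    ∃ π ρ, σ = blockPerm π ρ := by
  have := Equiv.Perm.mem_sumCongrHom_range_of_perm_mapsTo_inl
    (σ := finSumFinEquiv.symm.permCongr σ) (by
      rintro _ ⟨i, rfl⟩
      obtain ⟨j, hj⟩ := h i
      exact ⟨j, by simp [Equiv.permCongr_apply, hj]⟩)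
  obtain ⟨⟨π, ρ⟩, hπ⟩ := this
  refine ⟨π, ρ, ?_⟩
  rw [blockPerm]
  have h2 : Equiv.Perm.sumCongr π ρ = finSumFinEquiv.symm.permCongr σ := hπ
  rw [h2]
  ext i
  simp [Equiv.permCongr_apply]

lemma append_comp_left {k l : ℕ} (u : Fin k → Fin n) (c : Fin l → Fin n)
    (π : Equiv.Perm (Fin k)) : Fin.append (u ∘ π) c = Fin.append u c ∘ blockPerm π 1 := by
  funext i
  refine Fin.addCases (fun i => ?_) (fun i => ?_) i
  · have := congrFun (blockPerm_comp_castAdd π (1 : Equiv.Perm (Fin l))) i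
    simp only [Function.comp_apply] at this ⊢
    rw [this]; simp
  · have := congrFun (blockPerm_comp_natAdd π (1 : Equiv.Perm (Fin l))) i
    simp only [Function.comp_apply] at this ⊢
    rw [this]; simp

lemma columnOp_append_comp (b : Fin n → R) {k l : ℕ} (u : Fin k → Fin n) (c : Fin l → Fin n)
    (π : Equiv.Perm (Fin k)) : columnOp b (Fin.append (u ∘ π) c)
      = ((Equiv.Perm.sign π : ℤˣ) : ℤ) • columnOp b (Fin.append u c) := by
  rw [append_comp_left, columnOp_comp_perm, sign_blockPerm]; simp

variable [Algebra ℂ R]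

/-- A row violation lets one apply `garnir` to the top `r + 1` entries of `I` and the bottom `l`
entries of `K`, where all of the former are smaller than all of the latter. Permutations that keep
the two blocks return the original product; every other one brings a smaller entry into `K`. The
remainder ends in a column longer than `K` by one. -/
lemma columnOp_mul_columnOp_mem_of_lt {b : Fin n → R} (hb : TripleComm b) {r s l : ℕ}
    {I : Fin (r + 1 + s) → Fin n} {K : Fin (r + l) → Fin n} (hI : StrictMono I)
    (hK : StrictMono K) (hl : 0 < l)
    (hlt : I (Fin.castAdd s (Fin.last r)) < K (Fin.natAdd r ⟨0, hl⟩)) :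
    columnOp b I * columnOp b K ∈ genSpan b ^ (s + r) * colSpan b (r + 1 + l) ⊔
      Submodule.span ℂ {z | ∃ (I' : Fin (r + 1 + s) → Fin n) (K' : Fin (r + l) → Fin n),
        ∑ j, (K' j : ℕ) < ∑ j, (K j : ℕ) ∧ z = columnOp b I' * columnOp b K'} := by
  classical
  set W := genSpan b ^ (s + r) * colSpan b (r + 1 + l) ⊔
      Submodule.span ℂ {z | ∃ (I' : Fin (r + 1 + s) → Fin n) (K' : Fin (r + l) → Fin n),
        ∑ j, (K' j : ℕ) < ∑ j, (K j : ℕ) ∧ z = columnOp b I' * columnOp b K'}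
  set I₁ := I ∘ Fin.castAdd s with hI₁
  set I₂ := I ∘ Fin.natAdd (r + 1) with hI₂
  set K₁ := K ∘ Fin.castAdd l with hK₁
  set K₂ := K ∘ Fin.natAdd r with hK₂
  set x : Fin (r + 1 + l) → Fin n := Fin.append I₁ K₂ with hx
  have hIapp : Fin.append I₁ I₂ = I := Fin.append_castAdd_natAdd
  -- `garnir` lists the permuted entries first, whereas in `K` they come last; `ε` is the sign of
  -- this rearrangement.
  obtain ⟨ε, hε, hεK⟩ := columnOp_comp_equiv b (finAddFlip : Fin (l + r) ≃ Fin (r + l))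
  have hflip : ∀ u : Fin l → Fin n, Fin.append u K₁ = Fin.append K₁ u ∘ finAddFlip := by
    intro u
    funext i
    refine Fin.addCases (fun i => ?_) (fun i => ?_) i <;> simp
  have hKapp : columnOp b (Fin.append K₂ K₁) = ε • columnOp b K := by
    rw [hflip, hεK]; congr 2; exact Fin.append_castAdd_natAdd
  have hG := garnir hb x I₂ K₁
  set F : Equiv.Perm (Fin (r + 1 + l)) → R := fun σ => ((Equiv.Perm.sign σ : ℤˣ) : ℤ) •
      (columnOp b (Fin.append (x ∘ σ ∘ Fin.castAdd l) I₂)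
        * columnOp b (Fin.append (x ∘ σ ∘ Fin.natAdd (r + 1)) K₁)) with hF
  set H : Finset (Equiv.Perm (Fin (r + 1 + l))) := Finset.univ.filter fun σ =>
    ∀ i : Fin (r + 1), ∃ j : Fin (r + 1), σ (Fin.castAdd l i) = Fin.castAdd l j with hH
  have hmain : ∀ σ ∈ H, F σ = ε • (columnOp b I * columnOp b K) := by
    intro σ hσ
    obtain ⟨π, ρ, rfl⟩ := exists_blockPerm σ (Finset.mem_filter.1 hσ).2
    have e1 : x ∘ blockPerm π ρ ∘ Fin.castAdd l = I₁ ∘ π := by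
      rw [blockPerm_comp_castAdd]; funext i; simp [hx]
    have e2 : x ∘ blockPerm π ρ ∘ Fin.natAdd (r + 1) = K₂ ∘ ρ := by
      rw [blockPerm_comp_natAdd]; funext i; simp [hx]
    simp only [hF, e1, e2, columnOp_append_comp, hIapp, hKapp, sign_blockPerm, smul_mul_assoc,
      mul_smul_comm, smul_smul, Units.val_mul]
    congr 1
    rcases Int.units_eq_one_or (Equiv.Perm.sign π) with h1 | h1 <;>
    rcases Int.units_eq_one_or (Equiv.Perm.sign ρ) with h2 | h2 <;> simp [h1, h2]
  have hother : ∀ σ ∉ H, F σ ∈ W := by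
    intro σ hσ
    have hz : columnOp b (Fin.append (x ∘ σ ∘ Fin.castAdd l) I₂) *
        columnOp b (Fin.append K₁ (x ∘ σ ∘ Fin.natAdd (r + 1))) ∈ W := by
      refine Submodule.mem_sup_right (Submodule.subset_span ⟨_, _, ?_, rfl⟩)
      have hKsum : ∑ j, (K j : ℕ) = ∑ j, (K₁ j : ℕ) + ∑ j, (K₂ j : ℕ) := by
        rw [Fin.sum_univ_add]; rfl
      rw [hKsum, Fin.sum_univ_add]
      simp only [Fin.append_left, Fin.append_right, add_lt_add_iff_left]
      set T : Finset (Fin (r + 1 + l)) := Finset.univ.map (Fin.natAddEmb (r + 1)) with hT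
      set S : Finset (Fin (r + 1 + l)) := T.map σ.toEmbedding with hS
      have h1 : ∑ j, (((x ∘ σ ∘ Fin.natAdd (r + 1)) j : Fin n) : ℕ) = ∑ a ∈ S, (x a : ℕ) := by
        rw [hS, hT, Finset.sum_map, Finset.sum_map]; rfl
      have h2 : ∑ j, (K₂ j : ℕ) = ∑ a ∈ T, (x a : ℕ) := by
        rw [hT, Finset.sum_map]
        exact Finset.sum_congr rfl fun j _ => by simp [hx]
      rw [h1, h2]
      have hmemT : ∀ a, a ∈ T ↔ ∃ j, Fin.natAdd (r + 1) j = a := by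
        intro a; simp [hT]
      -- The threshold is the violating entry of `I`: it is the maximum over the block taken from
      -- `I`, and lies below the block taken from `K`.
      refine sum_lt_sum_of_exchange (m := (I (Fin.castAdd s (Fin.last r)) : ℕ))
        (by rw [hS, Finset.card_map]) ?_ ?_ ?_
      · intro hTS
        have hTS' : T = S := Finset.eq_of_subset_of_card_le hTS (by rw [hS, Finset.card_map])
        refine hσ (Finset.mem_filter.2 ⟨Finset.mem_univ _, fun i => ?_⟩)
        have hi : σ (Fin.castAdd l i) ∉ T := by
          rw [hTS', hS]
          intro hmem
          obtain ⟨a, ha, hai⟩ := Finset.mem_map.1 hmem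
          have hai' : a = Fin.castAdd l i := σ.injective hai
          obtain ⟨j, hj⟩ := (hmemT a).1 ha
          rw [hai', Fin.ext_iff] at hj
          simp at hj
          omega
        generalize σ (Fin.castAdd l i) = a at hi
        revert hi
        refine Fin.addCases (fun j _ => ⟨j, rfl⟩) (fun j hj => ?_) a
        exact absurd ((hmemT _).2 ⟨j, rfl⟩) hj
      · intro a ha
        have ha' := (Finset.mem_sdiff.1 ha).2
        revert ha'
        refine Fin.addCases (fun j _ => ?_) (fun j hj => ?_) a
        · rw [hx, Fin.append_left, hI₁, Function.comp_apply]
          exact hI.monotone (by rw [Fin.le_def]; simp; omega)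
        · exact absurd ((hmemT _).2 ⟨j, rfl⟩) hj
      · intro a ha
        obtain ⟨j, rfl⟩ := (hmemT a).1 (Finset.mem_sdiff.1 ha).1
        rw [hx, Fin.append_right, hK₂, Function.comp_apply]
        refine lt_of_lt_of_le (Fin.lt_def.1 hlt) (hK.monotone ?_)
        rw [Fin.le_def]; simp
    have hz' : F σ = (((Equiv.Perm.sign σ : ℤˣ) : ℤ) * ε) •
        (columnOp b (Fin.append (x ∘ σ ∘ Fin.castAdd l) I₂) *
        columnOp b (Fin.append K₁ (x ∘ σ ∘ Fin.natAdd (r + 1)))) := by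
      simp only [hF]
      rw [hflip, hεK, mul_smul_comm, smul_smul]
    rw [hz']
    exact zsmul_mem hz _
  have hsum : ∑ σ ∈ H, F σ ∈ W := by
    have h1 : ∑ σ ∈ H, F σ = ∑ σ, F σ - ∑ σ ∈ Hᶜ, F σ := by
      rw [← Finset.sum_add_sum_compl H F]; abel
    rw [h1]
    exact Submodule.sub_mem _ (Submodule.mem_sup_left hG)
      (Submodule.sum_mem _ fun σ hσ => hother σ (Finset.mem_compl.1 hσ))
  -- The original product occurs with coefficient `H.card * ε`, which is invertible in
  -- characteristic zero.
  rw [Finset.sum_congr rfl hmain, Finset.sum_const, ← Nat.cast_smul_eq_nsmul ℂ,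
    ← Int.cast_smul_eq_zsmul ℂ, smul_smul] at hsum
  refine (Submodule.smul_mem_iff _ ?_).1 hsum
  refine mul_ne_zero ?_ ?_
  · have : 0 < H.card := Finset.card_pos.2 ⟨1, Finset.mem_filter.2 ⟨Finset.mem_univ _,
      fun i => ⟨i, rfl⟩⟩⟩
    exact_mod_cast this.ne'
  · rcases hε with rfl | rfl <;> simp

end Straightening

/-! ### Tableaux -/

namespace Tableau

variable {n : ℕ}

/-- The number of boxes. -/
def size (A : Tableau n) : ℕ := ((List.range A.cols).map A.shape.colLen).sum

/-- The empty tableau. -/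
def empty (n : ℕ) : Tableau n where
  shape := ⊥
  filling := ⟨fun _ _ => 0, fun _ h => absurd h (YoungDiagram.notMem_bot _),
    fun _ h => absurd h (YoungDiagram.notMem_bot _), fun _ => rfl⟩
  entry_lt h := absurd h (YoungDiagram.notMem_bot _)

lemma cols_empty : (empty n).cols = 0 := by
  by_contra h
  exact YoungDiagram.notMem_bot (0, 0)
    (YoungDiagram.mem_iff_lt_rowLen.2 (Nat.pos_of_ne_zero h) : (0, 0) ∈ (⊥ : YoungDiagram))

lemma size_empty : (empty n).size = 0 := by simp [size, cols_empty]

lemma cols_pos_iff (A : Tableau n) : 0 < A.cols ↔ 0 < A.rows := by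
  rw [cols, rows, ← YoungDiagram.mem_iff_lt_rowLen, ← YoungDiagram.mem_iff_lt_colLen]

lemma colLen_le_rows (A : Tableau n) (l : ℕ) : A.shape.colLen l ≤ A.rows :=
  A.shape.colLen_anti 0 l (Nat.zero_le l)

lemma col_strictMono (A : Tableau n) (l : ℕ) : StrictMono (A.col l) := by
  intro r s hrs
  exact Fin.lt_def.2 (A.filling.col_strict hrs (YoungDiagram.mem_iff_lt_colLen.2 s.isLt))

lemma rows_le (A : Tableau n) : A.rows ≤ n := by
  have := Fintype.card_le_of_injective _ (A.col_strictMono 0).injective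
  rwa [Fintype.card_fin, Fintype.card_fin] at this

/-- The Young diagram obtained by adding a first column of length `k`. -/
def consShape (μ : YoungDiagram) (k : ℕ) (h : μ.colLen 0 ≤ k) : YoungDiagram where
  cells := (Finset.range k).image (fun r => (r, 0)) ∪ μ.cells.image fun c => (c.1, c.2 + 1)
  isLowerSet := by
    rintro ⟨r, l⟩ ⟨r', l'⟩ ⟨hr, hl⟩ hmem
    simp only at hr hl
    simp only [Finset.coe_union, Finset.coe_image, Finset.coe_range,
      Set.mem_union, Set.mem_image, Set.mem_Iio, Prod.mk.injEq, Finset.mem_coe,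
      YoungDiagram.mem_cells, Prod.exists] at hmem ⊢
    rcases hmem with ⟨s, hs, rfl, rfl⟩ | ⟨s, t, hst, rfl, rfl⟩
    · exact Or.inl ⟨r', by omega, rfl, by omega⟩
    · rcases l' with _ | l'
      · refine Or.inl ⟨r', lt_of_lt_of_le ?_ h, rfl, rfl⟩
        exact YoungDiagram.mem_iff_lt_colLen.1 (μ.up_left_mem hr (Nat.zero_le t) hst)
      · exact Or.inr ⟨r', l', μ.up_left_mem hr (by omega) hst, rfl, rfl⟩

lemma mk_zero_mem_consShape {μ : YoungDiagram} {k : ℕ} {h : μ.colLen 0 ≤ k} {r : ℕ} :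
    (r, 0) ∈ consShape μ k h ↔ r < k := by
  rw [← YoungDiagram.mem_cells]
  simp [consShape]

lemma mk_succ_mem_consShape {μ : YoungDiagram} {k : ℕ} {h : μ.colLen 0 ≤ k} {r l : ℕ} :
    (r, l + 1) ∈ consShape μ k h ↔ (r, l) ∈ μ := by
  rw [← YoungDiagram.mem_cells]
  simp [consShape]

lemma colLen_consShape_zero {μ : YoungDiagram} {k : ℕ} {h : μ.colLen 0 ≤ k} :
    (consShape μ k h).colLen 0 = k := by
  refine eq_of_forall_lt_iff fun r => ?_
  rw [← YoungDiagram.mem_iff_lt_colLen, mk_zero_mem_consShape]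

lemma colLen_consShape_succ {μ : YoungDiagram} {k : ℕ} {h : μ.colLen 0 ≤ k} {l : ℕ} :
    (consShape μ k h).colLen (l + 1) = μ.colLen l := by
  refine eq_of_forall_lt_iff fun r => ?_
  rw [← YoungDiagram.mem_iff_lt_colLen, mk_succ_mem_consShape, YoungDiagram.mem_iff_lt_colLen]

lemma rowLen_consShape_zero {μ : YoungDiagram} {k : ℕ} {h : μ.colLen 0 ≤ k} (hk : 0 < k) :
    (consShape μ k h).rowLen 0 = μ.rowLen 0 + 1 := by
  refine eq_of_forall_lt_iff fun l => ?_
  rw [← YoungDiagram.mem_iff_lt_rowLen]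
  rcases l with _ | l
  · simp [mk_zero_mem_consShape, hk]
  · rw [mk_succ_mem_consShape, YoungDiagram.mem_iff_lt_rowLen]; omega

/-- The tableau obtained by adding a first column. -/
def cons (A : Tableau n) {k : ℕ} (K : Fin k → Fin n) (hK : StrictMono K) (h : A.shape.colLen 0 ≤ k)
    (hle : ∀ r : Fin (A.shape.colLen 0), K ⟨r, r.isLt.trans_le h⟩ ≤ A.col 0 r) : Tableau n where
  shape := consShape A.shape k h
  filling :=
    { entry := fun r l => match l with
        | 0 => if hr : r < k then K ⟨r, hr⟩ else 0
        | l + 1 => A.filling r l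
      row_weak' := by
        intro r l m hlm hmem
        obtain ⟨m, rfl⟩ : ∃ m', m = m' + 1 := ⟨m - 1, by omega⟩
        rw [mk_succ_mem_consShape] at hmem
        rcases l with _ | l
        · have h0 : (r, 0) ∈ A.shape := A.shape.up_left_mem le_rfl (Nat.zero_le m) hmem
          have hr : r < A.shape.colLen 0 := YoungDiagram.mem_iff_lt_colLen.1 h0
          simp only [dif_pos (hr.trans_le h)]
          exact (Fin.le_def.1 (hle ⟨r, hr⟩)).trans
            (A.filling.row_weak_of_le (Nat.zero_le m) hmem)
        · exact A.filling.row_weak (by omega) hmem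
      col_strict' := by
        intro r s l hrs hmem
        rcases l with _ | l
        · rw [mk_zero_mem_consShape] at hmem
          simp only [dif_pos hmem, dif_pos (hrs.trans hmem)]
          exact hK hrs
        · rw [mk_succ_mem_consShape] at hmem
          exact A.filling.col_strict hrs hmem
      zeros' := by
        intro r l hmem
        rcases l with _ | l
        · rw [mk_zero_mem_consShape] at hmem
          simp [hmem]
        · rw [mk_succ_mem_consShape] at hmem
          exact A.filling.zeros hmem }
  entry_lt := by
    intro r l hmem
    rcases l with _ | l
    · rw [mk_zero_mem_consShape] at hmem
      change (if hr : r < k then (K ⟨r, hr⟩ : ℕ) else 0) < n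
      rw [dif_pos hmem]
      exact (K _).isLt
    · rw [mk_succ_mem_consShape] at hmem
      exact A.entry_lt hmem

end Tableau

/-! ### Products along tableaux and the straightening algorithm -/

section TableauOp

variable {R : Type*} [Ring R] {n : ℕ}

lemma columnOp_congr (b : Fin n → R) {k l : ℕ} (h : k = l) {I : Fin k → Fin n} {J : Fin l → Fin n}
    (hIJ : ∀ r : Fin k, I r = J (Fin.cast h r)) : columnOp b I = columnOp b J := by
  subst h
  congr 1
  exact funext hIJ

lemma tableauOp_empty (b : Fin n → R) : tableauOp b (Tableau.empty n) = 1 := by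
  simp [tableauOp, Tableau.cols_empty]

lemma tableauOp_eq_mul (b : Fin n → R) (A : Tableau n) {m : ℕ} (hm : A.cols = m + 1) :
    tableauOp b A = ((List.range m).map fun l => columnOp b (A.col (l + 1))).reverse.prod
      * columnOp b (A.col 0) := by
  simp [tableauOp, hm, List.range_succ_eq_map, Function.comp_def]

/-- Columns are multiplied from right to left, so the first column is the last factor. A column of
length zero would not raise the number of columns, whence `0 < k`. -/
lemma tableauOp_cons (b : Fin n → R) (A : Tableau n) {k : ℕ} (hk : 0 < k) (K : Fin k → Fin n)
    (hK : StrictMono K) (h : A.shape.colLen 0 ≤ k)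
    (hle : ∀ r : Fin (A.shape.colLen 0), K ⟨r, r.isLt.trans_le h⟩ ≤ A.col 0 r) :
    tableauOp b (A.cons K hK h hle) = tableauOp b A * columnOp b K := by
  have hc : (A.cons K hK h hle).cols = A.cols + 1 := Tableau.rowLen_consShape_zero (h := h) hk
  rw [tableauOp_eq_mul b _ hc, tableauOp]
  congr 1
  · congr 2
    refine List.map_congr_left fun l _ => ?_
    exact columnOp_congr b (Tableau.colLen_consShape_succ (h := h)) fun r => rfl
  · refine columnOp_congr b (Tableau.colLen_consShape_zero (h := h)) fun r => ?_
    have hr : (r : ℕ) < k := lt_of_lt_of_eq r.isLt (Tableau.colLen_consShape_zero (h := h))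
    apply Fin.ext
    change (if hr : (r : ℕ) < k then (K ⟨r, hr⟩ : ℕ) else 0) = _
    rw [dif_pos hr]; rfl

lemma size_cons (A : Tableau n) {k : ℕ} (hk : 0 < k) (K : Fin k → Fin n)
    (hK : StrictMono K) (h : A.shape.colLen 0 ≤ k)
    (hle : ∀ r : Fin (A.shape.colLen 0), K ⟨r, r.isLt.trans_le h⟩ ≤ A.col 0 r) :
    (A.cons K hK h hle).size = k + A.size := by
  have hc : (A.cons K hK h hle).cols = A.cols + 1 := Tableau.rowLen_consShape_zero (h := h) hk
  rw [Tableau.size, hc, List.range_succ_eq_map, List.map_cons, List.sum_cons, List.map_map]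
  have h0 : (A.cons K hK h hle).shape.colLen 0 = k := Tableau.colLen_consShape_zero (h := h)
  rw [h0, Tableau.size]
  congr 2
  refine List.map_congr_left fun l _ => ?_
  exact Tableau.colLen_consShape_succ (h := h)

variable [Algebra ℂ R]

lemma prod_columnOp_mem (b : Fin n → R) (A : Tableau n) (t : List ℕ) :
    (t.map fun l => columnOp b (A.col l)).reverse.prod
      ∈ genSpan b ^ (t.map A.shape.colLen).sum := by
  induction t with
  | nil => simp only [List.map_nil, List.reverse_nil, List.prod_nil, List.sum_nil, pow_zero]
           exact Submodule.one_le.1 le_rfl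
  | cons l t ih =>
    rw [List.map_cons, List.map_cons, List.reverse_cons, List.prod_append, List.prod_singleton,
      List.sum_cons, add_comm, pow_add]
    exact Submodule.mul_mem_mul ih (colSpan_le b _ (columnOp_mem_colSpan b _))

lemma exists_tableauOp_eq_mul (b : Fin n → R) (A : Tableau n) (h : 0 < A.rows) :
    ∃ d, d + A.rows = A.size ∧ ∃ u ∈ genSpan b ^ d,
      tableauOp b A = u * columnOp b (A.col 0) := by
  obtain ⟨m, hm⟩ : ∃ m, A.cols = m + 1 := ⟨A.cols - 1, by have := A.cols_pos_iff.2 h; omega⟩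
  refine ⟨(((List.range m).map (· + 1)).map A.shape.colLen).sum, ?_, _,
    prod_columnOp_mem b A ((List.range m).map (· + 1)), ?_⟩
  · rw [Tableau.size, hm, List.range_succ_eq_map, List.map_cons, List.sum_cons, Tableau.rows,
      add_comm]
  · rw [tableauOp_eq_mul b A hm]; simp [Function.comp_def]

/-! ### Spanning by tableaux -/

/-- The span of the tableau products of a given degree. -/
def tableauSpan (b : Fin n → R) (d : ℕ) : Submodule ℂ R :=
  Submodule.span ℂ (tableauOp b '' {A | A.size = d})

lemma colSpan_eq_bot (b : Fin n → R) {k : ℕ} (h : n < k) : colSpan b k = ⊥ := by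
  rw [colSpan, Submodule.span_eq_bot]
  rintro _ ⟨I, rfl⟩
  refine columnOp_of_not_injective b I fun hI => ?_
  have := Fintype.card_le_of_injective I hI
  simp at this; omega

lemma columnOp_mul_columnOp_mem {b : Fin n → R} (hb : TripleComm b) {i k r : ℕ}
    {I : Fin i → Fin n} {K : Fin k → Fin n} (hI : StrictMono I) (hK : StrictMono K)
    (hi : r < i) (hk : r < k) (hlt : I ⟨r, hi⟩ < K ⟨r, hk⟩) :
    columnOp b I * columnOp b K ∈ genSpan b ^ (i - 1) * colSpan b (k + 1) ⊔
      Submodule.span ℂ {z | ∃ (I' : Fin i → Fin n) (K' : Fin k → Fin n),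
        ∑ j, (K' j : ℕ) < ∑ j, (K j : ℕ) ∧ z = columnOp b I' * columnOp b K'} := by
  obtain ⟨s, rfl⟩ : ∃ s, i = r + 1 + s := ⟨i - (r + 1), by omega⟩
  obtain ⟨l, rfl⟩ : ∃ l, k = r + l := ⟨k - r, by omega⟩
  have h := columnOp_mul_columnOp_mem_of_lt hb hI hK (by omega) hlt
  rwa [show r + 1 + s - 1 = s + r by omega, show r + l + 1 = r + 1 + l by omega]

/-- One may take `w` to be the product of a tableau `A` and `K` to be increasing. Either `K` fits in
front of `A`, or the first column of `A` is longer than `K`, or some row is violated; in the last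
two cases the product reduces to longer final columns or to final columns of smaller entry sum. -/
lemma mul_columnOp_mem_tableauSpan {b : Fin n → R} (hb : TripleComm b) {d e k : ℕ} (hk : 0 < k)
    (hek : e + k = d) (he : genSpan b ^ e ≤ tableauSpan b e)
    (hcol : ∀ k' > k, ∀ e', e' + k' = d → genSpan b ^ e' * colSpan b k' ≤ tableauSpan b d)
    (s : ℕ) : ∀ K : Fin k → Fin n, ∑ j, (K j : ℕ) = s → ∀ w ∈ genSpan b ^ e,
      w * columnOp b K ∈ tableauSpan b d := by
  induction s using Nat.strong_induction_on with
  | _ s ih =>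
  intro K₀ hK₀ w hw
  by_cases hinj : Function.Injective K₀
  swap
  · rw [columnOp_of_not_injective b K₀ hinj, mul_zero]; exact Submodule.zero_mem _
  obtain ⟨K, hK, hKs, ε, hε⟩ : ∃ K : Fin k → Fin n, StrictMono K ∧ ∑ j, (K j : ℕ) = s ∧
      ∃ ε : ℤ, columnOp b K₀ = ε • columnOp b K := by
    refine ⟨K₀ ∘ Tuple.sort K₀, (Tuple.monotone_sort K₀).strictMono_of_injective
      (hinj.comp (Tuple.sort K₀).injective), ?_, ((Equiv.Perm.sign (Tuple.sort K₀)⁻¹ : ℤˣ) : ℤ), ?_⟩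
    · rw [← hK₀]; exact Equiv.sum_comp (Tuple.sort K₀) fun j => (K₀ j : ℕ)
    · rw [← columnOp_comp_perm, Function.comp_assoc]
      congr 1; funext i; simp
  rw [hε, mul_smul_comm]
  refine zsmul_mem ?_ _
  have hle : tableauSpan b e ≤ (tableauSpan b d).comap (LinearMap.mulRight ℂ (columnOp b K)) := by
    rw [tableauSpan, Submodule.span_le]
    rintro _ ⟨A, rfl : A.size = e, rfl⟩
    change tableauOp b A * columnOp b K ∈ tableauSpan b d
    by_cases hrows : A.shape.colLen 0 ≤ k
    · by_cases hle : ∀ r : Fin (A.shape.colLen 0), K ⟨r, r.isLt.trans_le hrows⟩ ≤ A.col 0 r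
      · rw [← tableauOp_cons b A hk K hK hrows hle]
        refine Submodule.subset_span ⟨_, ?_, rfl⟩
        rw [Set.mem_ofPred_eq, size_cons A hk]
        omega
      · push Not at hle
        obtain ⟨r, hr⟩ := hle
        have hpos : 0 < A.rows := r.pos
        obtain ⟨d', hd', u, hu, hA⟩ := exists_tableauOp_eq_mul b A hpos
        have hrow : A.rows = A.shape.colLen 0 := rfl
        have h1 := columnOp_mul_columnOp_mem hb (A.col_strictMono 0) hK r.isLt
          (r.isLt.trans_le hrows) hr
        rw [hA, mul_assoc]
        have h2 : genSpan b ^ (A.shape.colLen 0 - 1) * colSpan b (k + 1) ⊔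
            Submodule.span ℂ {z | ∃ (I' : Fin (A.shape.colLen 0) → Fin n) (K' : Fin k → Fin n),
              ∑ j, (K' j : ℕ) < ∑ j, (K j : ℕ) ∧ z = columnOp b I' * columnOp b K'}
            ≤ (tableauSpan b d).comap (LinearMap.mulLeft ℂ u) := by
          refine sup_le ?_ ?_
          · intro z hz
            -- The Garnir remainder ends in a column of length `k + 1`.
            refine hcol (k + 1) (Nat.lt_succ_self k) (d' + (A.shape.colLen 0 - 1)) (by omega) ?_
            rw [pow_add, mul_assoc]
            exact Submodule.mul_mem_mul hu hz
          · rw [Submodule.span_le]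
            rintro _ ⟨I', K', hK', rfl⟩
            change u * (columnOp b I' * columnOp b K') ∈ tableauSpan b d
            rw [← mul_assoc]
            refine ih _ (hK'.trans_eq hKs) K' rfl _ ?_
            rw [← hd', pow_add]
            exact Submodule.mul_mem_mul hu (colSpan_le b _ (columnOp_mem_colSpan b I'))
        exact h2 h1
    · push Not at hrows
      obtain ⟨d', hd', u, hu, hA⟩ := exists_tableauOp_eq_mul b A (lt_of_le_of_lt (Nat.zero_le _) hrows)
      have hrow : A.rows = A.shape.colLen 0 := rfl
      -- The longer first column of `A` is carried to the right across the `k` letters of `K` and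
      -- becomes the final column.
      refine hcol _ hrows (d' + k) (by omega) ?_
      rw [hA, mul_assoc, pow_add, mul_assoc]
      refine Submodule.mul_mem_mul hu (colSpan_mul_genSpan_pow_le hb _ _ ?_)
      exact Submodule.mul_mem_mul (columnOp_mem_colSpan b _)
        (colSpan_le b _ (columnOp_mem_colSpan b K))
  exact hle (he hw)

/-- Descending induction on the length of the final column, which stops because columns longer than
`n` vanish. -/
lemma genSpan_pow_mul_colSpan_le {b : Fin n → R} (hb : TripleComm b) {d : ℕ}
    (ih : ∀ e < d, genSpan b ^ e ≤ tableauSpan b e) (m : ℕ) :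
    ∀ k, 0 < k → n + 1 - k = m → ∀ e, e + k = d →
      genSpan b ^ e * colSpan b k ≤ tableauSpan b d := by
  induction m using Nat.strong_induction_on with
  | _ m ihm =>
  intro k hk hkm e hek
  by_cases hkn : n < k
  · rw [colSpan_eq_bot b hkn]; simp
  rw [Submodule.mul_le]
  intro w hw z hz
  have hle : colSpan b k ≤ (tableauSpan b d).comap (LinearMap.mulLeft ℂ w) := by
    rw [colSpan, Submodule.span_le]
    rintro _ ⟨K, rfl⟩
    refine mul_columnOp_mem_tableauSpan hb hk hek (ih e (by omega)) ?_ _ K rfl w hw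
    intro k' hk' e' he'
    exact ihm (n + 1 - k') (by omega) k' (by omega) rfl e' he'
  exact hle hz

/-- Straightening: every product of `d` generators is a combination of tableau products. -/
theorem genSpan_pow_le_tableauSpan {b : Fin n → R} (hb : TripleComm b) (d : ℕ) :
    genSpan b ^ d ≤ tableauSpan b d := by
  induction d using Nat.strong_induction_on with
  | _ d ih =>
  rcases d with _ | d
  · rw [pow_zero, Submodule.one_le]
    exact Submodule.subset_span ⟨Tableau.empty n, Tableau.size_empty, tableauOp_empty b⟩
  · refine le_trans ?_ (genSpan_pow_mul_colSpan_le hb ih _ 1 one_pos rfl d rfl)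
    rw [pow_succ]
    refine mul_le_mul_right ?_ _
    rw [genSpan, Submodule.span_le]
    rintro _ ⟨i, rfl⟩
    rw [← columnOp_one b i]
    exact columnOp_mem_colSpan b _

lemma adjoin_le_span_tableauOp {b : Fin n → R} (hb : TripleComm b) :
    Subalgebra.toSubmodule (Algebra.adjoin ℂ (Set.range b))
      ≤ Submodule.span ℂ (Set.range (tableauOp b)) := by
  rw [Algebra.adjoin_eq_span, Submodule.span_le]
  intro z hz
  obtain ⟨d, hd⟩ : ∃ d, z ∈ genSpan b ^ d := by
    induction hz using Submonoid.closure_induction with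
    | mem x hx => exact ⟨1, by rw [pow_one]; exact Submodule.subset_span hx⟩
    | one => exact ⟨0, by rw [pow_zero]; exact Submodule.one_le.1 le_rfl⟩
    | mul x y _ _ hx hy =>
      obtain ⟨d, hd⟩ := hx
      obtain ⟨e, he⟩ := hy
      exact ⟨d + e, by rw [pow_add]; exact Submodule.mul_mem_mul hd he⟩
  exact Submodule.span_mono (Set.image_subset_range _ _) (genSpan_pow_le_tableauSpan hb d hd)

end TableauOp

noncomputable section

/-! ### The Clifford realization -/

section Realization

variable {T : Type*} [Ring T] [Algebra ℂ T] {n q : ℕ}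

/-- The symplectic form `(η - ξ) δ_{ij} / 2`. -/
def sympl {n : ℕ} (ξ η : ℤˣ) (i j : Fin n) : ℂ :=
  if i = j then ((((η : ℤ) : ℂ) - ((ξ : ℤ) : ℂ)) / 2) else 0

/-- Weyl algebra generators `y` and Clifford generators `ε` that commute with each other. -/
structure WeylClifford (y : ℤˣ → Fin n → Fin q → T) (ε : Fin q → T) : Prop where
  comm : ∀ ξ i α β, ε β * y ξ i α = y ξ i α * ε β
  sq : ∀ α, ε α * ε α = 1
  anti : ∀ α β, α ≠ β → ε α * ε β + ε β * ε α = 0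
  weyl : ∀ ξ η i j α, y ξ i α * y η j α = y η j α * y ξ i α + sympl ξ η i j • 1
  weyl_ne : ∀ ξ η i j α β, α ≠ β → y ξ i α * y η j β = y η j β * y ξ i α

variable {y : ℤˣ → Fin n → Fin q → T} {ε : Fin q → T}

/-- The Clifford relations cancel the terms with `α ≠ β`, and each diagonal term contributes one
Weyl commutator. The scalar they add up to is the only place where `q` occurs explicitly, and it
becomes the lowest weight. -/
lemma WeylClifford.anticomm (h : WeylClifford y ε) (ξ η : ℤˣ) (i j : Fin n) :
    (∑ α, y ξ i α * ε α) * (∑ β, y η j β * ε β) + (∑ β, y η j β * ε β) * (∑ α, y ξ i α * ε α)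
      = (2 : ℂ) • ∑ α, y η j α * y ξ i α + ((q : ℂ) * sympl ξ η i j) • 1 := by
  have h1 : ∀ α β, (y ξ i α * ε α) * (y η j β * ε β) + (y η j β * ε β) * (y ξ i α * ε α)
      = if α = β then (2 : ℂ) • (y η j α * y ξ i α) + sympl ξ η i j • 1 else 0 := by
    intro α β
    have e1 : (y ξ i α * ε α) * (y η j β * ε β) = y ξ i α * y η j β * (ε α * ε β) := by
      rw [mul_assoc, ← mul_assoc (ε α), h.comm]; simp only [mul_assoc]
    have e2 : (y η j β * ε β) * (y ξ i α * ε α) = y η j β * y ξ i α * (ε β * ε α) := by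
      rw [mul_assoc, ← mul_assoc (ε β), h.comm]; simp only [mul_assoc]
    rw [e1, e2]
    split_ifs with hαβ
    · subst hαβ
      rw [h.sq, h.weyl]; simp only [mul_one]; module
    · rw [h.weyl_ne ξ η i j α β hαβ, ← mul_add, h.anti α β hαβ, mul_zero]
  rw [Finset.sum_mul_sum, Finset.sum_mul_sum,
    Finset.sum_comm (f := fun β α => y η j β * ε β * (y ξ i α * ε α)), ← Finset.sum_add_distrib]
  simp only [← Finset.sum_add_distrib, h1, Finset.sum_ite_eq, Finset.mem_univ, if_true]
  rw [Finset.sum_add_distrib, Finset.sum_const, Finset.smul_sum, Finset.card_univ,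
    Fintype.card_fin, ← Nat.cast_smul_eq_nsmul ℂ, smul_smul]

lemma WeylClifford.triple (h : WeylClifford y ε) (ξ η ζ : ℤˣ) (i j l : Fin n) :
    ((∑ α, y ξ i α * ε α) * (∑ β, y η j β * ε β) + (∑ β, y η j β * ε β) * (∑ α, y ξ i α * ε α))
        * (∑ γ, y ζ l γ * ε γ) - (∑ γ, y ζ l γ * ε γ) *
      ((∑ α, y ξ i α * ε α) * (∑ β, y η j β * ε β) + (∑ β, y η j β * ε β) * (∑ α, y ξ i α * ε α))
      = (2 * sympl ξ ζ i l) • (∑ β, y η j β * ε β)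
        + (2 * sympl η ζ j l) • (∑ α, y ξ i α * ε α) := by
  rw [h.anticomm]
  have h1 : ∀ α γ, (y η j α * y ξ i α) * (y ζ l γ * ε γ)
      = (y ζ l γ * ε γ) * (y η j α * y ξ i α) + if α = γ then
        sympl ξ ζ i l • (y η j α * ε α) + sympl η ζ j l • (y ξ i α * ε α) else 0 := by
    intro α γ
    have e1 : (y ζ l γ * ε γ) * (y η j α * y ξ i α) = y ζ l γ * y η j α * y ξ i α * ε γ := by
      rw [mul_assoc, ← mul_assoc (ε γ), h.comm, mul_assoc (y η j α), h.comm]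
      simp only [mul_assoc]
    rw [e1]
    split_ifs with hαγ
    · subst hαγ
      rw [mul_assoc (y η j α), ← mul_assoc (y ξ i α), h.weyl ξ ζ i l, add_mul, mul_add,
        smul_mul_assoc, one_mul, mul_smul_comm, ← mul_assoc, ← mul_assoc, h.weyl η ζ j l, add_mul,
        add_mul, smul_mul_assoc, smul_mul_assoc, one_mul]
      abel
    · rw [add_zero, mul_assoc (y η j α), ← mul_assoc (y ξ i α), h.weyl_ne ξ ζ i l α γ hαγ,
        ← mul_assoc, ← mul_assoc, h.weyl_ne η ζ j l α γ hαγ]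
  have h2 : (∑ α, y η j α * y ξ i α) * (∑ γ, y ζ l γ * ε γ)
      = (∑ γ, y ζ l γ * ε γ) * (∑ α, y η j α * y ξ i α)
        + (sympl ξ ζ i l • (∑ β, y η j β * ε β) + sympl η ζ j l • (∑ α, y ξ i α * ε α)) := by
    rw [Finset.sum_mul_sum, Finset.sum_mul_sum, Finset.sum_comm (γ := Fin q) (s := Finset.univ)
      (f := fun γ α => y ζ l γ * ε γ * (y η j α * y ξ i α))]
    simp only [h1, Finset.sum_add_distrib, Finset.sum_ite_eq, Finset.mem_univ, if_true,
      Finset.smul_sum]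
  rw [add_mul, mul_add, smul_mul_assoc, mul_smul_comm, smul_mul_assoc, mul_smul_comm, one_mul,
    mul_one, h2]
  module

end Realization

/-- The polynomial operators `x_{i,α}` (for the sign `1`) and `∂_{i,α}` (for the sign `-1`). -/
def weylOp (n q : ℕ) (ξ : ℤˣ) (i : Fin n) (α : Fin q) :
    Module.End ℂ (MvPolynomial (Fin n × Fin q) ℂ) :=
  if ξ = 1 then LinearMap.mulLeft ℂ (MvPolynomial.X (i, α))
  else (MvPolynomial.pderiv (R := ℂ) ((i, α) : Fin n × Fin q)).toLinearMap

lemma pderiv_comm {σ : Type*} (a b : σ) (f : MvPolynomial σ ℂ) :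
    MvPolynomial.pderiv a (MvPolynomial.pderiv b f)
      = MvPolynomial.pderiv b (MvPolynomial.pderiv a f) := by
  classical
  have h : ⁅MvPolynomial.pderiv (R := ℂ) a, MvPolynomial.pderiv (R := ℂ) b⁆ = 0 := by
    apply MvPolynomial.derivation_ext (R := ℂ)
    intro i
    simp [Derivation.commutator_apply, MvPolynomial.pderiv_X, Pi.single_apply, apply_ite]
  have := DFunLike.congr_fun h f
  simpa [Derivation.commutator_apply, sub_eq_zero] using this

lemma weylOp_comm (n q : ℕ) (ξ η : ℤˣ) (i j : Fin n) (α β : Fin q) :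
    weylOp n q ξ i α * weylOp n q η j β = weylOp n q η j β * weylOp n q ξ i α
      + (if α = β then sympl ξ η i j else 0) • 1 := by
  classical
  refine LinearMap.ext fun f => ?_
  have hij : (i, α) = (j, β) ↔ i = j ∧ α = β := Prod.mk.injEq _ _ _ _ ▸ Iff.rfl
  have hji : (j, β) = (i, α) ↔ i = j ∧ α = β := by rw [eq_comm, hij]
  rcases Int.units_eq_one_or ξ with rfl | rfl <;> rcases Int.units_eq_one_or η with rfl | rfl
  · simp [weylOp, sympl]; ring
  · by_cases h1 : i = j <;> by_cases h2 : α = β <;>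
      simp [weylOp, sympl, Derivation.leibniz, MvPolynomial.pderiv_X, hij, h1, h2]
    rw [show ((-1 - 1 : ℂ) / 2) = -1 by norm_num]
    module
  · by_cases h1 : i = j <;> by_cases h2 : α = β <;>
      simp [weylOp, sympl, Derivation.leibniz, MvPolynomial.pderiv_X, hji, h1, h2]
  · simp [weylOp, sympl]; exact pderiv_comm _ _ f

/-- The operator by which `B_i^ξ` acts. -/
def realOp (n q : ℕ) (ξ : ℤˣ) (i : Fin n) : Module.End ℂ (ClPoly n q) :=
  if ξ = 1 then X n q i else D n q i

lemma e_mul_self {q : ℕ} (α : Fin q) : (e α : Cl q) * e α = 1 := by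
  rw [e, CliffordAlgebra.ι_sq_scalar]
  simp [QuadraticMap.weightedSumSquares_apply, Pi.single_apply]

lemma e_mul_e {q : ℕ} {α β : Fin q} (h : α ≠ β) : (e α : Cl q) * e β = -(e β * e α) := by
  rw [eq_neg_iff_add_eq_zero, e, e, CliffordAlgebra.ι_mul_ι_add_swap]
  simp [QuadraticMap.polar, QuadraticMap.weightedSumSquares_apply, Pi.single_apply]
  have h1 : ∀ x : Fin q, (if x = α then (1 : ℂ) else 0) * (if x = β then 1 else 0) = 0 := by
    intro x; split_ifs <;> simp_all
  simp [mul_add, Finset.sum_add_distrib, h, h.symm]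

lemma realOp_eq (n q : ℕ) (ξ : ℤˣ) (i : Fin n) : realOp n q ξ i
    = ∑ α, LinearMap.rTensor (Cl q) (weylOp n q ξ i α)
      * LinearMap.lTensor (MvPolynomial (Fin n × Fin q) ℂ) (LinearMap.mulLeft ℂ (e α)) := by
  have h : ∀ α, LinearMap.rTensor (Cl q) (weylOp n q ξ i α)
      * LinearMap.lTensor (MvPolynomial (Fin n × Fin q) ℂ) (LinearMap.mulLeft ℂ (e α))
      = TensorProduct.map (weylOp n q ξ i α) (LinearMap.mulLeft ℂ (e α)) :=
    fun α => LinearMap.rTensor_comp_lTensor _ _ _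
  simp only [h]
  rw [realOp]
  split_ifs with hξ
  · simp only [X, weylOp, if_pos hξ]
  · simp only [D, weylOp, if_neg hξ]

lemma weylClifford (n q : ℕ) : WeylClifford
    (fun ξ i α => LinearMap.rTensor (Cl q) (weylOp n q ξ i α))
    (fun α : Fin q => LinearMap.lTensor (MvPolynomial (Fin n × Fin q) ℂ)
      (LinearMap.mulLeft ℂ (e α : Cl q))) where
  comm ξ i α β := by
    rw [Module.End.mul_eq_comp, Module.End.mul_eq_comp, LinearMap.lTensor_comp_rTensor,
      LinearMap.rTensor_comp_lTensor]
  sq α := by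
    rw [← LinearMap.lTensor_mul, Module.End.mul_eq_comp, ← LinearMap.mulLeft_mul, e_mul_self]
    ext; simp
  anti α β h := by
    rw [← LinearMap.lTensor_mul, ← LinearMap.lTensor_mul, ← LinearMap.lTensor_add,
      Module.End.mul_eq_comp, Module.End.mul_eq_comp, ← LinearMap.mulLeft_mul,
      ← LinearMap.mulLeft_mul, e_mul_e h,
      show LinearMap.mulLeft ℂ (-(e β * e α : Cl q)) + LinearMap.mulLeft ℂ (e β * e α) = 0 by
        ext; simp [mul_assoc], LinearMap.lTensor_zero]
  weyl ξ η i j α := by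
    rw [← LinearMap.rTensor_mul, weylOp_comm, if_pos rfl, LinearMap.rTensor_add,
      LinearMap.rTensor_mul, LinearMap.rTensor_smul]
    congr 2
    exact LinearMap.rTensor_id _ _
  weyl_ne ξ η i j α β h := by
    rw [← LinearMap.rTensor_mul, weylOp_comm, if_neg h, zero_smul, add_zero,
      LinearMap.rTensor_mul]

lemma realOp_triple (n q : ℕ) (i j l : Fin n) (ξ η ζ : ℤˣ) :
    (realOp n q ξ i * realOp n q η j + realOp n q η j * realOp n q ξ i) * realOp n q ζ l
      - realOp n q ζ l * (realOp n q ξ i * realOp n q η j + realOp n q η j * realOp n q ξ i)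
      = (if i = l then (((ζ : ℤ) - (ξ : ℤ) : ℤ) : ℂ) else 0) • realOp n q η j
          + (if j = l then (((ζ : ℤ) - (η : ℤ) : ℤ) : ℂ) else 0) • realOp n q ξ i := by
  simp only [realOp_eq]
  have h2 : ∀ (ξ ζ : ℤˣ) (i l : Fin n),
      2 * sympl ξ ζ i l = if i = l then (((ζ : ℤ) - (ξ : ℤ) : ℤ) : ℂ) else 0 := by
    intro ξ ζ i l
    rw [sympl]; split_ifs <;> push_cast <;> ring
  rw [(weylClifford n q).triple, h2, h2]

lemma D_one (n q : ℕ) (i : Fin n) : D n q i 1 = 0 := by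
  simp [D, Algebra.TensorProduct.one_def]

lemma D_mul_X_add_X_mul_D_one (n q : ℕ) (i j : Fin n) :
    (D n q j * X n q i + X n q i * D n q j) 1 = (if i = j then (q : ℂ) else 0) • 1 := by
  have h := (weylClifford n q).anticomm (-1) 1 j i
  have hX : X n q i = realOp n q 1 i := by simp [realOp]
  have hD : D n q j = realOp n q (-1) j := by simp [realOp]
  rw [hX, hD, realOp_eq, realOp_eq, h, LinearMap.add_apply, LinearMap.smul_apply,
    LinearMap.sum_apply]
  have h0 : ∀ α, (LinearMap.rTensor (Cl q) (weylOp n q 1 i α)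
      * LinearMap.rTensor (Cl q) (weylOp n q (-1) j α)) 1 = 0 := by
    intro α
    rw [Module.End.mul_apply, Algebra.TensorProduct.one_def, LinearMap.rTensor_tmul]
    simp [weylOp]
  rw [Finset.sum_eq_zero fun α _ => h0 α]
  simp only [smul_zero, zero_add, sympl, LinearMap.smul_apply, Module.End.one_apply]
  rcases eq_or_ne i j with rfl | hij
  · simp
  · simp [hij, hij.symm]

/-- The representation of `osp(1|2n)` on Clifford algebra valued polynomials. -/
def realization (n q : ℕ) : UOsp n →ₐ[ℂ] Module.End ℂ (ClPoly n q) :=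
  RingQuot.liftAlgHom ℂ (s := Rel n)
    ⟨FreeAlgebra.lift ℂ fun a => realOp n q a.2 a.1, by
      rintro _ _ ⟨i, j, l, ξ, η, ζ⟩
      simp only [map_sub, map_mul, map_add, map_smul, FreeAlgebra.lift_ι_apply]
      exact realOp_triple n q i j l ξ η ζ⟩

lemma realization_gen (n q : ℕ) (ξ : ℤˣ) (i : Fin n) :
    realization n q (gen n ξ i) = realOp n q ξ i := by
  have := RingQuot.liftAlgHom_mkAlgHom_apply ℂ (s := Rel n)
    (FreeAlgebra.lift ℂ fun a => realOp n q a.2 a.1) (by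
      rintro _ _ ⟨i, j, l, ξ, η, ζ⟩
      simp only [map_sub, map_mul, map_add, map_smul, FreeAlgebra.lift_ι_apply]
      exact realOp_triple n q i j l ξ η ζ) (FreeAlgebra.ι ℂ (i, ξ))
  rw [FreeAlgebra.lift_ι_apply] at this
  exact this

lemma realization_gen_pos (n q : ℕ) (i : Fin n) : realization n q (gen n 1 i) = X n q i := by
  rw [realization_gen, realOp, if_pos rfl]

lemma realization_gen_neg (n q : ℕ) (i : Fin n) : realization n q (gen n (-1) i) = D n q i := by
  rw [realization_gen, realOp, if_neg (by decide)]

/-- The polynomial `1` is a lowest weight vector of weight `q`. Hence relations modulo the vacuum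
ideal for `p = q` may be evaluated at `1`. -/
lemma realization_one_of_mem (n q : ℕ) {u : UOsp n} (hu : u ∈ vacuumIdeal n q) :
    realization n q u 1 = 0 := by
  rw [vacuumIdeal] at hu
  induction hu using Submodule.span_induction with
  | zero => simp
  | add x y _ _ hx hy => simp [hx, hy]
  | smul a x _ hx => rw [smul_eq_mul, map_mul, Module.End.mul_apply, hx, map_zero]
  | mem x hx =>
    rcases hx with (⟨i, rfl⟩ | ⟨ij, rfl⟩) | ⟨⟨i, j⟩, rfl⟩
    · simp only [realization_gen_neg, D_one]
    · simp only [map_add, map_mul, realization_gen_neg, LinearMap.add_apply, Module.End.mul_apply,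
        D_one, map_zero, add_zero]
    · simp only [map_sub, map_add, map_mul, realization_gen_neg, realization_gen_pos,
        AlgHom.commutes]
      rw [LinearMap.sub_apply, add_comm, D_mul_X_add_X_mul_D_one, Module.algebraMap_end_apply,
        sub_self]

/-! ### Leading terms of Clifford algebra valued polynomials -/

section LeadingTerm

variable {n q : ℕ}

/-- The lexicographic order on exponents. -/
def lexKey (m : Fin n × Fin q →₀ ℕ) : Lex (Fin n ×ₗ Fin q → ℕ) := toLex fun a => m (ofLex a)

lemma lexKey_add (m m' : Fin n × Fin q →₀ ℕ) : lexKey (m + m') = lexKey m + lexKey m' := rfl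

/-- The span of the terms whose exponent is smaller than `m`. -/
def lowerTerms (m : Fin n × Fin q →₀ ℕ) : Submodule ℂ (ClPoly n q) :=
  Submodule.span ℂ {z | ∃ m' c, lexKey m' < lexKey m ∧ z = MvPolynomial.monomial m' 1 ⊗ₜ[ℂ] c}

/-- The leading term of `f` is `x^m ⊗ u`. -/
def HasLeadingTerm (f : ClPoly n q) (m : Fin n × Fin q →₀ ℕ) (u : Cl q) : Prop :=
  f - MvPolynomial.monomial m 1 ⊗ₜ[ℂ] u ∈ lowerTerms m

lemma monomial_tmul_mul (m m' : Fin n × Fin q →₀ ℕ) (u u' : Cl q) :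
    (MvPolynomial.monomial m (1 : ℂ) ⊗ₜ[ℂ] u : ClPoly n q) * MvPolynomial.monomial m' 1 ⊗ₜ[ℂ] u'
      = MvPolynomial.monomial (m + m') 1 ⊗ₜ[ℂ] (u * u') := by
  rw [Algebra.TensorProduct.tmul_mul_tmul, MvPolynomial.monomial_mul, one_mul]

lemma lowerTerms_mul_le (m m' : Fin n × Fin q →₀ ℕ) :
    lowerTerms m * lowerTerms m' ≤ lowerTerms (m + m') := by
  rw [lowerTerms, lowerTerms, Submodule.span_mul_span, Submodule.span_le]
  rintro _ ⟨_, ⟨k, c, hk, rfl⟩, _, ⟨k', c', hk', rfl⟩, rfl⟩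
  refine Submodule.subset_span ⟨k + k', c * c', ?_, monomial_tmul_mul _ _ _ _⟩
  rw [lexKey_add, lexKey_add]
  exact add_lt_add hk hk'

lemma lowerTerms_mul_monomial {m m' : Fin n × Fin q →₀ ℕ} {f : ClPoly n q} (u : Cl q)
    (hf : f ∈ lowerTerms m) :
    f * MvPolynomial.monomial m' 1 ⊗ₜ[ℂ] u ∈ lowerTerms (m + m') := by
  have h : lowerTerms m ≤ (lowerTerms (m + m')).comap
      (LinearMap.mulRight ℂ ((MvPolynomial.monomial m' (1 : ℂ) ⊗ₜ[ℂ] u : ClPoly n q))) := by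
    rw [lowerTerms, Submodule.span_le]
    rintro _ ⟨k, c, hk, rfl⟩
    refine Submodule.subset_span ⟨k + m', c * u, ?_, monomial_tmul_mul _ _ _ _⟩
    rw [lexKey_add, lexKey_add]
    exact add_lt_add_left hk _
  exact h hf

lemma monomial_mul_lowerTerms {m m' : Fin n × Fin q →₀ ℕ} {f : ClPoly n q} (u : Cl q)
    (hf : f ∈ lowerTerms m') :
    MvPolynomial.monomial m 1 ⊗ₜ[ℂ] u * f ∈ lowerTerms (m + m') := by
  have h : lowerTerms m' ≤ (lowerTerms (m + m')).comap
      (LinearMap.mulLeft ℂ ((MvPolynomial.monomial m (1 : ℂ) ⊗ₜ[ℂ] u : ClPoly n q))) := by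
    rw [lowerTerms, Submodule.span_le]
    rintro _ ⟨k, c, hk, rfl⟩
    refine Submodule.subset_span ⟨m + k, u * c, ?_, monomial_tmul_mul _ _ _ _⟩
    rw [lexKey_add, lexKey_add]
    exact add_lt_add_right hk _
  exact h hf

lemma HasLeadingTerm.mul {f g : ClPoly n q} {m m' : Fin n × Fin q →₀ ℕ} {u u' : Cl q}
    (hf : HasLeadingTerm f m u) (hg : HasLeadingTerm g m' u') :
    HasLeadingTerm (f * g) (m + m') (u * u') := by
  have h : f * g - MvPolynomial.monomial (m + m') 1 ⊗ₜ[ℂ] (u * u')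
      = (f - MvPolynomial.monomial m 1 ⊗ₜ[ℂ] u) * (g - MvPolynomial.monomial m' 1 ⊗ₜ[ℂ] u')
        + (f - MvPolynomial.monomial m 1 ⊗ₜ[ℂ] u) * MvPolynomial.monomial m' 1 ⊗ₜ[ℂ] u'
        + MvPolynomial.monomial m 1 ⊗ₜ[ℂ] u * (g - MvPolynomial.monomial m' 1 ⊗ₜ[ℂ] u') := by
    rw [← monomial_tmul_mul]; simp only [mul_sub, sub_mul]; abel
  rw [HasLeadingTerm, h]
  exact Submodule.add_mem _ (Submodule.add_mem _
    (lowerTerms_mul_le m m' (Submodule.mul_mem_mul hf hg)) (lowerTerms_mul_monomial u' hf))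
    (monomial_mul_lowerTerms u hg)

lemma HasLeadingTerm.one : HasLeadingTerm (1 : ClPoly n q) 0 1 := by
  rw [HasLeadingTerm, Algebra.TensorProduct.one_def]
  have : (MvPolynomial.monomial (0 : Fin n × Fin q →₀ ℕ)) (1 : ℂ) = 1 := rfl
  rw [this, sub_self]
  exact Submodule.zero_mem _

lemma HasLeadingTerm.smul {f : ClPoly n q} {m : Fin n × Fin q →₀ ℕ} {u : Cl q}
    (hf : HasLeadingTerm f m u) (c : ℂ) : HasLeadingTerm (c • f) m (c • u) := by
  have h := Submodule.smul_mem _ c hf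
  rwa [smul_sub, ← TensorProduct.tmul_smul] at h

/-- The Clifford coefficient of a monomial. -/
def clCoeff (m : Fin n × Fin q →₀ ℕ) : ClPoly n q →ₗ[ℂ] Cl q :=
  (TensorProduct.lid ℂ (Cl q)).toLinearMap ∘ₗ LinearMap.rTensor (Cl q) (MvPolynomial.lcoeff ℂ m)

lemma clCoeff_monomial_tmul (m m' : Fin n × Fin q →₀ ℕ) (c : Cl q) :
    clCoeff m (MvPolynomial.monomial m' 1 ⊗ₜ[ℂ] c) = if m' = m then c else 0 := by
  simp [clCoeff, MvPolynomial.lcoeff_apply, MvPolynomial.coeff_monomial]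

lemma clCoeff_of_mem_lowerTerms {m m' : Fin n × Fin q →₀ ℕ} (h : lexKey m' ≤ lexKey m)
    {f : ClPoly n q} (hf : f ∈ lowerTerms m') : clCoeff m f = 0 := by
  induction hf using Submodule.span_induction with
  | zero => simp
  | add x y _ _ hx hy => simp [hx, hy]
  | smul a x _ hx => simp [hx]
  | mem x hx =>
    obtain ⟨k, c, hk, rfl⟩ := hx
    rw [clCoeff_monomial_tmul, if_neg]
    rintro rfl
    exact absurd hk (not_lt.2 h)

lemma HasLeadingTerm.clCoeff_eq {f : ClPoly n q} {m m' : Fin n × Fin q →₀ ℕ} {u : Cl q}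
    (hf : HasLeadingTerm f m' u) (h : lexKey m' ≤ lexKey m) :
    clCoeff m f = if m' = m then u else 0 := by
  have := clCoeff_of_mem_lowerTerms h hf
  rwa [map_sub, clCoeff_monomial_tmul, sub_eq_zero] at this

/-- In a vanishing combination, the largest leading monomial of the support occurs in only one of
the vectors. -/
lemma linearIndependent_of_hasLeadingTerm {ι : Type*} {f : ι → ClPoly n q}
    {m : ι → Fin n × Fin q →₀ ℕ} {u : ι → Cl q} (hm : Function.Injective m) (hu : ∀ i, u i ≠ 0)
    (h : ∀ i, HasLeadingTerm (f i) (m i) (u i)) : LinearIndependent ℂ f := by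
  rw [linearIndependent_iff]
  intro l hl
  by_contra hne
  obtain ⟨i, hi, hmax⟩ := Finset.exists_max_image l.support (fun i => lexKey (m i))
    (Finsupp.support_nonempty_iff.2 hne)
  have h1 := congrArg (clCoeff (m i)) hl
  rw [Finsupp.linearCombination_apply, Finsupp.sum, map_sum, map_zero,
    Finset.sum_eq_single_of_mem i hi] at h1
  · rw [map_smul, (h i).clCoeff_eq le_rfl, if_pos rfl] at h1
    rcases smul_eq_zero.1 h1 with h2 | h2
    · exact Finsupp.mem_support_iff.1 hi h2
    · exact hu i h2
  · intro j hj hji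
    rw [map_smul, (h j).clCoeff_eq (hmax j hj), if_neg (fun h => hji (hm h)), smul_zero]

end LeadingTerm

/-! ### Columns in the Clifford realization -/

section ClColumn

variable {n q : ℕ}

lemma e_tripleComm (q : ℕ) : TripleComm (fun α : Fin q => (e α : Cl q)) := by
  intro i j l
  rcases eq_or_ne i j with rfl | h
  · simp only [e_mul_self, add_mul, mul_add, one_mul, mul_one]
  · simp only [e_mul_e h, neg_add_cancel, zero_mul, mul_zero]

lemma wordOp_e_mul_e {k : ℕ} (s : Fin k → Fin q) (a : Fin q) (h : ∀ r, s r ≠ a) :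
    wordOp (fun α : Fin q => (e α : Cl q)) s * e a
      = (-1 : ℂ) ^ k • (e a * wordOp (fun α : Fin q => (e α : Cl q)) s) := by
  induction k with
  | zero => simp [wordOp_zero]
  | succ k ih =>
    rw [wordOp_succ, mul_assoc, ih _ fun r => h r.succ, mul_smul_comm, ← mul_assoc,
      e_mul_e (h 0), pow_succ, neg_mul, mul_smul, mul_assoc]
    simp

/-- Distinct Clifford generators anticommute, so all signed rearrangements agree; in the induction
the two terms of `columnOp_cons` coincide. -/
lemma columnOp_e {k : ℕ} (s : Fin k → Fin q) (hs : Function.Injective s) :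
    columnOp (fun α : Fin q => (e α : Cl q)) s
      = (k.factorial : ℂ) • wordOp (fun α : Fin q => (e α : Cl q)) s := by
  induction k with
  | zero => simp [columnOp_zero, wordOp_zero]
  | succ k ih =>
    have hs' : Function.Injective (fun r : Fin k => s r.succ) :=
      hs.comp (Fin.succ_injective k)
    have e1 : s = Fin.cons (s 0) (fun r : Fin k => s r.succ) := (Fin.cons_self_tail s).symm
    rw [wordOp_succ]
    conv_lhs => rw [e1]
    rw [columnOp_cons (e_tripleComm q), ih _ hs', smul_mul_assoc, wordOp_e_mul_e _ _
      (fun r hr => absurd (hs hr) (Fin.succ_ne_zero r)), mul_smul_comm, Nat.factorial_succ]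
    simp only [smul_smul, ← mul_assoc]
    rw [mul_right_comm, ← pow_add, ← two_mul, pow_mul]
    push_cast
    simp only [neg_one_sq, one_pow, one_mul]
    module

/-- Units are needed because the Clifford algebra may have zero divisors, and leading coefficients
are going to be multiplied. -/
lemma isUnit_wordOp_e {k : ℕ} (s : Fin k → Fin q) :
    IsUnit (wordOp (fun α : Fin q => (e α : Cl q)) s) := by
  induction k with
  | zero => rw [wordOp_zero]; exact isUnit_one
  | succ k ih =>
    rw [wordOp_succ]
    exact IsUnit.mul ⟨⟨e (s 0), e (s 0), e_mul_self _, e_mul_self _⟩, rfl⟩ (ih _)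

/-- The element `∑_α x_{i,α} e_α`, by which `X_i` multiplies. -/
def clVar (n q : ℕ) (i : Fin n) : ClPoly n q :=
  ∑ α : Fin q, (MvPolynomial.X (i, α) : MvPolynomial (Fin n × Fin q) ℂ) ⊗ₜ[ℂ] e α

lemma X_eq_lmul (n q : ℕ) (i : Fin n) : X n q i = Algebra.lmul ℂ (ClPoly n q) (clVar n q i) := by
  rw [X, clVar, map_sum]
  refine Finset.sum_congr rfl fun α _ => ?_
  refine TensorProduct.ext' fun f c => ?_
  simp

/-- The exponent of the product of the `x_{I(r), s(r)}`. -/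
def wordExp {k : ℕ} (I : Fin k → Fin n) (s : Fin k → Fin q) : Fin n × Fin q →₀ ℕ :=
  ∑ r, Finsupp.single (I r, s r) 1

lemma wordExp_comp_perm {k : ℕ} (I : Fin k → Fin n) (s : Fin k → Fin q)
    (σ : Equiv.Perm (Fin k)) : wordExp (I ∘ σ) (s ∘ σ) = wordExp I s :=
  Equiv.sum_comp σ fun r => Finsupp.single (I r, s r) 1

lemma prod_X_eq {k : ℕ} (I : Fin k → Fin n) (s : Fin k → Fin q) :
    (List.ofFn fun r => (MvPolynomial.X (I r, s r) : MvPolynomial (Fin n × Fin q) ℂ)).prod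
      = MvPolynomial.monomial (wordExp I s) 1 := by
  rw [List.prod_ofFn, wordExp, MvPolynomial.monomial_sum_one]
  rfl

lemma wordOp_clVar {k : ℕ} (I : Fin k → Fin n) : wordOp (clVar n q) I
    = ∑ s : Fin k → Fin q, MvPolynomial.monomial (wordExp I s) 1 ⊗ₜ[ℂ]
        wordOp (fun α : Fin q => (e α : Cl q)) s := by
  have h := (MultilinearMap.mkPiAlgebraFin ℂ k (ClPoly n q)).map_sum
    (fun (r : Fin k) (α : Fin q) =>
      (MvPolynomial.X (I r, α) : MvPolynomial (Fin n × Fin q) ℂ) ⊗ₜ[ℂ] (e α : Cl q))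
  simp only [MultilinearMap.mkPiAlgebraFin_apply] at h
  rw [wordOp]
  refine h.trans (Finset.sum_congr rfl fun s _ => ?_)
  rw [list_prod_tmul, prod_X_eq]
  rfl

lemma columnOp_clVar {k : ℕ} (I : Fin k → Fin n) : columnOp (clVar n q) I
    = ∑ s : Fin k → Fin q, MvPolynomial.monomial (wordExp I s) 1 ⊗ₜ[ℂ]
        columnOp (fun α : Fin q => (e α : Cl q)) s := by
  simp only [columnOp_eq, wordOp_clVar, TensorProduct.tmul_sum, Finset.smul_sum]
  symm
  rw [Finset.sum_comm]
  refine Finset.sum_congr rfl fun σ _ => ?_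
  refine Fintype.sum_equiv (Equiv.arrowCongr σ.symm (Equiv.refl _)) _ _ fun s => ?_
  have h1 : (Equiv.arrowCongr σ.symm (Equiv.refl (Fin q))) s = s ∘ σ := rfl
  rw [h1, wordExp_comp_perm, TensorProduct.tmul_smul]

lemma columnOp_clVar_eq_zero {k : ℕ} (I : Fin k → Fin n) (h : q < k) :
    columnOp (clVar n q) I = 0 := by
  rw [columnOp_clVar]
  refine Finset.sum_eq_zero fun s _ => ?_
  rw [columnOp_of_not_injective, TensorProduct.tmul_zero]
  intro hs
  have := Fintype.card_le_of_injective s hs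
  simp at this; omega

lemma wordExp_apply {k : ℕ} (I : Fin k → Fin n) (s : Fin k → Fin q) (a : Fin n × Fin q) :
    wordExp I s a = ∑ r, if (I r, s r) = a then 1 else 0 := by
  simp [wordExp, Finsupp.finsetSum_apply, Finsupp.single_apply]

/-- At the first row where `s` departs from the identity, injectivity forces a larger value, because
the smaller ones are used up. The identity therefore owns the earlier variable, which wins
lexicographically. -/
lemma lexKey_wordExp_lt {k : ℕ} (hk : k ≤ q) {I : Fin k → Fin n} (hI : StrictMono I)
    {s : Fin k → Fin q} (hs : Function.Injective s) (hne : s ≠ Fin.castLE hk) :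
    lexKey (wordExp I s) < lexKey (wordExp I (Fin.castLE hk)) := by
  classical
  have hex : ∃ r : ℕ, ∃ h : r < k, s ⟨r, h⟩ ≠ Fin.castLE hk ⟨r, h⟩ := by
    by_contra hc
    push Not at hc
    exact hne (funext fun r => hc r r.isLt)
  obtain ⟨hrk, hr⟩ := Nat.find_spec hex
  set r₀ := Nat.find hex
  set r : Fin k := ⟨r₀, hrk⟩ with hrdef
  have hmin : ∀ t : Fin k, t < r → s t = Fin.castLE hk t := by
    intro t ht
    by_contra hc
    exact Nat.find_min hex ht ⟨t.isLt, hc⟩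
  have hgt : Fin.castLE hk r < s r := by
    refine lt_of_le_of_ne ?_ (Ne.symm hr)
    by_contra hc
    push Not at hc
    have h1 : (s r : ℕ) < r₀ := hc
    have h2 := hmin ⟨s r, h1.trans hrk⟩ h1
    have h3 : s ⟨s r, h1.trans hrk⟩ = s r := by rw [h2]; ext; simp
    exact absurd (congrArg Fin.val (hs h3)) h1.ne
  -- The deciding position. Earlier variables receive equal exponents, since entries below row `r`
  -- have a larger first index; at this one the exponents are zero and positive.
  refine ⟨toLex (I r, Fin.castLE hk r), ?_, ?_⟩
  · rintro b hb
    obtain ⟨⟨i, α⟩, rfl⟩ := toLex.surjective b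
    change wordExp I s (i, α) = wordExp I (Fin.castLE hk) (i, α)
    have hb' := (Prod.Lex.toLex_lt_toLex (α := Fin n) (β := Fin q)).1 hb
    simp only at hb'
    rw [wordExp_apply, wordExp_apply]
    refine Finset.sum_congr rfl fun t _ => ?_
    rcases lt_trichotomy t r with ht | ht | ht
    · rw [hmin t ht]
    · subst ht
      rw [if_neg, if_neg]
      · rintro h
        obtain ⟨rfl, rfl⟩ := Prod.mk.inj h
        rcases hb' with h | h
        · exact lt_irrefl _ h
        · exact lt_irrefl _ h.2
      · rintro h
        obtain ⟨rfl, rfl⟩ := Prod.mk.inj h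
        rcases hb' with h | h
        · exact lt_irrefl _ h
        · exact lt_asymm h.2 hgt
    · have hlt : I r < I t := hI ht
      have hi : i ≤ I r := by rcases hb' with h | h; exacts [h.le, h.1.le]
      have hne' : I t ≠ i := (hi.trans_lt hlt).ne'
      rw [if_neg fun h => hne' (Prod.mk.inj h).1, if_neg fun h => hne' (Prod.mk.inj h).1]
  · change wordExp I s (I r, Fin.castLE hk r) < wordExp I (Fin.castLE hk) (I r, Fin.castLE hk r)
    rw [wordExp_apply, wordExp_apply]
    have h0 : ∑ t, (if (I t, s t) = (I r, Fin.castLE hk r) then 1 else 0) = 0 := by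
      refine Finset.sum_eq_zero fun t _ => if_neg fun h => ?_
      have ht : t = r := hI.injective (Prod.mk.inj h).1
      subst ht
      exact hr (Prod.mk.inj h).2
    rw [h0]
    exact Finset.sum_pos' (fun _ _ => Nat.zero_le _) ⟨r, Finset.mem_univ _, by simp⟩

lemma columnOp_clVar_hasLeadingTerm {k : ℕ} (hk : k ≤ q) {I : Fin k → Fin n}
    (hI : StrictMono I) : ∃ u, IsUnit u ∧
      HasLeadingTerm (columnOp (clVar n q) I) (wordExp I (Fin.castLE hk)) u := by
  refine ⟨columnOp (fun α : Fin q => (e α : Cl q)) (Fin.castLE hk), ?_, ?_⟩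
  · rw [columnOp_e _ (Fin.castLE_injective hk)]
    have h0 : IsUnit (k.factorial : ℂ) := isUnit_iff_ne_zero.2 (by exact_mod_cast k.factorial_ne_zero)
    rw [Algebra.smul_def]
    exact (h0.map _).mul (isUnit_wordOp_e _)
  · rw [HasLeadingTerm, columnOp_clVar, ← Finset.add_sum_erase _ _ (Finset.mem_univ (Fin.castLE hk)),
      add_sub_cancel_left]
    refine Submodule.sum_mem _ fun s hs => ?_
    by_cases hinj : Function.Injective s
    · exact Submodule.subset_span
        ⟨_, _, lexKey_wordExp_lt hk hI hinj (Finset.ne_of_mem_erase hs), rfl⟩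
    · rw [columnOp_of_not_injective _ _ hinj, TensorProduct.tmul_zero]
      exact Submodule.zero_mem _

end ClColumn

/-! ### Leading terms of the tableau vectors -/

section TableauLeadingTerm

variable {n q : ℕ}

lemma map_tableauOp {R S F : Type*} [Ring R] [Ring S] [FunLike F R S] [RingHomClass F R S] (φ : F)
    (b : Fin n → R) (A : Tableau n) : φ (tableauOp b A) = tableauOp (fun i => φ (b i)) A := by
  simp only [tableauOp, map_list_prod, List.map_reverse, List.map_map, Function.comp_def,
    map_columnOp]

/-- The exponent of the leading monomial attached to a tableau. -/
def tableauExp (A : Tableau n) (h : A.rows ≤ q) : Fin n × Fin q →₀ ℕ :=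
  ((List.range A.cols).map fun l =>
    wordExp (A.col l) (Fin.castLE ((A.colLen_le_rows l).trans h))).sum

lemma tableauOp_clVar_hasLeadingTerm (A : Tableau n) (h : A.rows ≤ q) :
    ∃ u, IsUnit u ∧ HasLeadingTerm (tableauOp (clVar n q) A) (tableauExp A h) u := by
  rw [tableauOp, tableauExp]
  generalize List.range A.cols = t
  induction t with
  | nil => exact ⟨1, isUnit_one, HasLeadingTerm.one⟩
  | cons l t ih =>
    obtain ⟨u, hu, ht⟩ := ih
    obtain ⟨u', hu', ht'⟩ := columnOp_clVar_hasLeadingTerm ((A.colLen_le_rows l).trans h)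
      (A.col_strictMono l)
    refine ⟨u * u', hu.mul hu', ?_⟩
    rw [List.map_cons, List.map_cons, List.reverse_cons, List.prod_append, List.prod_singleton,
      List.sum_cons, add_comm]
    exact ht.mul ht'

/-- In each column, the leading monomial pairs the entry of row `α` with the Clifford index `α`, so
its exponents are the row contents of the tableau. -/
lemma tableauExp_apply (A : Tableau n) (h : A.rows ≤ q) (i : Fin n) (α : Fin q) :
    tableauExp A h (i, α)
      = ((Finset.range (A.shape.rowLen α)).filter fun l => A.filling α l = i).card := by
  have h1 : tableauExp A h (i, α) = ∑ l ∈ Finset.range A.cols,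
      wordExp (A.col l) (Fin.castLE ((A.colLen_le_rows l).trans h)) (i, α) := by
    rw [tableauExp, ← Finsupp.finsetSum_apply]
    rfl
  have h2 : ∀ l, wordExp (A.col l) (Fin.castLE ((A.colLen_le_rows l).trans h)) (i, α)
      = if (l < A.shape.rowLen α ∧ A.filling α l = i) then 1 else 0 := by
    intro l
    rw [wordExp_apply]
    by_cases hl : l < A.shape.rowLen α
    · have hα : (α : ℕ) < A.shape.colLen l := by
        rwa [← YoungDiagram.mem_iff_lt_colLen, YoungDiagram.mem_iff_lt_rowLen]
      rw [Finset.sum_eq_single_of_mem (⟨α, hα⟩ : Fin (A.shape.colLen l)) (Finset.mem_univ _)]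
      · have : Fin.castLE ((A.colLen_le_rows l).trans h) ⟨α, hα⟩ = α := by ext; simp
        rw [this]
        refine if_congr ?_ rfl rfl
        rw [Prod.mk.injEq, and_iff_left rfl, and_iff_right hl, Fin.ext_iff]
        rfl
      · intro r _ hr
        refine if_neg fun hc => hr ?_
        have := congrArg Fin.val (Prod.mk.inj hc).2
        exact Fin.ext this
    · rw [if_neg fun hc => hl hc.1]
      refine Finset.sum_eq_zero fun r _ => if_neg fun hc => hl ?_
      have h3 : (r : ℕ) = α := congrArg Fin.val (Prod.mk.inj hc).2
      rw [← YoungDiagram.mem_iff_lt_rowLen, YoungDiagram.mem_iff_lt_colLen, ← h3]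
      exact r.isLt
  rw [h1, Finset.sum_congr rfl fun l _ => h2 l, ← Finset.sum_filter, Finset.sum_const, smul_eq_mul,
    mul_one]
  congr 1
  ext l
  simp only [Finset.mem_filter, Finset.mem_range]
  have h4 := A.shape.rowLen_anti 0 α (Nat.zero_le _)
  constructor
  · rintro ⟨-, h5⟩; exact h5
  · intro h5; exact ⟨h5.1.trans_le h4, h5⟩

lemma filter_le_eq_range {L : ℕ} {f : ℕ → ℕ} (hf : ∀ l m, l ≤ m → m < L → f l ≤ f m) (i : ℕ) :
    (Finset.range L).filter (fun l => f l ≤ i)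
      = Finset.range ((Finset.range L).filter fun l => f l ≤ i).card := by
  set S := (Finset.range L).filter fun l => f l ≤ i
  have hS : ∀ l m, l ≤ m → m ∈ S → l ∈ S := by
    intro l m hlm hm
    have h1 := Finset.mem_filter.1 hm
    have h2 := Finset.mem_range.1 h1.1
    exact Finset.mem_filter.2 ⟨Finset.mem_range.2 (hlm.trans_lt h2), (hf l m hlm h2).trans h1.2⟩
  refine Finset.eq_of_subset_of_card_le (fun m hm => ?_) (by simp)
  rw [Finset.mem_range]
  have h3 : Finset.range (m + 1) ⊆ S := fun l hl =>
    hS l m (Nat.lt_succ_iff.1 (Finset.mem_range.1 hl)) hm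
  have := Finset.card_le_card h3
  rw [Finset.card_range] at this
  omega

/-- The positions with value at most `i` form an initial segment whose length is a sum of
multiplicities. Hence the multiplicities recover a weakly increasing row. -/
lemma monotone_seq_ext {L L' : ℕ} {f g : ℕ → ℕ} (hf : ∀ l m, l ≤ m → m < L → f l ≤ f m)
    (hg : ∀ l m, l ≤ m → m < L' → g l ≤ g m) (hfn : ∀ l < L, f l < n) (hgn : ∀ l < L', g l < n)
    (h : ∀ i < n, ((Finset.range L).filter fun l => f l = i).card
      = ((Finset.range L').filter fun l => g l = i).card) :
    L = L' ∧ ∀ l < L, f l = g l := by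
  have hcum : ∀ (L : ℕ) (f : ℕ → ℕ) (i : ℕ), ((Finset.range L).filter fun l => f l ≤ i).card
      = ∑ j ∈ Finset.range (i + 1), ((Finset.range L).filter fun l => f l = j).card := by
    intro L f i
    rw [Finset.card_eq_sum_card_fiberwise (f := f) (t := Finset.range (i + 1))]
    · refine Finset.sum_congr rfl fun j hj => ?_
      rw [Finset.filter_filter]
      congr 1
      refine Finset.filter_congr fun l _ => ?_
      have := Finset.mem_range.1 hj
      constructor
      · exact fun h => h.2
      · rintro rfl; exact ⟨by omega, rfl⟩
    · intro l hl
      have := (Finset.mem_filter.1 hl).2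
      simp; omega
  have hiff : ∀ i < n, ∀ l, (l < L ∧ f l ≤ i) ↔ (l < L' ∧ g l ≤ i) := by
    intro i hi l
    have e1 := Finset.ext_iff.1 (filter_le_eq_range hf i) l
    have e2 := Finset.ext_iff.1 (filter_le_eq_range hg i) l
    simp only [Finset.mem_filter, Finset.mem_range] at e1 e2
    rw [e1, e2, hcum, hcum, Finset.sum_congr rfl fun j hj => h j
      ((Nat.lt_succ_iff.1 (Finset.mem_range.1 hj)).trans_lt hi)]
  have hlt : ∀ l, l < L ↔ l < L' := by
    intro l
    constructor
    · intro hl; exact ((hiff (f l) (hfn l hl) l).1 ⟨hl, le_rfl⟩).1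
    · intro hl; exact ((hiff (g l) (hgn l hl) l).2 ⟨hl, le_rfl⟩).1
  refine ⟨eq_of_forall_lt_iff hlt, fun l hl => le_antisymm ?_ ?_⟩
  · have hl' := (hlt l).1 hl
    exact ((hiff (g l) (hgn l hl') l).2 ⟨hl', le_rfl⟩).2
  · exact ((hiff (f l) (hfn l hl) l).1 ⟨hl, le_rfl⟩).2

lemma Tableau.ext_of_mem_iff {A B : Tableau n} (h : ∀ c, c ∈ A.shape ↔ c ∈ B.shape)
    (h' : ∀ r l, (r, l) ∈ A.shape → A.filling r l = B.filling r l) : A = B := by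
  obtain ⟨μ, f, hf⟩ := A
  obtain ⟨ν, g, hg⟩ := B
  obtain rfl : μ = ν := SetLike.ext h
  have : f = g := by
    ext r l
    by_cases hm : (r, l) ∈ μ
    · exact h' r l hm
    · rw [f.zeros hm, g.zeros hm]
  subst this
  rfl

lemma tableauExp_injective {A B : Tableau n} (hA : A.rows ≤ q) (hB : B.rows ≤ q)
    (h : tableauExp A hA = tableauExp B hB) : A = B := by
  have hrow : ∀ α : Fin q, A.shape.rowLen α = B.shape.rowLen α ∧
      ∀ l < A.shape.rowLen α, A.filling α l = B.filling α l := by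
    intro α
    refine monotone_seq_ext (n := n) ?_ ?_ ?_ ?_ ?_
    · intro l m hlm hm
      exact A.filling.row_weak_of_le hlm (YoungDiagram.mem_iff_lt_rowLen.2 hm)
    · intro l m hlm hm
      exact B.filling.row_weak_of_le hlm (YoungDiagram.mem_iff_lt_rowLen.2 hm)
    · intro l hl; exact A.entry_lt (YoungDiagram.mem_iff_lt_rowLen.2 hl)
    · intro l hl; exact B.entry_lt (YoungDiagram.mem_iff_lt_rowLen.2 hl)
    · intro i hi
      have := DFunLike.congr_fun h (⟨i, hi⟩, α)
      rwa [tableauExp_apply, tableauExp_apply] at this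
  have hlt : ∀ (C : Tableau n), C.rows ≤ q → ∀ r l, (r, l) ∈ C.shape → r < q := by
    intro C hC r l hm
    exact ((YoungDiagram.mem_iff_lt_colLen.1 hm).trans_le (C.colLen_le_rows l)).trans_le hC
  apply Tableau.ext_of_mem_iff
  · rintro ⟨r, l⟩
    constructor
    · intro hm
      have := (hrow ⟨r, hlt A hA r l hm⟩).1
      rw [YoungDiagram.mem_iff_lt_rowLen] at hm ⊢
      exact hm.trans_eq this
    · intro hm
      have := (hrow ⟨r, hlt B hB r l hm⟩).1
      rw [YoungDiagram.mem_iff_lt_rowLen] at hm ⊢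
      exact hm.trans_eq this.symm
  · intro r l hm
    exact (hrow ⟨r, hlt A hA r l hm⟩).2 l (YoungDiagram.mem_iff_lt_rowLen.1 hm)

lemma ω_eq (n q : ℕ) (A : Tableau n) : ω n q A = tableauOp (clVar n q) A := by
  have h := map_tableauOp (Algebra.lmul ℂ (ClPoly n q)) (clVar n q) A
  have h2 : X n q = fun i => Algebra.lmul ℂ (ClPoly n q) (clVar n q i) :=
    funext fun i => X_eq_lmul n q i
  rw [ω, h2, ← h]
  exact mul_one _

lemma shapeFactorial_ne_zero (A : Tableau n) : (A.shapeFactorial : ℂ) ≠ 0 := by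
  rw [Nat.cast_ne_zero, Tableau.shapeFactorial, Finset.prod_ne_zero_iff]
  exact fun l _ => Nat.factorial_ne_zero _

/-- The normalised tableau vectors with at most `q` rows are linearly independent. -/
theorem linearIndependent_ωTilde (n q : ℕ) :
    LinearIndependent ℂ (fun A : {A : Tableau n // A.rows ≤ q} => ωTilde n q A.1) := by
  choose u hu h using fun A : {A : Tableau n // A.rows ≤ q} =>
    tableauOp_clVar_hasLeadingTerm A.1 A.2
  have : Nontrivial (Cl q) := inferInstance
  refine linearIndependent_of_hasLeadingTerm (m := fun A => tableauExp A.1 A.2)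
    (u := fun A => (A.1.shapeFactorial : ℂ)⁻¹ • u A) ?_ ?_ ?_
  · intro A B hAB
    exact Subtype.ext (tableauExp_injective A.2 B.2 hAB)
  · intro A
    exact smul_ne_zero (inv_ne_zero (shapeFactorial_ne_zero A.1)) (hu A).ne_zero
  · intro A
    have := (h A).smul (A.1.shapeFactorial : ℂ)⁻¹
    rwa [← ω_eq] at this

/-- The first column would need more than `q` distinct Clifford indices. -/
lemma ωTilde_eq_zero (n q : ℕ) (A : Tableau n) (h : q < A.rows) : ωTilde n q A = 0 := by
  obtain ⟨m, hm⟩ : ∃ m, A.cols = m + 1 :=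
    ⟨A.cols - 1, by have := A.cols_pos_iff.2 (by omega); omega⟩
  rw [ωTilde, ω_eq, tableauOp_eq_mul _ A hm,
    columnOp_clVar_eq_zero (A.col 0) (show q < A.shape.colLen 0 from h), mul_zero, smul_zero]

end TableauLeadingTerm

/-! ### The enveloping algebra -/

section Enveloping

variable {n : ℕ}

lemma gen_triple (n : ℕ) (i j l : Fin n) (ξ η ζ : ℤˣ) :
    (gen n ξ i * gen n η j + gen n η j * gen n ξ i) * gen n ζ l
      - gen n ζ l * (gen n ξ i * gen n η j + gen n η j * gen n ξ i)
      = (if i = l then (((ζ : ℤ) - (ξ : ℤ) : ℤ) : ℂ) else 0) • gen n η j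
          + (if j = l then (((ζ : ℤ) - (η : ℤ) : ℤ) : ℂ) else 0) • gen n ξ i := by
  have h := RingQuot.mkAlgHom_rel ℂ (Rel.triple i j l ξ η ζ)
  simp only [map_sub, map_mul, map_add, map_smul] at h
  exact h

lemma gen_pos_tripleComm (n : ℕ) : TripleComm (gen n 1) := by
  intro i j l
  have h := gen_triple n i j l 1 1 1
  simpa [sub_eq_zero] using h

lemma anticomm_mul_gen_pos (i j l : Fin n) :
    (gen n 1 j * gen n (-1) i + gen n (-1) i * gen n 1 j) * gen n 1 l
      = gen n 1 l * (gen n 1 j * gen n (-1) i + gen n (-1) i * gen n 1 j)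
        + (if i = l then (2 : ℂ) else 0) • gen n 1 j := by
  have h := gen_triple n j i l 1 (-1) 1
  rw [sub_eq_iff_eq_add] at h
  rw [h, add_comm]
  congr 1
  norm_num

lemma adjoin_gen (n : ℕ) :
    Algebra.adjoin ℂ (Set.range fun a : ℤˣ × Fin n => gen n a.1 a.2) = ⊤ := by
  rw [eq_top_iff]
  intro u _
  obtain ⟨x, rfl⟩ := RingQuot.mkAlgHom_surjective ℂ (Rel n) u
  have hx : x ∈ Algebra.adjoin ℂ (Set.range (FreeAlgebra.ι ℂ (X := Fin n × ℤˣ))) := by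
    rw [FreeAlgebra.adjoin_range_ι]; trivial
  have h2 : RingQuot.mkAlgHom ℂ (Rel n) x ∈ (Algebra.adjoin ℂ (Set.range
      (FreeAlgebra.ι ℂ (X := Fin n × ℤˣ)))).map (RingQuot.mkAlgHom ℂ (Rel n)) := ⟨x, hx, rfl⟩
  rw [AlgHom.map_adjoin] at h2
  refine Algebra.adjoin_mono ?_ h2
  rintro _ ⟨_, ⟨a, rfl⟩, rfl⟩
  exact ⟨(a.2, a.1), rfl⟩

/-- The action of a lowering operator is affine in `p` modulo the vacuum relations. -/
lemma exists_lowering (i : Fin n) {w : UOsp n}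
    (hw : w ∈ Algebra.adjoin ℂ (Set.range (gen n 1))) :
    ∃ u₀ ∈ Algebra.adjoin ℂ (Set.range (gen n 1)), ∃ u₁ ∈ Algebra.adjoin ℂ (Set.range (gen n 1)),
      ∀ p : ℕ, gen n (-1) i * w - (u₀ + (p : ℂ) • u₁) ∈ vacuumIdeal n p := by
  set U := Algebra.adjoin ℂ (Set.range (gen n 1)) with hU
  have hgen : ∀ j, gen n 1 j ∈ U := fun j => Algebra.subset_adjoin ⟨j, rfl⟩
  set P : UOsp n → UOsp n → Prop := fun x w => ∃ u₀ ∈ U, ∃ u₁ ∈ U,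
      ∀ p : ℕ, x * w - (u₀ + (p : ℂ) • u₁) ∈ vacuumIdeal n p with hP
  have hmem : ∀ {p : ℕ} {x y : UOsp n}, x ∈ vacuumIdeal n p → y = x → y ∈ vacuumIdeal n p :=
    fun h e => e ▸ h
  have hsmul : ∀ {p : ℕ} (c : ℂ) {x : UOsp n}, x ∈ vacuumIdeal n p → c • x ∈ vacuumIdeal n p := by
    intro p c x hx
    rw [Algebra.smul_def]
    exact Ideal.mul_mem_left _ _ hx
  -- The anticommutators must be carried along in the induction: moving `B_i^-` past the first
  -- letter creates one, while moving an anticommutator past a letter gives only a word free of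
  -- lowering operators. Thus no product of two weights, and no power `p ^ 2`, can arise.
  have key : ∀ w ∈ Submonoid.closure (Set.range (gen n 1)), w ∈ U ∧ (∀ i, P (gen n (-1) i) w) ∧
      ∀ i j, P (gen n 1 j * gen n (-1) i + gen n (-1) i * gen n 1 j) w := by
    intro w hw
    induction hw using Submonoid.closure_induction_left with
    | one =>
      refine ⟨one_mem _, fun i => ⟨0, zero_mem _, 0, zero_mem _, fun p => ?_⟩,
        fun i j => ⟨0, zero_mem _, (if j = i then (1 : ℂ) else 0) • 1,
          U.smul_mem (one_mem _) _, fun p => ?_⟩⟩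
      · refine hmem (Ideal.subset_span (Or.inl (Or.inl ⟨i, rfl⟩))) ?_
        simp
      -- The only source of `p`: an anticommutator acting directly on the vacuum.
      · refine hmem (Ideal.subset_span (Or.inr ⟨(j, i), rfl⟩)) ?_
        rw [mul_one, zero_add, smul_smul, ← Algebra.algebraMap_eq_smul_one]
        congr 2
        split_ifs <;> simp
    | mul_left x hx w _ ih =>
      obtain ⟨l, rfl⟩ := hx
      obtain ⟨hwU, ih1, ih2⟩ := ih
      refine ⟨mul_mem (hgen l) hwU, fun i => ?_, fun i j => ?_⟩
      · obtain ⟨u₀, h₀, u₁, h₁, h⟩ := ih1 i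
        obtain ⟨v₀, k₀, v₁, k₁, k⟩ := ih2 i l
        refine ⟨v₀ - gen n 1 l * u₀, sub_mem k₀ (mul_mem (hgen l) h₀),
          v₁ - gen n 1 l * u₁, sub_mem k₁ (mul_mem (hgen l) h₁), fun p => ?_⟩
        refine hmem (Ideal.sub_mem _ (k p) (Ideal.mul_mem_left _ (gen n 1 l) (h p))) ?_
        simp only [add_mul, mul_sub, mul_add, smul_sub, mul_smul_comm, mul_assoc]
        abel
      · obtain ⟨v₀, k₀, v₁, k₁, k⟩ := ih2 i j
        refine ⟨gen n 1 l * v₀ + (if i = l then (2 : ℂ) else 0) • (gen n 1 j * w),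
          add_mem (mul_mem (hgen l) k₀) (U.smul_mem (mul_mem (hgen j) hwU) _),
          gen n 1 l * v₁, mul_mem (hgen l) k₁, fun p => ?_⟩
        refine hmem (Ideal.mul_mem_left _ (gen n 1 l) (k p)) ?_
        rw [← mul_assoc, anticomm_mul_gen_pos]
        simp only [add_mul, mul_sub, mul_add, smul_mul_assoc, mul_smul_comm, mul_assoc]
        abel
  rw [hU, ← Subalgebra.mem_toSubmodule, Algebra.adjoin_eq_span] at hw
  change P (gen n (-1) i) w
  induction hw using Submodule.span_induction with
  | mem w hw => exact (key w hw).2.1 i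
  | zero =>
    refine ⟨0, zero_mem _, 0, zero_mem _, fun p => ?_⟩
    simp
  | add x y _ _ hx hy =>
    obtain ⟨u₀, h₀, u₁, h₁, h⟩ := hx
    obtain ⟨v₀, k₀, v₁, k₁, k⟩ := hy
    refine ⟨u₀ + v₀, add_mem h₀ k₀, u₁ + v₁, add_mem h₁ k₁, fun p => ?_⟩
    refine hmem (Ideal.add_mem _ (h p) (k p)) ?_
    rw [mul_add, smul_add]; abel
  | smul c x _ hx =>
    obtain ⟨u₀, h₀, u₁, h₁, h⟩ := hx
    refine ⟨c • u₀, U.smul_mem h₀ c, c • u₁, U.smul_mem h₁ c, fun p => ?_⟩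
    refine hmem (hsmul c (h p)) ?_
    rw [mul_smul_comm, smul_sub, smul_add, smul_comm c]

lemma subalgebra_tableauOp_mem {R : Type*} [Ring R] [Algebra ℂ R] (S : Subalgebra ℂ R)
    {b : Fin n → R} (hb : ∀ i, b i ∈ S) (A : Tableau n) : tableauOp b A ∈ S := by
  have := map_tableauOp S.val (fun i => (⟨b i, hb i⟩ : S)) A
  simp only [Subalgebra.coe_val] at this
  rw [← this]
  exact SetLike.coe_mem _

/-- The normalised tableau product in the enveloping algebra. -/
def tab (A : Tableau n) : UOsp n := (A.shapeFactorial : ℂ)⁻¹ • tableauOp (gen n 1) A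

lemma tab_mem_adjoin (A : Tableau n) : tab A ∈ Algebra.adjoin ℂ (Set.range (gen n 1)) :=
  Subalgebra.smul_mem _
    (subalgebra_tableauOp_mem (Algebra.adjoin ℂ (Set.range (gen n 1)))
      (fun i => Algebra.subset_adjoin (Set.mem_range_self i)) A) _

lemma tab_empty : tab (Tableau.empty n) = 1 := by
  simp [tab, tableauOp_empty, Tableau.shapeFactorial, Tableau.cols_empty]

lemma exists_eq_linearCombination_tab {u : UOsp n}
    (hu : u ∈ Algebra.adjoin ℂ (Set.range (gen n 1))) :
    ∃ c : Tableau n →₀ ℂ, Finsupp.linearCombination ℂ tab c = u := by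
  have h1 : u ∈ Submodule.span ℂ (Set.range (tableauOp (gen n 1))) :=
    adjoin_le_span_tableauOp (gen_pos_tripleComm n) hu
  have h2 : Submodule.span ℂ (Set.range (tableauOp (gen n 1)))
      ≤ Submodule.span ℂ (Set.range (tab : Tableau n → UOsp n)) := by
    rw [Submodule.span_le]
    rintro _ ⟨A, rfl⟩
    have : tableauOp (gen n 1) A = (A.shapeFactorial : ℂ) • tab A := by
      rw [tab, smul_smul, mul_inv_cancel₀ (shapeFactorial_ne_zero A), one_smul]
    rw [this]
    exact Submodule.smul_mem _ _ (Submodule.subset_span ⟨A, rfl⟩)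
  exact Finsupp.mem_span_range_iff_exists_finsupp.1 (h2 h1)

lemma exists_raising (i : Fin n) (A : Tableau n) : ∃ c : Tableau n →₀ ℂ,
    gen n 1 i * tab A = Finsupp.linearCombination ℂ tab c := by
  obtain ⟨c, hc⟩ := exists_eq_linearCombination_tab
    (mul_mem (Algebra.subset_adjoin ⟨i, rfl⟩) (tab_mem_adjoin A))
  exact ⟨c, hc.symm⟩

/-- The order of the quantifiers is the point: one pair of coefficient vectors serves all `p`, which
makes interpolation possible. -/
lemma exists_lowering_tab (i : Fin n) (A : Tableau n) : ∃ c₀ c₁ : Tableau n →₀ ℂ, ∀ p : ℕ,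
    gen n (-1) i * tab A - Finsupp.linearCombination ℂ tab (c₀ + (p : ℂ) • c₁)
      ∈ vacuumIdeal n p := by
  obtain ⟨u₀, h₀, u₁, h₁, h⟩ := exists_lowering i (tab_mem_adjoin A)
  obtain ⟨c₀, rfl⟩ := exists_eq_linearCombination_tab h₀
  obtain ⟨c₁, rfl⟩ := exists_eq_linearCombination_tab h₁
  exact ⟨c₀, c₁, fun p => by simpa using h p⟩

/-- The coefficients of `B_i^+` on the normalised tableau products. -/
def raise (i : Fin n) (A : Tableau n) : Tableau n →₀ ℂ := (exists_raising i A).choose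

lemma gen_pos_mul_tab (i : Fin n) (A : Tableau n) :
    gen n 1 i * tab A = Finsupp.linearCombination ℂ tab (raise i A) :=
  (exists_raising i A).choose_spec

/-- The constant part of the coefficients of `B_i^-`. -/
def lowerConst (i : Fin n) (A : Tableau n) : Tableau n →₀ ℂ := (exists_lowering_tab i A).choose

/-- The part of the coefficients of `B_i^-` that is linear in `p`. -/
def lowerLin (i : Fin n) (A : Tableau n) : Tableau n →₀ ℂ :=
  (exists_lowering_tab i A).choose_spec.choose

lemma gen_neg_mul_tab (i : Fin n) (A : Tableau n) (p : ℕ) :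
    gen n (-1) i * tab A
      - Finsupp.linearCombination ℂ tab (lowerConst i A + (p : ℂ) • lowerLin i A)
      ∈ vacuumIdeal n p :=
  (exists_lowering_tab i A).choose_spec.choose_spec p

end Enveloping

/-! ### The actions on the tableau vectors -/

section Actions

variable {n : ℕ}

/-- The map `u ↦ u|0⟩`. -/
def toVBar (n p : ℕ) : UOsp n →ₗ[ℂ] VBar n p :=
  (LinearMap.toSpanSingleton (UOsp n) (VBar n p) (vacuum n p)).restrictScalars ℂ

lemma toVBar_apply (n p : ℕ) (u : UOsp n) : toVBar n p u = u • vacuum n p := rfl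

lemma toVBar_eq_mk (n p : ℕ) (u : UOsp n) :
    toVBar n p u = (Submodule.Quotient.mk u : UOsp n ⧸ vacuumIdeal n p) := by
  have h : u • (Submodule.Quotient.mk 1 : UOsp n ⧸ vacuumIdeal n p)
      = Submodule.Quotient.mk (u • 1) := rfl
  rw [toVBar_apply]
  refine h.trans ?_
  rw [smul_eq_mul, mul_one]

lemma toVBar_eq_zero_iff (n p : ℕ) (u : UOsp n) : toVBar n p u = 0 ↔ u ∈ vacuumIdeal n p := by
  rw [toVBar_eq_mk]
  exact Submodule.Quotient.mk_eq_zero _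

lemma toVBar_surjective (n p : ℕ) : Function.Surjective (toVBar n p) := by
  intro w
  obtain ⟨u, hu⟩ := Submodule.Quotient.mk_surjective (vacuumIdeal n p) w
  exact ⟨u, (toVBar_eq_mk n p u).trans hu⟩

/-- The map `u ↦ u(1)`. -/
def toClPoly (n q : ℕ) : UOsp n →ₗ[ℂ] ClPoly n q :=
  (LinearMap.applyₗ (1 : ClPoly n q)) ∘ₗ (realization n q).toLinearMap

lemma toClPoly_apply (n q : ℕ) (u : UOsp n) : toClPoly n q u = realization n q u 1 := rfl

lemma toVBar_tab (n p : ℕ) (A : Tableau n) : toVBar n p (tab A) = vTilde n p A := by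
  rw [tab, map_smul, toVBar_apply]; rfl

lemma toClPoly_tab (n q : ℕ) (A : Tableau n) : toClPoly n q (tab A) = ωTilde n q A := by
  have h : (fun i => realization n q (gen n 1 i)) = X n q :=
    funext fun i => realization_gen_pos n q i
  rw [tab, map_smul, toClPoly_apply, map_tableauOp, h]; rfl

lemma map_linearCombination_tab {M : Type*} [AddCommGroup M] [Module ℂ M] (f : UOsp n →ₗ[ℂ] M)
    {g : Tableau n → M} (h : ∀ A, f (tab A) = g A) (c : Tableau n →₀ ℂ) :
    f (Finsupp.linearCombination ℂ tab c) = Finsupp.linearCombination ℂ g c := by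
  rw [Finsupp.apply_linearCombination]
  congr 2
  exact funext h

lemma gen_pos_smul_vTilde (p : ℕ) (i : Fin n) (A : Tableau n) :
    gen n 1 i • vTilde n p A = Finsupp.linearCombination ℂ (vTilde n p) (raise i A) := by
  rw [← map_linearCombination_tab (toVBar n p) (toVBar_tab n p), ← gen_pos_mul_tab,
    ← toVBar_tab, toVBar_apply, toVBar_apply, mul_smul]

lemma gen_neg_smul_vTilde (p : ℕ) (i : Fin n) (A : Tableau n) :
    gen n (-1) i • vTilde n p A = Finsupp.linearCombination ℂ (vTilde n p)
      (lowerConst i A + (p : ℂ) • lowerLin i A) := by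
  have h := (toVBar_eq_zero_iff n p _).2 (gen_neg_mul_tab i A p)
  rw [map_sub, sub_eq_zero] at h
  rw [← map_linearCombination_tab (toVBar n p) (toVBar_tab n p), ← h,
    ← toVBar_tab, toVBar_apply, toVBar_apply, mul_smul]

lemma X_ωTilde (q : ℕ) (i : Fin n) (A : Tableau n) :
    X n q i (ωTilde n q A) = Finsupp.linearCombination ℂ (ωTilde n q) (raise i A) := by
  rw [← map_linearCombination_tab (toClPoly n q) (toClPoly_tab n q), ← gen_pos_mul_tab,
    ← toClPoly_tab, toClPoly_apply, toClPoly_apply, map_mul, realization_gen_pos,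
    Module.End.mul_apply]

/-- The universal coefficients at `p = q`, transported by `u ↦ u(1)`. The expansion is valid for all
`q`, although for `q < n` it may contain vanishing vectors. -/
lemma D_ωTilde (q : ℕ) (i : Fin n) (A : Tableau n) :
    D n q i (ωTilde n q A) = Finsupp.linearCombination ℂ (ωTilde n q)
      (lowerConst i A + (q : ℂ) • lowerLin i A) := by
  have h := realization_one_of_mem n q (gen_neg_mul_tab i A q)
  rw [← toClPoly_apply, map_sub, sub_eq_zero] at h
  rw [← map_linearCombination_tab (toClPoly n q) (toClPoly_tab n q), ← h,
    ← toClPoly_tab, toClPoly_apply, toClPoly_apply, map_mul, realization_gen_neg,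
    Module.End.mul_apply]

lemma linearIndependent_ωTilde_of_le {q : ℕ} (h : n ≤ q) : LinearIndependent ℂ (ωTilde n q) :=
  (linearIndependent_ωTilde n q).comp (fun A : Tableau n => ⟨A, A.rows_le.trans h⟩)
    fun _ _ hAB => congrArg Subtype.val hAB

/-- A tableau has at most `n` rows, so for `q ≥ n` the row condition is empty and independence makes
the chosen coordinates unique. -/
lemma coords_linearCombination {q : ℕ} (h : n ≤ q) (c : Tableau n →₀ ℂ) :
    coords n q (Finsupp.linearCombination ℂ (ωTilde n q) c) = c := by
  have hex : ∃ d : Tableau n →₀ ℂ, (∀ B, q < B.rows → d B = 0) ∧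
      Finsupp.linearCombination ℂ (ωTilde n q) c = Finsupp.linearCombination ℂ (ωTilde n q) d :=
    ⟨c, fun B hB => absurd (hB.trans_le B.rows_le) (not_lt.2 h), rfl⟩
  exact (linearIndependent_ωTilde_of_le h (Classical.epsilon_spec hex).2).symm

lemma cBar_eq (i : Fin n) (A : Tableau n) : cBar n n i A = raise i A := by
  rw [cBar, X_ωTilde, coords_linearCombination le_rfl]

lemma cHat_eq {q : ℕ} (h : n ≤ q) (i : Fin n) (A : Tableau n) :
    cHat n q i A = lowerConst i A + (q : ℂ) • lowerLin i A := by
  rw [cHat, D_ωTilde, coords_linearCombination h]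

/-- An affine function satisfies `f p = (n + 1 - p) f n - (n - p) f (n + 1)`. At the nodes `n` and
`n + 1` all tableau vectors are independent, so `cHat` gives the universal coefficients there. -/
lemma interpolation (p : ℕ) (i : Fin n) (A : Tableau n) :
    ((n : ℂ) + 1 - p) • cHat n n i A - ((n : ℂ) - p) • cHat n (n + 1) i A
      = lowerConst i A + (p : ℂ) • lowerLin i A := by
  rw [cHat_eq le_rfl, cHat_eq (Nat.le_succ n)]
  push_cast
  module

lemma linearCombination_ωTilde_filter (q : ℕ) (c : Tableau n →₀ ℂ) :
    Finsupp.linearCombination ℂ (ωTilde n q) (c.filter fun B => B.rows ≤ q)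
      = Finsupp.linearCombination ℂ (ωTilde n q) c := by
  conv_rhs => rw [← Finsupp.filter_add_filter_not c fun B => B.rows ≤ q]
  rw [map_add, left_eq_add, Finsupp.linearCombination_apply]
  refine Finset.sum_eq_zero fun B hB => ?_
  rw [Finsupp.support_filter, Finset.mem_filter] at hB
  change _ • ωTilde n q B = 0
  rw [ωTilde_eq_zero n q B (not_le.1 hB.2), smul_zero]

/-! ### Spanning -/

/-- The span of the tableau vectors contains the vacuum, as the vector of the empty tableau, and is
stable under all generators. -/
lemma exists_sub_linearCombination_mem (p : ℕ) (u : UOsp n) :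
    ∃ c : Tableau n →₀ ℂ, u - Finsupp.linearCombination ℂ tab c ∈ vacuumIdeal n p := by
  set W : Submodule ℂ (VBar n p) := Submodule.span ℂ (Set.range (vTilde n p)) with hW
  have hlc : ∀ c, Finsupp.linearCombination ℂ (vTilde n p) c ∈ W := fun c =>
    Finsupp.mem_span_range_iff_exists_finsupp.2 ⟨c, rfl⟩
  have hgen : ∀ (ξ : ℤˣ) (i : Fin n), ∀ w ∈ W, gen n ξ i • w ∈ W := by
    intro ξ i w hw
    induction hw using Submodule.span_induction with
    | zero => rw [smul_zero]; exact zero_mem _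
    | add x y _ _ hx hy => rw [smul_add]; exact add_mem hx hy
    | smul c x _ hx => rw [smul_comm]; exact W.smul_mem c hx
    | mem x hx =>
      obtain ⟨A, rfl⟩ := hx
      rcases Int.units_eq_one_or ξ with rfl | rfl
      · rw [gen_pos_smul_vTilde]; exact hlc _
      · rw [gen_neg_smul_vTilde]; exact hlc _
  have hall : ∀ w ∈ W, u • w ∈ W := by
    have hu : u ∈ Algebra.adjoin ℂ (Set.range fun a : ℤˣ × Fin n => gen n a.1 a.2) := by
      rw [adjoin_gen]; trivial
    induction hu using Algebra.adjoin_induction with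
    | mem x hx => obtain ⟨a, rfl⟩ := hx; exact hgen a.1 a.2
    | algebraMap r => intro w hw; rw [algebraMap_smul]; exact W.smul_mem r hw
    | add x y _ _ hx hy => intro w hw; rw [add_smul]; exact add_mem (hx w hw) (hy w hw)
    | mul x y _ _ hx hy => intro w hw; rw [mul_smul]; exact hx _ (hy w hw)
  have h1 : vTilde n p (Tableau.empty n) = vacuum n p := by
    rw [← toVBar_tab, tab_empty, toVBar_apply, one_smul]
  have h2 : toVBar n p u ∈ W := by
    rw [toVBar_apply, ← h1]
    exact hall _ (Submodule.subset_span ⟨_, rfl⟩)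
  obtain ⟨c, hc⟩ := Finsupp.mem_span_range_iff_exists_finsupp.1 h2
  refine ⟨c, (toVBar_eq_zero_iff n p _).1 ?_⟩
  rw [map_sub, map_linearCombination_tab (toVBar n p) (toVBar_tab n p), sub_eq_zero]
  exact hc.symm

lemma span_vTilde (n p : ℕ) : Submodule.span ℂ (Set.range (vTilde n p)) = ⊤ := by
  rw [eq_top_iff]
  intro w _
  obtain ⟨u, rfl⟩ := toVBar_surjective n p w
  obtain ⟨c, hc⟩ := exists_sub_linearCombination_mem p u
  rw [← toVBar_eq_zero_iff, map_sub, map_linearCombination_tab (toVBar n p) (toVBar_tab n p),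
    sub_eq_zero] at hc
  exact Finsupp.mem_span_range_iff_exists_finsupp.2 ⟨c, hc.symm⟩

/-- The operators in question come from the enveloping algebra, where any element reduces to tableau
products modulo the vacuum ideal; tableaux with too many rows give zero. -/
lemma span_ωTilde (n q : ℕ) :
    Submodule.span ℂ (Set.range fun A : {A : Tableau n // A.rows ≤ q} => ωTilde n q A.1)
      = L n q := by
  apply le_antisymm
  · rw [Submodule.span_le]
    rintro _ ⟨A, rfl⟩
    refine Submodule.smul_mem _ _ ⟨tableauOp (X n q) A.1, ?_, rfl⟩
    exact subalgebra_tableauOp_mem (Algebra.adjoin ℂ (Set.range (X n q) ∪ Set.range (D n q)))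
      (fun i => Algebra.subset_adjoin (Or.inl (Set.mem_range_self i))) A.1
  · rintro _ ⟨a, ha, rfl⟩
    have hle : Algebra.adjoin ℂ (Set.range (X n q) ∪ Set.range (D n q))
        ≤ (realization n q).range := by
      rw [Algebra.adjoin_le_iff]
      rintro _ (⟨i, rfl⟩ | ⟨i, rfl⟩)
      · exact ⟨gen n 1 i, realization_gen_pos n q i⟩
      · exact ⟨gen n (-1) i, realization_gen_neg n q i⟩
    obtain ⟨u, rfl⟩ := hle ha
    obtain ⟨c, hc⟩ := exists_sub_linearCombination_mem q u
    have h := realization_one_of_mem n q hc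
    rw [← toClPoly_apply, map_sub, map_linearCombination_tab (toClPoly n q) (toClPoly_tab n q),
      sub_eq_zero] at h
    change toClPoly n q u ∈ _
    rw [h, Finsupp.linearCombination_apply]
    refine Submodule.sum_mem _ fun A _ => Submodule.smul_mem _ _ ?_
    by_cases hA : A.rows ≤ q
    · exact Submodule.subset_span ⟨⟨A, hA⟩, rfl⟩
    · rw [ωTilde_eq_zero n q A (not_le.1 hA)]; exact zero_mem _

end Actions

/-! ### Polynomial dependence on a parameter -/

section PolynomialFamily

variable {M : Type*} [AddCommGroup M] [Module ℂ M]

/-- The families of vectors that depend polynomially on a complex parameter. -/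
def polyFamily (M : Type*) [AddCommGroup M] [Module ℂ M] : Submodule ℂ (ℂ → M) :=
  Submodule.span ℂ (Set.range fun a : ℕ × M => fun p : ℂ => p ^ a.1 • a.2)

lemma const_mem_polyFamily (m : M) : (fun _ : ℂ => m) ∈ polyFamily M :=
  Submodule.subset_span ⟨(0, m), by simp⟩

lemma map_mem_polyFamily (T : Module.End ℂ M) {f : ℂ → M} (hf : f ∈ polyFamily M) :
    (fun p => T (f p)) ∈ polyFamily M := by
  have h : (polyFamily M) ≤ (polyFamily M).comap (T.compLeft ℂ) := by
    rw [polyFamily, Submodule.span_le]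
    rintro _ ⟨a, rfl⟩
    refine Submodule.subset_span ⟨(a.1, T a.2), ?_⟩
    ext p; simp
  exact h hf

lemma smul_mem_polyFamily {f : ℂ → M} (hf : f ∈ polyFamily M) :
    (fun p => p • f p) ∈ polyFamily M := by
  induction hf using Submodule.span_induction with
  | zero =>
    simp only [Pi.zero_apply, smul_zero]
    exact zero_mem (polyFamily M)
  | add x y _ _ hx hy =>
    simp only [Pi.add_apply, smul_add]
    exact add_mem hx hy
  | smul c x _ hx =>
    have := (polyFamily M).smul_mem c hx
    convert this using 1
    ext p; simp only [Pi.smul_apply]; rw [smul_comm]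
  | mem x hx =>
    obtain ⟨a, rfl⟩ := hx
    refine Submodule.subset_span ⟨(a.1 + 1, a.2), ?_⟩
    ext p; simp only [smul_smul]; rw [pow_succ']

lemma exists_polynomial_of_mem_polyFamily {f : ℂ → M} (hf : f ∈ polyFamily M) (l : M →ₗ[ℂ] ℂ) :
    ∃ P : Polynomial ℂ, ∀ p, l (f p) = P.eval p := by
  induction hf using Submodule.span_induction with
  | zero => exact ⟨0, by simp⟩
  | add x y _ _ hx hy =>
    obtain ⟨P, hP⟩ := hx
    obtain ⟨Q, hQ⟩ := hy
    exact ⟨P + Q, fun p => by simp [hP, hQ]⟩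
  | smul c x _ hx =>
    obtain ⟨P, hP⟩ := hx
    exact ⟨c • P, fun p => by simp [hP]⟩
  | mem x hx =>
    obtain ⟨a, rfl⟩ := hx
    exact ⟨Polynomial.C (l a.2) * Polynomial.X ^ a.1, fun p => by
      rw [map_smul, Polynomial.eval_mul, Polynomial.eval_C, Polynomial.eval_pow,
        Polynomial.eval_X, smul_eq_mul, mul_comm]⟩

/-- A polynomial family that vanishes at all large natural numbers vanishes identically. -/
lemma eq_zero_of_mem_polyFamily {ι : Type*} {f : ℂ → ι →₀ ℂ} (hf : f ∈ polyFamily (ι →₀ ℂ))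
    {n : ℕ} (h : ∀ q : ℕ, n ≤ q → f q = 0) (p : ℂ) : f p = 0 := by
  ext B
  obtain ⟨P, hP⟩ := exists_polynomial_of_mem_polyFamily hf (Finsupp.lapply B)
  have hP0 : P = 0 := by
    apply Polynomial.eq_zero_of_infinite_isRoot
    refine Set.Infinite.mono (s := (Nat.cast : ℕ → ℂ) '' Set.Ici n) ?_
      ((Set.Ici_infinite n).image Nat.cast_injective.injOn)
    rintro _ ⟨q, hq, rfl⟩
    change P.eval _ = 0
    rw [← hP, h q hq, map_zero]
  have := hP p
  rwa [hP0, Polynomial.eval_zero] at this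

end PolynomialFamily

/-! ### The representation on the span of all tableaux -/

section TableauModule

variable {n : ℕ}

/-- The operator by which `B_i^ξ` acts on the formal span of all tableaux, at the parameter `p`. -/
def tabOp (n : ℕ) (p : ℂ) (ξ : ℤˣ) (i : Fin n) : Module.End ℂ (Tableau n →₀ ℂ) :=
  if ξ = 1 then Finsupp.linearCombination ℂ (raise i)
  else Finsupp.linearCombination ℂ (lowerConst i) + p • Finsupp.linearCombination ℂ (lowerLin i)

lemma tabOp_mem_polyFamily (ξ : ℤˣ) (i : Fin n) {f : ℂ → Tableau n →₀ ℂ}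
    (hf : f ∈ polyFamily (Tableau n →₀ ℂ)) :
    (fun p => tabOp n p ξ i (f p)) ∈ polyFamily (Tableau n →₀ ℂ) := by
  by_cases hξ : ξ = 1
  · simp only [tabOp, if_pos hξ]
    exact map_mem_polyFamily _ hf
  · simp only [tabOp, if_neg hξ, LinearMap.add_apply, LinearMap.smul_apply]
    exact add_mem (map_mem_polyFamily _ hf) (smul_mem_polyFamily (map_mem_polyFamily _ hf))

lemma linearCombination_ωTilde_injective {q : ℕ} (h : n ≤ q) :
    Function.Injective (Finsupp.linearCombination ℂ (ωTilde n q)) :=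
  linearIndependent_ωTilde_of_le h

lemma linearCombination_ωTilde_tabOp (q : ℕ) (ξ : ℤˣ) (i : Fin n) (m : Tableau n →₀ ℂ) :
    Finsupp.linearCombination ℂ (ωTilde n q) (tabOp n q ξ i m)
      = realOp n q ξ i (Finsupp.linearCombination ℂ (ωTilde n q) m) := by
  induction m using Finsupp.induction_linear with
  | zero => simp
  | add x y hx hy => simp only [map_add, hx, hy]
  | single A c =>
    rw [tabOp, realOp]
    split_ifs
    · rw [Finsupp.linearCombination_single, map_smul, Finsupp.linearCombination_single, map_smul,
        X_ωTilde]
    · rw [LinearMap.add_apply, LinearMap.smul_apply, Finsupp.linearCombination_single,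
        Finsupp.linearCombination_single, smul_comm, ← smul_add, map_smul,
        Finsupp.linearCombination_single, map_smul, D_ωTilde]

lemma ωTilde_empty (n q : ℕ) : ωTilde n q (Tableau.empty n) = 1 := by
  rw [← toClPoly_tab, tab_empty, toClPoly_apply, map_one (realization n q)]; rfl

/-- Applied to a fixed vector, the defect of the relation is polynomial in `p`. At an integer `q ≥
n` the formal span embeds equivariantly into the Clifford polynomials, where the relation holds, so
the polynomial has infinitely many zeros. -/
lemma tabOp_triple (p : ℂ) (i j l : Fin n) (ξ η ζ : ℤˣ) :
    (tabOp n p ξ i * tabOp n p η j + tabOp n p η j * tabOp n p ξ i) * tabOp n p ζ l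
      - tabOp n p ζ l * (tabOp n p ξ i * tabOp n p η j + tabOp n p η j * tabOp n p ξ i)
      = (if i = l then (((ζ : ℤ) - (ξ : ℤ) : ℤ) : ℂ) else 0) • tabOp n p η j
          + (if j = l then (((ζ : ℤ) - (η : ℤ) : ℤ) : ℂ) else 0) • tabOp n p ξ i := by
  refine LinearMap.ext fun m => ?_
  have h0 := const_mem_polyFamily m
  -- In `h2` and `h3` the arguments follow the order of application, the reverse of the order in an
  -- operator product.
  have h1 : ∀ ξ i, _ := fun ξ i => tabOp_mem_polyFamily (n := n) ξ i h0
  have h2 : ∀ ξ i η j, _ := fun ξ i η j => tabOp_mem_polyFamily (n := n) η j (h1 ξ i)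
  have h3 : ∀ ξ i η j ζ l, _ := fun ξ i η j ζ l => tabOp_mem_polyFamily (n := n) ζ l (h2 ξ i η j)
  have hmem := sub_mem (sub_mem (add_mem (h3 ζ l η j ξ i) (h3 ζ l ξ i η j))
      (add_mem (h3 η j ξ i ζ l) (h3 ξ i η j ζ l)))
    (add_mem (Submodule.smul_mem _ (if i = l then (((ζ : ℤ) - (ξ : ℤ) : ℤ) : ℂ) else 0) (h1 η j))
      (Submodule.smul_mem _ (if j = l then (((ζ : ℤ) - (η : ℤ) : ℤ) : ℂ) else 0) (h1 ξ i)))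
  have key := eq_zero_of_mem_polyFamily hmem (n := n) (fun q hq => by
    apply linearCombination_ωTilde_injective hq
    have h := LinearMap.congr_fun (realOp_triple n q i j l ξ η ζ)
      (Finsupp.linearCombination ℂ (ωTilde n q) m)
    rw [← sub_eq_zero] at h
    simp only [LinearMap.sub_apply, LinearMap.add_apply, Module.End.mul_apply, map_add,
      LinearMap.smul_apply] at h
    simp only [Pi.sub_apply, Pi.add_apply, Pi.smul_apply, map_sub, map_add, map_smul,
      linearCombination_ωTilde_tabOp, map_zero]
    exact h) p
  rw [← sub_eq_zero]
  simp only [LinearMap.sub_apply, LinearMap.add_apply, Module.End.mul_apply, map_add,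
    LinearMap.smul_apply]
  exact key

lemma tabOp_neg_empty (p : ℂ) (i : Fin n) :
    tabOp n p (-1) i (Finsupp.single (Tableau.empty n) 1) = 0 := by
  refine eq_zero_of_mem_polyFamily (f := fun p => tabOp n p (-1) i _) (n := n)
    (tabOp_mem_polyFamily (-1) i (const_mem_polyFamily _)) (fun q hq => ?_) p
  apply linearCombination_ωTilde_injective hq
  rw [linearCombination_ωTilde_tabOp, Finsupp.linearCombination_single, one_smul, ωTilde_empty,
    realOp, if_neg (by decide), D_one, map_zero]

lemma tabOp_anticomm_empty (p : ℂ) (i j : Fin n) :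
    (tabOp n p 1 i * tabOp n p (-1) j + tabOp n p (-1) j * tabOp n p 1 i)
        (Finsupp.single (Tableau.empty n) 1)
      = (if i = j then p else 0) • Finsupp.single (Tableau.empty n) 1 := by
  rw [LinearMap.add_apply, Module.End.mul_apply, tabOp_neg_empty, map_zero, zero_add,
    Module.End.mul_apply, ← sub_eq_zero]
  set m : Tableau n →₀ ℂ := Finsupp.single (Tableau.empty n) 1 with hm
  have h0 := const_mem_polyFamily m
  have hmem := sub_mem (tabOp_mem_polyFamily (-1) j (tabOp_mem_polyFamily 1 i h0))
    (Submodule.smul_mem _ (if i = j then (1 : ℂ) else 0) (smul_mem_polyFamily h0))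
  have key := eq_zero_of_mem_polyFamily hmem (n := n) (fun q hq => by
    apply linearCombination_ωTilde_injective hq
    have h := D_mul_X_add_X_mul_D_one n q i j
    rw [LinearMap.add_apply, Module.End.mul_apply, Module.End.mul_apply, D_one, map_zero,
      add_zero] at h
    have hω : Finsupp.linearCombination ℂ (ωTilde n q) m = 1 := by
      rw [hm, Finsupp.linearCombination_single, one_smul, ωTilde_empty]
    simp only [Pi.sub_apply, Pi.smul_apply, map_sub, map_smul,
      linearCombination_ωTilde_tabOp, map_zero, hω]
    rw [realOp, if_neg (by decide), realOp, if_pos rfl, h, smul_smul]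
    simp) p
  simpa only [Pi.sub_apply, Pi.smul_apply, smul_smul, ite_mul, one_mul, zero_mul] using key

/-- The representation of `osp(1|2n)` on the formal span of all tableaux. -/
def tabRep (n : ℕ) (p : ℂ) : UOsp n →ₐ[ℂ] Module.End ℂ (Tableau n →₀ ℂ) :=
  RingQuot.liftAlgHom ℂ (s := Rel n)
    ⟨FreeAlgebra.lift ℂ fun a => tabOp n p a.2 a.1, by
      rintro _ _ ⟨i, j, l, ξ, η, ζ⟩
      simp only [map_sub, map_mul, map_add, map_smul, FreeAlgebra.lift_ι_apply]
      exact tabOp_triple p i j l ξ η ζ⟩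

lemma tabRep_gen (p : ℂ) (ξ : ℤˣ) (i : Fin n) : tabRep n p (gen n ξ i) = tabOp n p ξ i := by
  have := RingQuot.liftAlgHom_mkAlgHom_apply ℂ (s := Rel n)
    (FreeAlgebra.lift ℂ fun a => tabOp n p a.2 a.1) (by
      rintro _ _ ⟨i, j, l, ξ, η, ζ⟩
      simp only [map_sub, map_mul, map_add, map_smul, FreeAlgebra.lift_ι_apply]
      exact tabOp_triple p i j l ξ η ζ) (FreeAlgebra.ι ℂ (i, ξ))
  rw [FreeAlgebra.lift_ι_apply] at this
  exact this

lemma tabRep_empty_of_mem {p : ℕ} {u : UOsp n} (hu : u ∈ vacuumIdeal n p) :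
    tabRep n p u (Finsupp.single (Tableau.empty n) 1) = 0 := by
  rw [vacuumIdeal] at hu
  induction hu using Submodule.span_induction with
  | zero => simp
  | add x y _ _ hx hy => rw [map_add, LinearMap.add_apply, hx, hy, add_zero]
  | smul a x _ hx => rw [smul_eq_mul, map_mul, Module.End.mul_apply, hx, map_zero]
  | mem x hx =>
    rcases hx with (⟨i, rfl⟩ | ⟨ij, rfl⟩) | ⟨⟨i, j⟩, rfl⟩
    · simp only [tabRep_gen, tabOp_neg_empty]
    · simp only [map_add, map_mul, tabRep_gen, LinearMap.add_apply, Module.End.mul_apply,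
        tabOp_neg_empty, map_zero, add_zero]
    · simp only [map_sub, map_add, map_mul, tabRep_gen, AlgHom.commutes]
      rw [LinearMap.sub_apply, tabOp_anticomm_empty, Module.algebraMap_end_apply, sub_self]

lemma tabOp_one_eq (p p' : ℂ) (i : Fin n) : tabOp n p 1 i = tabOp n p' 1 i := by
  simp only [tabOp, if_true]

/-- Only raising operators occur in `tab A`, and these do not depend on the parameter. The
comparison with Clifford polynomials at `q = n` therefore applies for every `p`. -/
lemma tabRep_tab_empty (p : ℂ) (A : Tableau n) :
    tabRep n p (tab A) (Finsupp.single (Tableau.empty n) 1) = Finsupp.single A 1 := by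
  apply linearCombination_ωTilde_injective (le_refl n)
  set φ := Finsupp.linearCombination ℂ (ωTilde n n)
  have h1 : ∀ u ∈ Algebra.adjoin ℂ (Set.range (gen n 1)), ∀ m,
      φ (tabRep n p u m) = realization n n u (φ m) := by
    intro u hu
    induction hu using Algebra.adjoin_induction with
    | mem x hx =>
      obtain ⟨i, rfl⟩ := hx
      intro m
      rw [tabRep_gen, realization_gen, tabOp_one_eq p n, linearCombination_ωTilde_tabOp]
    | algebraMap r =>
      intro m
      rw [AlgHom.commutes, AlgHom.commutes, Module.algebraMap_end_apply,
        Module.algebraMap_end_apply, map_smul]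
    | add x y _ _ hx hy =>
      intro m
      rw [map_add, map_add, LinearMap.add_apply, LinearMap.add_apply, map_add, hx, hy]
    | mul x y _ _ hx hy =>
      intro m
      rw [map_mul, map_mul, Module.End.mul_apply, Module.End.mul_apply, hx, hy]
  rw [h1 _ (tab_mem_adjoin A), Finsupp.linearCombination_single, one_smul, ωTilde_empty,
    Finsupp.linearCombination_single, one_smul, ← toClPoly_apply, toClPoly_tab]

/-- Acting on the empty tableau in `tabRep` annihilates the vacuum ideal and sends `tab A` to the
basis vector of `A`. A relation among the `vTilde` thus becomes one among basis vectors. -/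
lemma linearIndependent_vTilde (n p : ℕ) : LinearIndependent ℂ (vTilde n p) := by
  rw [linearIndependent_iff]
  intro c hc
  rw [← map_linearCombination_tab (toVBar n p) (toVBar_tab n p), toVBar_eq_zero_iff] at hc
  have h := tabRep_empty_of_mem hc
  have h2 := map_linearCombination_tab
    ((LinearMap.applyₗ (Finsupp.single (Tableau.empty n) (1 : ℂ))) ∘ₗ (tabRep n p).toLinearMap)
    (tabRep_tab_empty (n := n) p) c
  have h3 : Finsupp.linearCombination ℂ (fun A => Finsupp.single A (1 : ℂ)) c = c := by
    rw [Finsupp.linearCombination_apply]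
    simp only [Finsupp.smul_single, smul_eq_mul, mul_one]
    exact Finsupp.sum_single c
  rw [h3] at h2
  exact h2.symm.trans h

end TableauModule

end

end Paraboson

/-! ### The matrix elements in both modules -/

open Paraboson in
theorem proposition6p5 (n p : ℕ) (hn : 0 < n) (hp : 0 < p) :
    -- the tableau vectors are bases, so that all matrix elements below are well defined
    (∀ q : ℕ, 0 < q →
      LinearIndependent ℂ (fun A : {A : Tableau n // A.rows ≤ q} => ωTilde n q A.1) ∧
      Submodule.span ℂ (Set.range fun A : {A : Tableau n // A.rows ≤ q} => ωTilde n q A.1)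
        = L n q) ∧
    LinearIndependent ℂ (vTilde n p) ∧
    Submodule.span ℂ (Set.range (vTilde n p)) = ⊤ ∧
    -- the actions on the induced module
    (∀ (i : Fin n) (A : Tableau n),
      gen n 1 i • vTilde n p A
        = Finsupp.linearCombination ℂ (vTilde n p) (cBar n n i A) ∧
      gen n (-1) i • vTilde n p A
        = Finsupp.linearCombination ℂ (vTilde n p)
            (((n : ℂ) + 1 - p) • cHat n n i A - ((n : ℂ) - p) • cHat n (n + 1) i A)) ∧
    -- the actions on `L_n(p)`, with sums only over tableaux with at most `p` rows
    (∀ (i : Fin n) (A : Tableau n), A.rows ≤ p →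
      X n p i (ωTilde n p A)
        = Finsupp.linearCombination ℂ (ωTilde n p)
            ((cBar n n i A).filter fun B => B.rows ≤ p) ∧
      D n p i (ωTilde n p A)
        = Finsupp.linearCombination ℂ (ωTilde n p)
            ((((n : ℂ) + 1 - p) • cHat n n i A
              - ((n : ℂ) - p) • cHat n (n + 1) i A).filter fun B => B.rows ≤ p)) := by
  refine ⟨fun q _ => ⟨linearIndependent_ωTilde n q, span_ωTilde n q⟩,
    linearIndependent_vTilde n p, span_vTilde n p, fun i A => ⟨?_, ?_⟩, fun i A _ => ⟨?_, ?_⟩⟩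
  · rw [cBar_eq, gen_pos_smul_vTilde]
  · rw [interpolation, gen_neg_smul_vTilde]
  · rw [cBar_eq, linearCombination_ωTilde_filter, X_ωTilde]
  · rw [interpolation, linearCombination_ωTilde_filter, D_ωTilde]
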